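/- Let $M_1\subset\mathbb{R}^2$ be the $\mathbb{Z}[\sqrt2]$-lattice generated by $(\sqrt2,0)$ and $(1,1)$, and for $m\ge 1$ let $M_m=M_1^{\otimes m}\subset(\mathbb{R}^2)^{\otimes m}=\mathbb{R}^{2^m}$ be its $m$-fold tensor power over $\mathbb{Z}[\sqrt2]$ (the balanced Barnes-Wall lattice). Let the Clifford group $\mathcal{C}_m=\mathrm{Aut}(M_m)$ be the subgroup of the orthogonal group $O(2^m,\mathbb{R})$ consisting of the elements that map $M_m$ onto itself, and let $$\Phi_m(t)=\sum_{d\ge 0} a_d(m)\,t^d$$ be its Molien series, where $a_d(m)$ is the dimension of the real vector space of homogeneous polynomials of degree $d$ in $2^m$ variables with real coefficients that are fixed by every element of $\mathcal{C}_m$. Then for every integer $m\ge 1$ $$\Phi_m(t)=1+t^2+t^4+t^6+2t^8+2t^{10}+O(t^{12})$$ as formal power series, and the coefficient of $t^{12}$ in $\Phi_m(t)$ is $2$ if $m=1$ and $3$ if $m>1$. -/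

import Mathlib

noncomputable section

namespace BarnesWall

/-- Coordinates of `ℝ ^ (2 ^ m) = (ℝ ^ 2) ^ ⊗ m` are indexed by the `m`-tuples over `{0, 1}`. -/
abbrev Idx (m : ℕ) : Type := Fin m → Fin 2

/-- The subring `ℤ[√2]` of the real numbers. -/
abbrev ZSqrtTwo : Subalgebra ℤ ℝ := Algebra.adjoin ℤ {Real.sqrt 2}

/-- The generator matrix of the two-dimensional balanced Barnes-Wall lattice. -/
def genMatrix : Matrix (Fin 2) (Fin 2) ℝ := !![Real.sqrt 2, 0; 1, 1]

/-- The balanced Barnes-Wall lattice `M_1`: the `ℤ[√2]`-span of the rows of `genMatrix`. -/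
def latticeOne : Submodule ZSqrtTwo (Fin 2 → ℝ) :=
  Submodule.span ZSqrtTwo (Set.range fun i => genMatrix i)

/-- The pure tensor `v_1 ⊗ ⋯ ⊗ v_m` of `m` vectors of `ℝ ^ 2`, in coordinates. -/
def pureTensor {m : ℕ} (v : Fin m → Fin 2 → ℝ) : Idx m → ℝ :=
  fun j => ∏ k, v k (j k)

/-- The balanced Barnes-Wall lattice `M_m`, the `m`-fold tensor power of `M_1` over `ℤ[√2]`,
as the `ℤ[√2]`-span in `ℝ ^ (2 ^ m)` of the pure tensors of vectors of `M_1`. -/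
def lattice (m : ℕ) : Submodule ZSqrtTwo (Idx m → ℝ) :=
  Submodule.span ZSqrtTwo {x | ∃ v : Fin m → Fin 2 → ℝ, (∀ k, v k ∈ latticeOne) ∧ x = pureTensor v}

open Matrix in
/-- The Clifford group `𝒞_m = Aut (M_m)`: the orthogonal matrices that preserve `M_m`. -/
def cliffordGroup (m : ℕ) : Subgroup (Matrix.orthogonalGroup (Idx m) ℝ) where
  carrier := {A | (fun v => A.1 *ᵥ v) '' (lattice m : Set (Idx m → ℝ)) = lattice m}
  one_mem' := by simp
  mul_mem' := by
    intro A B hA hB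
    simp only [Set.mem_ofPred_eq] at hA hB ⊢
    have h : (fun v => (A * B).1 *ᵥ v) = (fun v => A.1 *ᵥ v) ∘ (fun v => B.1 *ᵥ v) := by
      funext v
      simp [Matrix.mulVec_mulVec]
    rw [h, Set.image_comp, hB, hA]
  inv_mem' := by
    intro A hA
    simp only [Set.mem_ofPred_eq] at hA ⊢
    have h : (fun v => (A⁻¹).1 *ᵥ v) ∘ (fun v => A.1 *ᵥ v) = id := by
      funext v
      have h1 : (A⁻¹).1 * A.1 = 1 := congrArg Subtype.val (inv_mul_cancel A)
      simp only [Function.comp_apply, Matrix.mulVec_mulVec, h1, Matrix.one_mulVec, id_eq]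
    conv_lhs => rw [← hA]
    rw [← Set.image_comp, h, Set.image_id]

/-- The linear substitution `p(x) ↦ p(A x)` on real polynomials in `2 ^ m` variables. -/
def substitute {m : ℕ} (A : Matrix (Idx m) (Idx m) ℝ) :
    MvPolynomial (Idx m) ℝ →ₐ[ℝ] MvPolynomial (Idx m) ℝ :=
  MvPolynomial.aeval fun i => ∑ j, MvPolynomial.C (A i j) * MvPolynomial.X j

/-- The real vector space of homogeneous invariant polynomials of degree `d` of a group of
orthogonal `2 ^ m × 2 ^ m` matrices. -/
def homogeneousInvariants {m : ℕ} (G : Subgroup (Matrix.orthogonalGroup (Idx m) ℝ)) (d : ℕ) :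
    Submodule ℝ (MvPolynomial (Idx m) ℝ) where
  carrier := {p | p.IsHomogeneous d ∧ ∀ A ∈ G, substitute A.1 p = p}
  zero_mem' := ⟨MvPolynomial.isHomogeneous_zero _ _ _, fun A _ => map_zero _⟩
  add_mem' := fun {p q} hp hq =>
    ⟨hp.1.add hq.1, fun A hA => by rw [map_add, hp.2 A hA, hq.2 A hA]⟩
  smul_mem' := fun c p hp =>
    ⟨(MvPolynomial.homogeneousSubmodule (Idx m) ℝ d).smul_mem c hp.1,
      fun A hA => by rw [map_smul, hp.2 A hA]⟩

/-- The Molien series: the generating function of the numbers of linearly independent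
homogeneous invariants of each degree. -/
def molienSeries {m : ℕ} (G : Subgroup (Matrix.orthogonalGroup (Idx m) ℝ)) : PowerSeries ℤ :=
  PowerSeries.mk fun d => (Module.finrank ℝ (homogeneousInvariants G d) : ℤ)

end BarnesWall

end

/-! Upper bounds. The apolar product turns a homogeneous polynomial of degree `N` into a symmetric
tensor, that is, a function `φ` of `m` binary words of length `N`, one word (row) for each tensor
factor. Invariance under the controlled sign changes confines `φ` to tuples of pairwise orthogonal
words; invariance under the Hadamard matrices makes `φ` its own normalised Fourier transform in
every row. Such a `φ` depends only on the code spanned by its rows and the all-ones word, and for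
even `N` it vanishes as soon as its sums over all self-dual codes vanish
(`IsCliffordInvariant.eq_zero_of_codeSum`).

If the polynomial is harmonic, its sum over a code with a word of weight two is zero. Every
self-dual code of length 2, 4, 6 or 10 has such a word, and those of length 8 or 12 that have none
are equivalent to each other (type `d⁺`). Hence the Laplacian, which lowers the degree of invariants
by two, is injective on invariants of degree 2, 4, 6, 10 and has a kernel of dimension at most one
in degrees 8 and 12. For `m = 1` the kernel in degree 12 is zero as well, because harmonicity forces
`φ r = φ 0 * Re (i ^ wt r)` and the Fourier condition then reads `64 φ 0 = -64 φ 0`. In odd degree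
there are no nonzero invariants.

Lower bounds. Multiplication by the squared norm embeds the invariants of degree `d` in those of
degree `d + 2`. New invariants come from the sums of the fourth and sixth powers of the quadratic
forms of the Pauli matrices. Their invariance needs that every automorphism of the lattice
normalizes the Pauli group up to sign (`exists_conj_pauli`). Pauli matrices are congruent to 1
modulo `√2`, and so are their conjugates; the commutator of two such automorphisms is congruent to 1
modulo 2; and an orthogonal matrix congruent to 1 modulo 2 is `1` or `-1`, since it fixes each
minimal vector up to sign. A matrix commuting up to sign with all Pauli matrices is a Pauli matrix
up to sign. Linear independence is tested on pure tensors, where the Pauli sums factorise. -/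

noncomputable section

namespace BarnesWall

set_option linter.unusedSectionVars false

open Matrix Finset

/-! ### The character of `𝔽₂`. -/

/-- The real character of `𝔽₂`. -/
def sgn (x : ZMod 2) : ℝ := if x = 0 then 1 else -1

@[simp] lemma sgn_zero : sgn 0 = 1 := by simp [sgn]

@[simp] lemma sgn_one : sgn 1 = -1 := by simp [sgn]

lemma zmod_two_eq (x : ZMod 2) : x = 0 ∨ x = 1 := by
  fin_cases x
  · exact Or.inl rfl
  · exact Or.inr rfl

lemma sgn_add (x y : ZMod 2) : sgn (x + y) = sgn x * sgn y := by
  have h : (1 : ZMod 2) + 1 = 0 := rfl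
  rcases zmod_two_eq x with rfl | rfl <;> rcases zmod_two_eq y with rfl | rfl <;> simp [h]

lemma sgn_mul_self (x : ZMod 2) : sgn x * sgn x = 1 := by
  rcases zmod_two_eq x with rfl | rfl <;> simp

lemma zmod_two_add_self (x : ZMod 2) : x + x = 0 := CharTwo.add_self_eq_zero x

lemma sgn_sum {α : Type*} (s : Finset α) (f : α → ZMod 2) :
    sgn (∑ i ∈ s, f i) = ∏ i ∈ s, sgn (f i) := by
  classical
  induction s using Finset.induction_on with
  | empty => simp
  | insert a s ha ih => rw [sum_insert ha, prod_insert ha, sgn_add, ih]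

/-! ### Linear maps with equal range. -/

section SameRange

variable {F E W : Type*} [Field F] [AddCommGroup E] [Module F E] [FiniteDimensional F E]
  [AddCommGroup W] [Module F W]

/-- Linear maps with the same range differ by an automorphism of the source. -/
lemma exists_linearEquiv_comp_eq (f f' : E →ₗ[F] W)
    (h : LinearMap.range f = LinearMap.range f') :
    ∃ g : E ≃ₗ[F] E, ∀ x, f' x = f (g x) := by
  obtain ⟨S, hS⟩ := Submodule.exists_isCompl (LinearMap.ker f)
  obtain ⟨S', hS'⟩ := Submodule.exists_isCompl (LinearMap.ker f')
  have hk : Module.finrank F (LinearMap.ker f') = Module.finrank F (LinearMap.ker f) := by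
    have h1 := LinearMap.finrank_range_add_finrank_ker f
    have h2 := LinearMap.finrank_range_add_finrank_ker f'
    rw [h] at h1
    omega
  let eS : S' ≃ₗ[F] S := (LinearMap.kerComplementEquivRange f' hS'.symm) ≪≫ₗ
    (LinearEquiv.ofEq _ _ h.symm) ≪≫ₗ (LinearMap.kerComplementEquivRange f hS.symm).symm
  have heS : ∀ s : S', f (eS s) = f' s := by
    intro s
    have h1 := (LinearMap.kerComplementEquivRange f hS.symm).apply_symm_apply
      (LinearEquiv.ofEq _ _ h.symm (LinearMap.kerComplementEquivRange f' hS'.symm s))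
    exact congrArg Subtype.val h1
  let g : E ≃ₗ[F] E := (Submodule.prodEquivOfIsCompl _ _ hS').symm ≪≫ₗ
    ((LinearEquiv.ofFinrankEq _ _ hk).prodCongr eS) ≪≫ₗ Submodule.prodEquivOfIsCompl _ _ hS
  refine ⟨g, fun x => ?_⟩
  obtain ⟨⟨k, s⟩, rfl⟩ := (Submodule.prodEquivOfIsCompl _ _ hS').surjective x
  have h1 : f' (k : E) = 0 := k.2
  have h2 : ∀ k : LinearMap.ker f, f (k : E) = 0 := fun k => k.2
  simp [g, h1, h2, heS]

end SameRange

/-! ### Binary codes and their duals. -/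

section Codes

variable {ι : Type*} [Fintype ι] [DecidableEq ι]

/-- The dual of a binary linear code. -/
def dualCode (C : Submodule (ZMod 2) (ι → ZMod 2)) : Submodule (ZMod 2) (ι → ZMod 2) where
  carrier := {v | ∀ c ∈ C, c ⬝ᵥ v = 0}
  zero_mem' := by simp
  add_mem' := by
    intro a b ha hb c hc
    simp [dotProduct_add, ha c hc, hb c hc]
  smul_mem' := by
    intro x a ha c hc
    simp [dotProduct_smul, ha c hc]

lemma mem_dualCode {C : Submodule (ZMod 2) (ι → ZMod 2)} {v : ι → ZMod 2} :
    v ∈ dualCode C ↔ ∀ c ∈ C, c ⬝ᵥ v = 0 := Iff.rfl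

-- Orthogonality of characters: translation by a codeword that is not orthogonal to `v` negates the
-- sum.
open Classical in
lemma sum_sgn_dotProduct (C : Submodule (ZMod 2) (ι → ZMod 2)) (v : ι → ZMod 2) :
    ∑ c : C, sgn (c.1 ⬝ᵥ v) = if v ∈ dualCode C then (Nat.card C : ℝ) else 0 := by
  split_ifs with h
  · rw [Finset.sum_congr rfl fun c _ => by rw [h c.1 c.2, sgn_zero]]
    simp
  · simp only [mem_dualCode, not_forall] at h
    obtain ⟨c₀, hc₀, h₀⟩ := h
    have h₁ : c₀ ⬝ᵥ v = 1 := (zmod_two_eq _).resolve_left h₀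
    have h2 : ∑ c : C, sgn (c.1 ⬝ᵥ v) = ∑ c : C, -sgn (c.1 ⬝ᵥ v) := by
      rw [← Equiv.sum_comp (Equiv.addRight (⟨c₀, hc₀⟩ : C))]
      refine Finset.sum_congr rfl fun c _ => ?_
      simp [add_dotProduct, sgn_add, h₁]
    rw [Finset.sum_neg_distrib] at h2
    linarith

/-- The character sum over pairs `(c, v)` is evaluated in both orders; summing over `v` first leaves
only `c = 0`. -/
lemma card_mul_card_dualCode (C : Submodule (ZMod 2) (ι → ZMod 2)) :
    (Nat.card C : ℝ) * Nat.card (dualCode C) = 2 ^ Fintype.card ι := by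
  classical
  have h1 : ∑ v : ι → ZMod 2, ∑ c : C, sgn (c.1 ⬝ᵥ v)
      = (Nat.card C : ℝ) * Nat.card (dualCode C) := by
    simp_rw [sum_sgn_dotProduct]
    rw [Finset.sum_ite]
    simp only [sum_const, nsmul_eq_mul, mul_zero, add_zero]
    rw [mul_comm, Nat.card_eq_fintype_card (α := dualCode C), Fintype.card_subtype]
  rw [← h1, Finset.sum_comm, Finset.sum_eq_single (0 : C)]
  · simp
  · intro c _ hc
    have h2 := sum_sgn_dotProduct (⊤ : Submodule (ZMod 2) (ι → ZMod 2)) c.1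
    rw [if_neg] at h2
    · rw [← Equiv.sum_comp (Submodule.topEquiv (R := ZMod 2) (M := ι → ZMod 2)).toEquiv]
      rw [← h2]
      exact Finset.sum_congr rfl fun v _ => by rw [dotProduct_comm]; rfl
    · intro h
      apply hc
      ext i
      have := h (Pi.single i 1) trivial
      simpa using this
  · simp

end Codes

/-! ### Symmetries of Clifford-invariant functions. -/

section Invariants

variable {κ ι : Type*} [Fintype κ] [DecidableEq κ] [Fintype ι] [DecidableEq ι]

/-- Functions on tuples of binary words that are fixed by the real Clifford group, in terms of
the action of its diagonal and Hadamard generators. -/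
structure IsCliffordInvariant (φ : (κ → ι → ZMod 2) → ℝ) : Prop where
  -- The case `i = j` says that every row has even weight.
  support : ∀ ρ i j, φ ρ ≠ 0 → ρ i ⬝ᵥ ρ j = 0
  fourier : ∀ ρ i, √2 ^ Fintype.card ι * φ ρ =
    ∑ s, sgn (s ⬝ᵥ ρ i) * φ (Function.update ρ i s)

lemma self_dotProduct (r : ι → ZMod 2) : r ⬝ᵥ r = r ⬝ᵥ 1 := by
  refine Finset.sum_congr rfl fun i _ => ?_
  rcases zmod_two_eq (r i) with h | h <;> simp [h]

namespace IsCliffordInvariant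

variable {φ : (κ → ι → ZMod 2) → ℝ}

lemma sqrt_pow_ne_zero (n : ℕ) : (√2 : ℝ) ^ n ≠ 0 := by positivity

/-- Shifting row `i` by `v` multiplies the Fourier term at `s` by `sgn (s ⬝ᵥ v)`, which is 1
wherever that term is nonzero. -/
lemma update_add (hφ : IsCliffordInvariant φ) (ρ : κ → ι → ZMod 2) (i : κ) (v : ι → ZMod 2)
    (hv : ∀ s, φ (Function.update ρ i s) ≠ 0 → s ⬝ᵥ v = 0) :
    φ (Function.update ρ i (ρ i + v)) = φ ρ := by
  apply mul_left_cancel₀ (sqrt_pow_ne_zero (Fintype.card ι))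
  rw [hφ.fourier ρ i, hφ.fourier _ i]
  refine Finset.sum_congr rfl fun s _ => ?_
  simp only [Function.update_self, Function.update_idem]
  by_cases h : φ (Function.update ρ i s) = 0
  · simp [h]
  · rw [dotProduct_add, hv s h, add_zero]

lemma update_add_one (hφ : IsCliffordInvariant φ) (ρ : κ → ι → ZMod 2) (i : κ) :
    φ (Function.update ρ i (ρ i + 1)) = φ ρ :=
  hφ.update_add ρ i 1 fun s hs => by
    have := hφ.support _ i i hs
    rwa [Function.update_self, self_dotProduct] at this

lemma update_add_row (hφ : IsCliffordInvariant φ) (ρ : κ → ι → ZMod 2) {i j : κ} (hij : i ≠ j) :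
    φ (Function.update ρ i (ρ i + ρ j)) = φ ρ :=
  hφ.update_add ρ i (ρ j) fun s hs => by
    have := hφ.support _ i j hs
    rwa [Function.update_self, Function.update_of_ne hij.symm] at this

lemma eq_of_sub_mem (hφ : IsCliffordInvariant φ) (ρ ρ' : κ → ι → ZMod 2)
    (h : ∀ i, ρ' i = ρ i ∨ ρ' i = ρ i + 1) : φ ρ' = φ ρ := by
  suffices H : ∀ s : Finset κ, φ (fun i => if i ∈ s then ρ' i else ρ i) = φ ρ by
    simpa using H Finset.univ
  intro s
  induction s using Finset.induction_on with
  | empty => simp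
  | insert a s ha ih =>
    rw [← ih]
    have h1 : (fun i => if i ∈ insert a s then ρ' i else ρ i)
        = Function.update (fun i => if i ∈ s then ρ' i else ρ i) a (ρ' a) := by
      funext i
      by_cases hi : i = a
      · subst hi; simp
      · simp [hi]
    rw [h1]
    rcases h a with h2 | h2
    · rw [h2]
      congr 1
      rw [Function.update_eq_self_iff]
      simp [ha]
    · rw [← hφ.update_add_one (fun i => if i ∈ s then ρ' i else ρ i) a, h2]
      simp [ha]

/-- Over `𝔽₂` an invertible diagonal matrix is trivial and a transvection adds one row to another,
so invariance under row additions gives invariance under the general linear group. -/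
lemma mul_matrix (hφ : IsCliffordInvariant φ) (M : Matrix κ κ (ZMod 2)) (hM : M.det ≠ 0) :
    ∀ ρ, φ (fun i => ∑ j, M i j • ρ j) = φ ρ := by
  refine Matrix.diagonal_transvection_induction_of_det_ne_zero
    (fun M => ∀ ρ, φ (fun i => ∑ j, M i j • ρ j) = φ ρ) M hM ?_ ?_ ?_
  · intro D hD ρ
    congr 1
    funext i
    have : D i = 1 := by
      refine (zmod_two_eq _).resolve_left fun h => hD ?_
      rw [Matrix.det_diagonal]
      exact Finset.prod_eq_zero (Finset.mem_univ i) h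
    rw [Finset.sum_eq_single i]
    · simp [this]
    · intro j _ hj
      simp [Matrix.diagonal_apply_ne' _ hj]
    · simp
  · intro t ρ
    obtain ⟨i, j, hij, c⟩ := t
    rcases zmod_two_eq c with rfl | rfl
    · congr 1
      funext a
      rw [Finset.sum_eq_single a]
      · simp [Matrix.TransvectionStruct.toMatrix]
      · intro b _ hb
        simp [Matrix.TransvectionStruct.toMatrix, Matrix.one_apply_ne' hb]
      · simp
    · rw [← hφ.update_add_row ρ hij]
      congr 1
      funext a
      simp only [Matrix.TransvectionStruct.toMatrix, Matrix.transvection, Matrix.add_apply,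
        add_smul, Finset.sum_add_distrib]
      have h1 : ∑ b, (1 : Matrix κ κ (ZMod 2)) a b • ρ b = ρ a := by
        simp [Matrix.one_apply]
      rw [h1]
      by_cases ha : a = i
      · subst ha
        simp [Matrix.single_apply]
      · simp [Function.update_of_ne ha, Ne.symm ha]
  · intro A B _ _ hA hB ρ
    rw [← hB ρ, ← hA (fun i => ∑ j, B i j • ρ j)]
    congr 1
    funext i
    simp only [Matrix.mul_apply, Finset.sum_smul, Finset.smul_sum, smul_smul]
    rw [Finset.sum_comm]

end IsCliffordInvariant

end Invariants

/-! ### Sums over codes, and how they determine the function. -/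

section Invariants

variable {κ ι : Type*} [Fintype κ] [DecidableEq κ] [Fintype ι] [DecidableEq ι]

/-- The left action of matrices on tuples of words. -/
def rowAct (M : Matrix κ κ (ZMod 2)) (ρ : κ → ι → ZMod 2) : κ → ι → ZMod 2 :=
  fun i => ∑ j, M i j • ρ j

lemma rowAct_mul (A B : Matrix κ κ (ZMod 2)) (ρ : κ → ι → ZMod 2) :
    rowAct A (rowAct B ρ) = rowAct (A * B) ρ := by
  funext i
  simp only [rowAct, Matrix.mul_apply, Finset.sum_smul, Finset.smul_sum, smul_smul]
  rw [Finset.sum_comm]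

lemma rowAct_one (ρ : κ → ι → ZMod 2) : rowAct 1 ρ = ρ := by
  funext i
  simp [rowAct, Matrix.one_apply]

/-- The action of an involution on tuples of words, as a permutation. -/
def rowEquiv (M : Matrix κ κ (ZMod 2)) (hM : M * M = 1) :
    (κ → ι → ZMod 2) ≃ (κ → ι → ZMod 2) where
  toFun := rowAct M
  invFun := rowAct M
  left_inv ρ := by rw [rowAct_mul, hM, rowAct_one]
  right_inv ρ := by rw [rowAct_mul, hM, rowAct_one]

/-- Transitivity on nonzero vectors, with involutions so that the same matrix serves as its own
inverse in `rowEquiv`. -/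
lemma exists_involution_mulVec (u v : κ → ZMod 2) (hu : u ≠ 0) (hv : v ≠ 0) :
    ∃ M : Matrix κ κ (ZMod 2), M * M = 1 ∧ M *ᵥ u = v := by
  obtain ⟨a, hau, hav⟩ : ∃ a : κ → ZMod 2, a ⬝ᵥ u = 1 ∧ a ⬝ᵥ v = 1 := by
    obtain ⟨i, hi⟩ := Function.ne_iff.mp hu
    obtain ⟨j, hj⟩ := Function.ne_iff.mp hv
    have hi' : u i = 1 := (zmod_two_eq _).resolve_left hi
    have hj' : v j = 1 := (zmod_two_eq _).resolve_left hj
    rcases zmod_two_eq (v i) with h1 | h1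
    · rcases zmod_two_eq (u j) with h2 | h2
      · exact ⟨Pi.single i 1 + Pi.single j 1, by simp [add_dotProduct, hi', h2],
          by simp [add_dotProduct, hj', h1]⟩
      · exact ⟨Pi.single j 1, by simp [h2], by simp [hj']⟩
    · exact ⟨Pi.single i 1, by simp [hi'], by simp [h1]⟩
  -- A transvection: `a ⬝ᵥ (u + v) = 0` makes it an involution, and `a ⬝ᵥ u = 1` makes it send `u`
  -- to `u + (u + v) = v`.
  refine ⟨1 + vecMulVec (u + v) a, ?_, ?_⟩
  · have h1 : vecMulVec (u + v) a * vecMulVec (u + v) a = 0 := by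
      rw [vecMulVec_mul_vecMulVec, dotProduct_add, hau, hav, zmod_two_add_self]
      simp
    have h2 : vecMulVec (u + v) a + vecMulVec (u + v) a = 0 := by
      ext i j
      exact zmod_two_add_self _
    rw [add_mul, mul_add, mul_add, h1]
    simp only [one_mul, mul_one, add_zero]
    rw [add_assoc, h2, add_zero]
  · rw [add_mulVec, one_mulVec, vecMulVec_mulVec, hau]
    funext i
    simp only [Pi.add_apply, MulOpposite.op_one, one_smul]
    rw [← add_assoc, zmod_two_add_self, zero_add]

open Classical in
/-- The sum of `φ` over the tuples whose rows lie in the cosets `u i • x + C`. -/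
def cosetSum (φ : (κ → ι → ZMod 2) → ℝ) (C : Submodule (ZMod 2) (ι → ZMod 2))
    (x : ι → ZMod 2) (u : κ → ZMod 2) : ℝ :=
  ∑ ρ, if ∀ i, ρ i - u i • x ∈ C then φ ρ else 0

open Classical in
/-- The sum of `φ` over the tuples of words of a code. -/
def codeSum (φ : (κ → ι → ZMod 2) → ℝ) (C : Submodule (ZMod 2) (ι → ZMod 2)) : ℝ :=
  ∑ ρ, if ∀ i, ρ i ∈ C then φ ρ else 0

lemma cosetSum_zero (φ : (κ → ι → ZMod 2) → ℝ) (C : Submodule (ZMod 2) (ι → ZMod 2))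
    (x : ι → ZMod 2) : cosetSum φ C x 0 = codeSum φ C := by
  unfold cosetSum codeSum
  refine Finset.sum_congr rfl fun ρ _ => ?_
  congr 1
  refine propext (forall_congr' fun i => ?_)
  rw [Pi.zero_apply, zero_smul, sub_zero]

lemma codeSum_sup_span (φ : (κ → ι → ZMod 2) → ℝ) (C : Submodule (ZMod 2) (ι → ZMod 2))
    {x : ι → ZMod 2} (hx : x ∉ C) :
    codeSum φ (C ⊔ Submodule.span (ZMod 2) {x}) = ∑ u, cosetSum φ C x u := by
  classical
  unfold codeSum cosetSum
  rw [Finset.sum_comm]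
  refine Finset.sum_congr rfl fun ρ _ => ?_
  have huniq : ∀ y : ι → ZMod 2, ∀ a b : ZMod 2, y - a • x ∈ C → y - b • x ∈ C → a = b := by
    intro y a b ha hb
    have h := C.sub_mem ha hb
    rcases zmod_two_eq a with rfl | rfl <;> rcases zmod_two_eq b with rfl | rfl
    · rfl
    · exact absurd (by simpa using h) hx
    · refine absurd (by simpa using h) hx
    · rfl
  have hmem : ∀ y, y ∈ C ⊔ Submodule.span (ZMod 2) {x} ↔ ∃ a : ZMod 2, y - a • x ∈ C := by
    intro y
    rw [Submodule.mem_sup]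
    constructor
    · rintro ⟨c, hc, z, hz, rfl⟩
      obtain ⟨a, rfl⟩ := Submodule.mem_span_singleton.mp hz
      exact ⟨a, by simpa using hc⟩
    · rintro ⟨a, ha⟩
      exact ⟨_, ha, a • x, Submodule.smul_mem _ _ (Submodule.mem_span_singleton_self x),
        by simp⟩
  split_ifs with h
  · simp only [hmem] at h
    choose u hu using h
    rw [Finset.sum_eq_single u]
    · rw [if_pos hu]
    · intro v _ hv
      rw [if_neg]
      intro h'
      exact hv (funext fun i => huniq _ _ _ (h' i) (hu i))
    · simp
  · symm
    apply Finset.sum_eq_zero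
    intro u _
    rw [if_neg]
    intro h'
    exact h fun i => (hmem _).mpr ⟨u i, h' i⟩

namespace IsCliffordInvariant

variable {φ : (κ → ι → ZMod 2) → ℝ}

lemma cosetSum_mulVec (hφ : IsCliffordInvariant φ) (C : Submodule (ZMod 2) (ι → ZMod 2))
    (x : ι → ZMod 2) (u : κ → ZMod 2) {M : Matrix κ κ (ZMod 2)} (hM : M * M = 1) :
    cosetSum φ C x (M *ᵥ u) = cosetSum φ C x u := by
  classical
  have key : ∀ (ρ : κ → ι → ZMod 2) (u : κ → ZMod 2), (∀ i, ρ i - u i • x ∈ C) →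
      ∀ i, rowAct M ρ i - (M *ᵥ u) i • x ∈ C := by
    intro ρ u h i
    have h1 : rowAct M ρ i - (M *ᵥ u) i • x = ∑ j, M i j • (ρ j - u j • x) := by
      simp only [rowAct, mulVec, dotProduct, smul_sub, Finset.sum_sub_distrib, Finset.sum_smul,
        smul_smul]
    rw [h1]
    exact Submodule.sum_mem _ fun j _ => C.smul_mem _ (h j)
  have hdet : M.det ≠ 0 := by
    intro h
    have := congrArg Matrix.det hM
    rw [Matrix.det_mul, h, Matrix.det_one] at this
    simp at this
  unfold cosetSum
  rw [← Equiv.sum_comp (rowEquiv M hM)]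
  refine Finset.sum_congr rfl fun ρ _ => ?_
  have h1 : φ (rowEquiv M hM ρ) = φ ρ := hφ.mul_matrix M hdet ρ
  rw [h1]
  congr 1
  apply propext
  constructor
  · intro h
    have := key _ _ h
    simpa only [rowEquiv, Equiv.coe_fn_mk, rowAct_mul, mulVec_mulVec, hM, rowAct_one,
      one_mulVec] using this
  · exact key ρ u

/-- The tuples over the larger code split by their coset pattern `u`. All `2 ^ Fintype.card κ - 1`
nonzero patterns contribute equally, because the linear group permutes them transitively. -/
lemma codeSum_sup_span_eq (hφ : IsCliffordInvariant φ) (C : Submodule (ZMod 2) (ι → ZMod 2))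
    {x : ι → ZMod 2} (hx : x ∉ C) (i : κ) :
    codeSum φ (C ⊔ Submodule.span (ZMod 2) {x}) =
      codeSum φ C + (2 ^ Fintype.card κ - 1) * cosetSum φ C x (Pi.single i 1) := by
  classical
  have hne : (Pi.single i 1 : κ → ZMod 2) ≠ 0 := by simp
  rw [codeSum_sup_span φ C hx, ← Finset.add_sum_erase _ _ (Finset.mem_univ 0), cosetSum_zero]
  congr 1
  rw [Finset.sum_congr rfl (g := fun _ => cosetSum φ C x (Pi.single i 1))]
  · rw [Finset.sum_const, Finset.card_erase_of_mem (Finset.mem_univ _), Finset.card_univ,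
      nsmul_eq_mul, Nat.cast_sub Fintype.card_pos]
    simp
  · intro u hu
    obtain ⟨M, hM, h⟩ := exists_involution_mulVec _ u hne (Finset.ne_of_mem_erase hu)
    rw [← h, hφ.cosetSum_mulVec C x _ hM]

-- Poisson summation in row `i`.
open Classical in
lemma codeSum_poisson (hφ : IsCliffordInvariant φ) (C : Submodule (ZMod 2) (ι → ZMod 2))
    (i : κ) :
    √2 ^ Fintype.card ι * codeSum φ C = Nat.card C *
      ∑ ρ, if ρ i ∈ dualCode C ∧ ∀ j, j ≠ i → ρ j ∈ C then φ ρ else 0 := by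
  have h1 : √2 ^ Fintype.card ι * codeSum φ C = ∑ p : (κ → ι → ZMod 2) × (ι → ZMod 2),
      if ∀ j, p.1 j ∈ C then sgn (p.2 ⬝ᵥ p.1 i) * φ (Function.update p.1 i p.2) else 0 := by
    rw [codeSum, Finset.mul_sum, Fintype.sum_prod_type]
    refine Finset.sum_congr rfl fun ρ _ => ?_
    by_cases h : ∀ j, ρ j ∈ C
    · simp only [h, implies_true, if_true]
      exact hφ.fourier ρ i
    · simp [h]
  -- Exchanging row `i` with the Fourier variable turns the character sum into one over `C`, where
  -- orthogonality applies.
  let e : (κ → ι → ZMod 2) × (ι → ZMod 2) → (κ → ι → ZMod 2) × (ι → ZMod 2) :=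
    fun p => (Function.update p.1 i p.2, p.1 i)
  have he : Function.Involutive e := by
    rintro ⟨ρ, s⟩
    simp [e]
  rw [h1, ← Equiv.sum_comp he.toPerm, Fintype.sum_prod_type, Finset.mul_sum]
  refine Finset.sum_congr rfl fun ρ _ => ?_
  simp only [Function.Involutive.coe_toPerm, e, Function.update_self, Function.update_idem,
    Function.update_eq_self]
  have h2 : ∀ s, (∀ j, Function.update ρ i s j ∈ C) ↔ s ∈ C ∧ ∀ j, j ≠ i → ρ j ∈ C := by
    intro s
    constructor
    · intro h
      refine ⟨by simpa using h i, fun j hj => by simpa [hj] using h j⟩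
    · rintro ⟨h, h'⟩ j
      by_cases hj : j = i
      · subst hj; simpa using h
      · simpa [hj] using h' j hj
  simp only [h2]
  by_cases h : ∀ j, j ≠ i → ρ j ∈ C
  · simp only [eq_true h, and_true]
    have h3 := sum_sgn_dotProduct C (ρ i)
    rw [← Finset.sum_filter, Finset.sum_subtype (p := (· ∈ C)) _ (by simp), ← Finset.sum_mul]
    rw [Finset.sum_congr rfl fun (c : C) _ => by rw [dotProduct_comm], h3]
    split_ifs <;> simp
  · simp [h]

/-- The sums over the one-step extensions of `C` express each coset sum through `codeSum φ C`, with
a negative factor. Substituting this in the Poisson formula gives `codeSum φ C` times a positive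
number equal to zero. -/
lemma codeSum_eq_zero_of_forall_gt [Nonempty κ] (hφ : IsCliffordInvariant φ)
    (C : Submodule (ZMod 2) (ι → ZMod 2)) (hC : C < dualCode C)
    (h : ∀ x ∈ dualCode C, x ∉ C → codeSum φ (C ⊔ Submodule.span (ZMod 2) {x}) = 0) :
    codeSum φ C = 0 := by
  classical
  obtain ⟨i⟩ := ‹Nonempty κ›
  set q : ℝ := 2 ^ Fintype.card κ - 1 with hq
  have hq0 : 0 < q := by
    have : (1 : ℝ) < 2 ^ Fintype.card κ :=
      one_lt_pow₀ (by norm_num) (Fintype.card_pos_iff.mpr ⟨i⟩).ne'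
    linarith
  have h1 : ∀ x ∈ dualCode C, x ∉ C →
      cosetSum φ C x (Pi.single i 1) = -codeSum φ C / q := by
    intro x hx hxC
    have := h x hx hxC
    rw [hφ.codeSum_sup_span_eq C hxC i] at this
    rw [eq_div_iff hq0.ne']
    linarith
  set R : ℝ := ∑ ρ, if (ρ i ∈ dualCode C ∧ ρ i ∉ C) ∧ ∀ j, j ≠ i → ρ j ∈ C then φ ρ else 0
    with hR
  set X : Finset (ι → ZMod 2) := Finset.univ.filter fun x => x ∈ dualCode C ∧ x ∉ C with hX
  have hXpos : 0 < X.card := by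
    obtain ⟨x, hx, hxC⟩ := Set.exists_of_ssubset hC
    exact Finset.card_pos.mpr ⟨x, by simpa [hX] using ⟨hx, hxC⟩⟩
  have h2 : Nat.card C * R = X.card * (-codeSum φ C / q) := by
    have h3 : ∑ x ∈ X, cosetSum φ C x (Pi.single i 1) = X.card * (-codeSum φ C / q) := by
      rw [← nsmul_eq_mul, ← Finset.sum_const]
      refine Finset.sum_congr rfl fun x hx => ?_
      rw [hX, Finset.mem_filter] at hx
      exact h1 x hx.2.1 hx.2.2
    rw [← h3]
    unfold cosetSum
    rw [Finset.sum_comm, hR, Finset.mul_sum]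
    refine Finset.sum_congr rfl fun ρ _ => ?_
    have h3 : ∀ x, (∀ j, ρ j - (Pi.single i 1 : κ → ZMod 2) j • x ∈ C) ↔
        ρ i - x ∈ C ∧ ∀ j, j ≠ i → ρ j ∈ C := by
      intro x
      constructor
      · intro h
        refine ⟨by simpa using h i, fun j hj => by simpa [hj] using h j⟩
      · rintro ⟨h, h'⟩ j
        by_cases hj : j = i
        · subst hj; simpa using h
        · simpa [hj] using h' j hj
    simp only [h3]
    by_cases h4 : ∀ j, j ≠ i → ρ j ∈ C
    · simp only [eq_true h4, and_true]
      rw [← Finset.sum_filter, Finset.sum_const, nsmul_eq_mul]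
      have h5 : ∀ x, ρ i - x ∈ C → (x ∈ X ↔ ρ i ∈ dualCode C ∧ ρ i ∉ C) := by
        intro x hx
        have h6 : ρ i ∈ C ↔ x ∈ C := by
          rw [← sub_add_cancel (ρ i) x]
          exact ⟨fun h => by simpa using C.sub_mem h hx, fun h => C.add_mem hx h⟩
        have h7 : ρ i ∈ dualCode C ↔ x ∈ dualCode C := by
          have hx' := hC.le hx
          rw [← sub_add_cancel (ρ i) x]
          exact ⟨fun h => by simpa using (dualCode C).sub_mem h hx',
            fun h => (dualCode C).add_mem hx' h⟩
        simp [hX, h6, h7]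
      split_ifs with h6
      · have h7 : (X.filter fun x => ρ i - x ∈ C).card = Nat.card C := by
          rw [Nat.card_eq_fintype_card, Fintype.card_subtype]
          refine Finset.card_bij (fun x _ => ρ i - x) ?_ ?_ ?_
          · intro x hx
            simpa using (Finset.mem_filter.mp hx).2
          · intro x _ y _ hxy
            simpa using hxy
          · intro c hc
            have hc' : c ∈ C := by simpa using hc
            refine ⟨ρ i - c, ?_, by simp⟩
            rw [Finset.mem_filter]
            exact ⟨(h5 _ (by simpa using hc')).mpr h6, by simpa using hc'⟩
        rw [h7]
      · have h7 : (X.filter fun x => ρ i - x ∈ C) = ∅ := by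
          rw [Finset.filter_eq_empty_iff]
          intro x hx hxC
          exact h6 ((h5 x hxC).mp hx)
        simp [h7]
    · simp [h4]
  have h3 : (∑ ρ, if ρ i ∈ dualCode C ∧ ∀ j, j ≠ i → ρ j ∈ C then φ ρ else 0)
      = codeSum φ C + R := by
    rw [codeSum, hR, ← Finset.sum_add_distrib]
    refine Finset.sum_congr rfl fun ρ _ => ?_
    have h5 : (∀ j, ρ j ∈ C) ↔ ρ i ∈ C ∧ ∀ j, j ≠ i → ρ j ∈ C := by
      constructor
      · exact fun h => ⟨h i, fun j _ => h j⟩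
      · rintro ⟨h, h'⟩ j
        by_cases hj : j = i
        · subst hj; exact h
        · exact h' j hj
    by_cases h4 : ∀ j, j ≠ i → ρ j ∈ C
    · by_cases h6 : ρ i ∈ C
      · have h7 := hC.le h6
        simp [h5, h6, h7]
      · simp [h5, h6]
    · simp [h5, h4]
  have h4 := hφ.codeSum_poisson C i
  rw [h3] at h4
  have hcard : (Nat.card C : ℝ) ≤ √2 ^ Fintype.card ι := by
    have h5 := card_mul_card_dualCode C
    have h6 : (Nat.card C : ℝ) ≤ Nat.card (dualCode C) := by
      exact_mod_cast Nat.card_mono (Set.toFinite _) hC.le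
    have h7 : (√2 ^ Fintype.card ι : ℝ) ^ 2 = 2 ^ Fintype.card ι := by
      rw [← pow_mul, mul_comm, pow_mul, Real.sq_sqrt (by norm_num)]
    refine (sq_le_sq₀ (by positivity) (by positivity)).mp ?_
    rw [h7, ← h5, sq]
    exact mul_le_mul_of_nonneg_left h6 (by positivity)
  -- The second factor is positive: self-orthogonality gives `Nat.card C ≤ √2 ^ Fintype.card ι`, and
  -- `X` is nonempty.
  have h5 : codeSum φ C * (√2 ^ Fintype.card ι - Nat.card C + X.card / q) = 0 := by
    rw [mul_add, h2] at h4
    have : (X.card : ℝ) * (-codeSum φ C / q) = - (codeSum φ C * (X.card / q)) := by ring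
    rw [this] at h4
    linarith
  rcases mul_eq_zero.mp h5 with h6 | h6
  · exact h6
  · have : (0 : ℝ) < X.card / q := div_pos (by exact_mod_cast hXpos) hq0
    linarith

lemma sup_span_le_dualCode {C : Submodule (ZMod 2) (ι → ZMod 2)} (h1 : 1 ∈ C)
    (hC : C ≤ dualCode C) {x : ι → ZMod 2} (hx : x ∈ dualCode C) :
    C ⊔ Submodule.span (ZMod 2) {x} ≤ dualCode (C ⊔ Submodule.span (ZMod 2) {x}) := by
  have key : ∀ c ∈ C, ∀ d ∈ C, ∀ a b : ZMod 2, (c + a • x) ⬝ᵥ (d + b • x) = 0 := by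
    intro c hc d hd a b
    have hxx : x ⬝ᵥ x = 0 := by
      rw [self_dotProduct, dotProduct_comm]
      exact hx 1 h1
    have hxd : x ⬝ᵥ d = 0 := by rw [dotProduct_comm]; exact hx d hd
    simp [add_dotProduct, dotProduct_add, hC hd c hc, hx c hc, hxd, hxx]
  intro v hv w hw
  obtain ⟨c, hc, z, hz, rfl⟩ := Submodule.mem_sup.mp hv
  obtain ⟨d, hd, z', hz', rfl⟩ := Submodule.mem_sup.mp hw
  obtain ⟨a, rfl⟩ := Submodule.mem_span_singleton.mp hz
  obtain ⟨b, rfl⟩ := Submodule.mem_span_singleton.mp hz'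
  exact key d hd c hc b a

/-- Downward induction from the self-dual codes. The word `1` in `C` guarantees that words of the
dual have even weight, so that every one-step extension is again self-orthogonal. -/
lemma codeSum_eq_zero [Nonempty κ] (hφ : IsCliffordInvariant φ)
    (h : ∀ C : Submodule (ZMod 2) (ι → ZMod 2), dualCode C = C → codeSum φ C = 0)
    (C : Submodule (ZMod 2) (ι → ZMod 2)) (h1 : 1 ∈ C) (hC : C ≤ dualCode C) :
    codeSum φ C = 0 := by
  induction C using WellFoundedGT.induction with
  | ind C ih =>
    rcases hC.eq_or_lt with h2 | h2
    · exact h C h2.symm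
    · refine hφ.codeSum_eq_zero_of_forall_gt C h2 fun x hx hxC => ?_
      refine ih _ (left_lt_sup.mpr fun h3 => ?_) (Submodule.mem_sup_left h1)
        (sup_span_le_dualCode h1 hC hx)
      exact hxC (h3 (Submodule.mem_span_singleton_self x))

/-- Modulo the all-ones word the two tuples are linear maps with the same range, so they differ by
an automorphism of the source. Lifting back changes rows only by multiples of `1`; both changes
leave `φ` fixed. -/
lemma eq_of_span_eq (hφ : IsCliffordInvariant φ) (ρ ρ' : κ → ι → ZMod 2)
    (h : Submodule.span (ZMod 2) {1} ⊔ Submodule.span (ZMod 2) (Set.range ρ) =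
      Submodule.span (ZMod 2) {1} ⊔ Submodule.span (ZMod 2) (Set.range ρ')) :
    φ ρ' = φ ρ := by
  set L : Submodule (ZMod 2) (ι → ZMod 2) := Submodule.span (ZMod 2) {1} with hL
  let F : (κ → ι → ZMod 2) → (κ → ZMod 2) →ₗ[ZMod 2] (ι → ZMod 2) ⧸ L :=
    fun ρ => L.mkQ ∘ₗ Fintype.linearCombination (ZMod 2) ρ
  have hF : ∀ ρ, LinearMap.range (F ρ) =
      (L ⊔ Submodule.span (ZMod 2) (Set.range ρ)).map L.mkQ := by
    intro ρ
    rw [LinearMap.range_comp, Fintype.range_linearCombination, Submodule.map_sup]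
    simp
  obtain ⟨g, hg⟩ := exists_linearEquiv_comp_eq (F ρ) (F ρ') (by rw [hF, hF, h])
  let M : Matrix κ κ (ZMod 2) := fun i j => g (Pi.single i 1) j
  have hM : M.det ≠ 0 := by
    have h1 : M = (LinearMap.toMatrix' (g : (κ → ZMod 2) →ₗ[ZMod 2] (κ → ZMod 2)))ᵀ := by
      ext i j
      simp [M, LinearMap.toMatrix'_apply]
    rw [h1, Matrix.det_transpose, LinearMap.det_toMatrix']
    exact (LinearEquiv.isUnit_det' g).ne_zero
  rw [← hφ.mul_matrix M hM ρ]
  refine hφ.eq_of_sub_mem _ _ fun i => ?_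
  have h2 := hg (Pi.single i 1)
  simp only [F, LinearMap.comp_apply, Fintype.linearCombination_apply,
    Submodule.mkQ_apply] at h2
  rw [Submodule.Quotient.eq, hL, Submodule.mem_span_singleton] at h2
  obtain ⟨a, ha⟩ := h2
  have h3 : ∑ j, (Pi.single i 1 : κ → ZMod 2) j • ρ' j = ρ' i := by
    rw [Finset.sum_eq_single i] <;> simp +contextual
  rw [h3] at ha
  have h4 : ρ' i = ∑ j, M i j • ρ j + a • 1 := by
    rw [ha]
    simp [M]
  rcases zmod_two_eq a with rfl | rfl
  · left; simpa using h4
  · right; simpa using h4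

theorem eq_zero_of_codeSum [Nonempty κ] (hφ : IsCliffordInvariant φ)
    (hι : Even (Fintype.card ι))
    (h : ∀ C : Submodule (ZMod 2) (ι → ZMod 2), dualCode C = C → codeSum φ C = 0) :
    φ = 0 := by
  classical
  have h11 : (1 : ι → ZMod 2) ⬝ᵥ 1 = 0 := by
    simp only [dotProduct, Pi.one_apply, mul_one, Finset.sum_const, Finset.card_univ,
      nsmul_eq_mul]
    exact (ZMod.natCast_eq_zero_iff_even).mpr hι
  let D : (κ → ι → ZMod 2) → Submodule (ZMod 2) (ι → ZMod 2) := fun ρ =>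
    Submodule.span (ZMod 2) {1} ⊔ Submodule.span (ZMod 2) (Set.range ρ)
  have hmem1 : ∀ ρ, 1 ∈ D ρ := fun ρ =>
    Submodule.mem_sup_left (Submodule.mem_span_singleton_self _)
  have hmem : ∀ ρ i, ρ i ∈ D ρ := fun ρ i =>
    Submodule.mem_sup_right (Submodule.subset_span ⟨i, rfl⟩)
  have hle : ∀ ρ (C : Submodule (ZMod 2) (ι → ZMod 2)), 1 ∈ C → (∀ i, ρ i ∈ C) → D ρ ≤ C := by
    intro ρ C h1 h2
    refine sup_le ?_ (Submodule.span_le.mpr ?_)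
    · rwa [Submodule.span_singleton_le_iff_mem]
    · rintro _ ⟨i, rfl⟩
      exact h2 i
  have hself : ∀ ρ, φ ρ ≠ 0 → D ρ ≤ dualCode (D ρ) := by
    intro ρ h0
    have hri : ∀ i, ρ i ⬝ᵥ 1 = 0 := fun i => by
      rw [← self_dotProduct]; exact hφ.support ρ i i h0
    have h3 : ∀ v, v ⬝ᵥ 1 = 0 → (∀ i, v ⬝ᵥ ρ i = 0) → D ρ ≤ dualCode (Submodule.span _ {v}) := by
      intro v h1 h2
      refine hle _ _ ?_ ?_
      · intro c hc
        obtain ⟨a, rfl⟩ := Submodule.mem_span_singleton.mp hc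
        simp [h1]
      · intro i c hc
        obtain ⟨a, rfl⟩ := Submodule.mem_span_singleton.mp hc
        simp [h2]
    have h4 : ∀ v, v ⬝ᵥ 1 = 0 → (∀ i, v ⬝ᵥ ρ i = 0) → ∀ c ∈ D ρ, c ⬝ᵥ v = 0 := by
      intro v h1 h2 c hc
      rw [dotProduct_comm]
      exact h3 v h1 h2 hc v (Submodule.mem_span_singleton_self v)
    refine hle _ _ (h4 1 h11 fun i => ?_) fun i => h4 _ (hri i) fun j => hφ.support ρ i j h0
    rw [dotProduct_comm]; exact hri i
  suffices H : ∀ C : Submodule (ZMod 2) (ι → ZMod 2), ∀ ρ, D ρ = C → φ ρ = 0 by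
    funext ρ
    exact H _ ρ rfl
  intro C
  induction C using WellFoundedLT.induction with
  | ind C ih =>
    intro ρ hρ
    by_contra h0
    have h2 := hφ.codeSum_eq_zero h (D ρ) (hmem1 ρ) (hself ρ h0)
    -- Tuples in `D ρ` that span less contribute zero by induction; the others have the value `φ ρ`.
    -- The code sum is therefore a positive multiple of `φ ρ`.
    have h3 : codeSum φ (D ρ) = ∑ ρ', if D ρ' = D ρ then φ ρ else 0 := by
      refine Finset.sum_congr rfl fun ρ' _ => ?_
      by_cases h4 : ∀ i, ρ' i ∈ D ρ
      · rw [if_pos h4]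
        rcases (hle ρ' _ (hmem1 ρ) h4).eq_or_lt with h5 | h5
        · rw [if_pos h5, hφ.eq_of_span_eq ρ ρ' h5.symm]
        · rw [if_neg h5.ne, ih (D ρ') (hρ ▸ h5) ρ' rfl]
      · rw [if_neg h4, if_neg]
        intro h5
        exact h4 fun i => h5 ▸ hmem ρ' i
    rw [h3, ← Finset.sum_filter, Finset.sum_const, nsmul_eq_mul] at h2
    rcases mul_eq_zero.mp h2 with h4 | h4
    · have : ρ ∈ Finset.univ.filter fun ρ' => D ρ' = D ρ := by simp
      rw [Nat.cast_eq_zero, Finset.card_eq_zero] at h4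
      simp [h4] at this
    · exact h0 h4

end IsCliffordInvariant

end Invariants

/-! ### Self-dual codes without words of weight two. -/

section SelfDual

variable {ι : Type*} [Fintype ι] [DecidableEq ι]

/-- The Hamming weight of a binary word. -/
def wt (c : ι → ZMod 2) : ℕ := ∑ i, (c i).val

/-- The code contains no word of weight two. -/
def NoWeightTwo (C : Submodule (ZMod 2) (ι → ZMod 2)) : Prop :=
  ∀ i j, i ≠ j → (Pi.single i 1 + Pi.single j 1 : ι → ZMod 2) ∉ C

lemma sgn_eq_sub_val (x : ZMod 2) : sgn x = 1 - 2 * (x.val : ℝ) := by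
  rcases zmod_two_eq x with rfl | rfl
  · simp
  · rw [sgn_one, show (1 : ZMod 2).val = 1 from rfl]; norm_num

lemma sum_sgn_eq (c : ι → ZMod 2) : ∑ i, sgn (c i) = Fintype.card ι - 2 * (wt c : ℝ) := by
  simp_rw [sgn_eq_sub_val]
  rw [Finset.sum_sub_distrib, ← Finset.mul_sum]
  simp [wt]

lemma wt_cast (c : ι → ZMod 2) : (wt c : ZMod 2) = c ⬝ᵥ 1 := by
  simp [wt, dotProduct]

lemma wt_zero : wt (0 : ι → ZMod 2) = 0 := by simp [wt]

lemma wt_eq_card (c : ι → ZMod 2) : wt c = (univ.filter fun i => c i = 1).card := by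
  rw [Finset.card_filter]
  refine Finset.sum_congr rfl fun i _ => ?_
  rcases zmod_two_eq (c i) with h | h <;> rw [h]
  · simp
  · rfl

lemma eq_zero_of_wt {c : ι → ZMod 2} (h : wt c = 0) : c = 0 := by
  rw [wt_eq_card, Finset.card_eq_zero, Finset.filter_eq_empty_iff] at h
  funext i
  exact (zmod_two_eq _).resolve_right (h (mem_univ i))

lemma wt_one_add (c : ι → ZMod 2) : wt (1 + c) + wt c = Fintype.card ι := by
  rw [wt, wt, ← Finset.sum_add_distrib, Fintype.card_eq_sum_ones]
  refine Finset.sum_congr rfl fun i _ => ?_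
  rcases zmod_two_eq (c i) with h | h
  · simp only [Pi.add_apply, Pi.one_apply, h]; rfl
  · simp only [Pi.add_apply, Pi.one_apply, h]; rfl

lemma eq_one_of_wt {c : ι → ZMod 2} (h : wt c = Fintype.card ι) : c = 1 := by
  have h1 : 1 + c = 0 := eq_zero_of_wt (by have := wt_one_add c; omega)
  funext i
  have h2 := congrFun h1 i
  rcases zmod_two_eq (c i) with h3 | h3
  · simp [h3] at h2
  · exact h3

lemma wt_add (c d : ι → ZMod 2) :
    wt (c + d) + 2 * ∑ i, (c i).val * (d i).val = wt c + wt d := by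
  rw [wt, wt, wt, Finset.mul_sum, ← Finset.sum_add_distrib, ← Finset.sum_add_distrib]
  refine Finset.sum_congr rfl fun i _ => ?_
  rw [Pi.add_apply]
  rcases zmod_two_eq (c i) with h | h <;> rcases zmod_two_eq (d i) with h' | h' <;>
    rw [h, h'] <;> rfl

lemma eq_single_add_single_of_wt {c : ι → ZMod 2} (h : wt c = 2) :
    ∃ i j, i ≠ j ∧ c = Pi.single i 1 + Pi.single j 1 := by
  rw [wt_eq_card, Finset.card_eq_two] at h
  obtain ⟨i, j, hij, h⟩ := h
  refine ⟨i, j, hij, ?_⟩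
  funext k
  have hk := Finset.ext_iff.mp h k
  simp only [mem_filter, mem_univ, true_and, mem_insert, mem_singleton] at hk
  by_cases h1 : k = i
  · subst h1
    simp [hk.mpr (Or.inl rfl), hij]
  · by_cases h2 : k = j
    · subst h2
      simp [hk.mpr (Or.inr rfl), h1]
    · have : c k = 0 := (zmod_two_eq _).resolve_right fun h3 => by
        rcases hk.mp h3 with h4 | h4 <;> contradiction
      simp [this, h1, h2]

lemma single_add_single_mem_dualCode {C : Submodule (ZMod 2) (ι → ZMod 2)} {i j : ι} :
    (Pi.single i 1 + Pi.single j 1 : ι → ZMod 2) ∈ dualCode C ↔ ∀ c ∈ C, c i = c j := by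
  rw [mem_dualCode]
  refine forall₂_congr fun c _ => ?_
  simp only [dotProduct_add, dotProduct_single, mul_one]
  exact CharTwo.add_eq_zero

-- Second moment of the weights: the expanded square is a sum of characters at `e_i + e_j`, so the
-- result counts pairs of coordinates that no word of `D` separates.
open Classical in
lemma sum_sq_sum_sgn (D : Submodule (ZMod 2) (ι → ZMod 2)) :
    ∑ c : D, (∑ i, sgn (c.1 i)) ^ 2 =
      Nat.card D * ∑ i, ((univ.filter fun j => ∀ c ∈ D, c i = c j).card : ℝ) := by
  have h1 : ∀ c : D, (∑ i, sgn (c.1 i)) ^ 2 =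
      ∑ i, ∑ j, sgn (c.1 ⬝ᵥ (Pi.single i 1 + Pi.single j 1)) := by
    intro c
    rw [sq, Finset.sum_mul_sum]
    simp [dotProduct_add, sgn_add]
  simp_rw [h1]
  rw [Finset.sum_comm, Finset.mul_sum]
  refine Finset.sum_congr rfl fun i _ => ?_
  rw [Finset.sum_comm]
  simp_rw [sum_sgn_dotProduct, single_add_single_mem_dualCode]
  rw [← Finset.sum_filter, Finset.sum_const, nsmul_eq_mul, mul_comm]

-- First moment of the weights: it counts the coordinates on which `D` vanishes identically.
open Classical in
lemma sum_sum_sgn (D : Submodule (ZMod 2) (ι → ZMod 2)) :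
    ∑ c : D, ∑ i, sgn (c.1 i) =
      Nat.card D * ((univ.filter fun i => ∀ c ∈ D, c i = 0).card : ℝ) := by
  rw [Finset.sum_comm]
  have h1 : ∀ i, ∑ c : D, sgn (c.1 i) = if ∀ c ∈ D, c i = 0 then (Nat.card D : ℝ) else 0 := by
    intro i
    have := sum_sgn_dotProduct D (Pi.single i 1)
    simpa [mem_dualCode] using this
  simp_rw [h1]
  rw [← Finset.sum_filter, Finset.sum_const, nsmul_eq_mul, mul_comm]

section Facts

variable {C : Submodule (ZMod 2) (ι → ZMod 2)}

lemma one_mem_of_selfDual (hC : dualCode C = C) : 1 ∈ C := by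
  rw [← hC]
  intro c hc
  rw [← self_dotProduct]
  rw [← hC] at hc
  exact hc c (hC ▸ hc)

lemma dotProduct_eq_zero_of_selfDual (hC : dualCode C = C) {c d : ι → ZMod 2} (hc : c ∈ C)
    (hd : d ∈ C) : c ⬝ᵥ d = 0 := by
  rw [← hC] at hd
  exact hd c hc

lemma even_wt_of_selfDual (hC : dualCode C = C) {c : ι → ZMod 2} (hc : c ∈ C) :
    Even (wt c) := by
  rw [← ZMod.natCast_eq_zero_iff_even, wt_cast]
  exact dotProduct_eq_zero_of_selfDual hC hc (one_mem_of_selfDual hC)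

lemma wt_ne_two (h2 : NoWeightTwo C) {c : ι → ZMod 2} (hc : c ∈ C) : wt c ≠ 2 := by
  intro h
  obtain ⟨i, j, hij, rfl⟩ := eq_single_add_single_of_wt h
  exact h2 i j hij hc

lemma wt_le (c : ι → ZMod 2) : wt c ≤ Fintype.card ι := by
  have := wt_one_add c; omega

lemma wt_add_two_ne (hC : dualCode C = C) (h2 : NoWeightTwo C) {c : ι → ZMod 2} (hc : c ∈ C) :
    wt c + 2 ≠ Fintype.card ι := by
  intro h
  exact wt_ne_two h2 (C.add_mem (one_mem_of_selfDual hC) hc) (by have := wt_one_add c; omega)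

lemma card_sq_of_selfDual (hC : dualCode C = C) :
    (Nat.card C) ^ 2 = 2 ^ Fintype.card ι := by
  have := card_mul_card_dualCode C
  rw [hC] at this
  rw [sq]
  exact_mod_cast this

-- By self-duality, two coordinates that no codeword separates would give a word of weight two in
-- `C`; so every class of equal coordinates is a singleton.
open Classical in
lemma sum_sq_of_selfDual (hC : dualCode C = C) (h2 : NoWeightTwo C) :
    ∑ c : C, (∑ i, sgn (c.1 i)) ^ 2 = Nat.card C * Fintype.card ι := by
  rw [sum_sq_sum_sgn]
  congr 1
  have : ∀ i, (univ.filter fun j => ∀ c ∈ C, c i = c j) = {i} := by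
    intro i
    ext j
    simp only [mem_filter, mem_univ, true_and, mem_singleton]
    constructor
    · intro h
      by_contra hij
      rw [← single_add_single_mem_dualCode, hC] at h
      exact h2 i j (Ne.symm hij) h
    · rintro rfl
      simp
  simp [this]

/-- In length `n ≤ 6`, excluding the weights 2 and `n - 2` leaves only 0 and `n`. Every squared
character sum is then `n ^ 2`, whereas the second moment gives an average of `n`. -/
lemma not_noWeightTwo_of_card_le_six (hC : dualCode C = C) (h0 : 0 < Fintype.card ι)
    (he : Even (Fintype.card ι)) (h6 : Fintype.card ι ≤ 6) (h1 : Fintype.card ι ≠ 1) :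
    ¬ NoWeightTwo C := by
  classical
  intro h2
  have h3 := sum_sq_of_selfDual hC h2
  have h4 : ∀ c : C, (∑ i, sgn (c.1 i)) ^ 2 = (Fintype.card ι : ℝ) ^ 2 := by
    intro c
    rw [sum_sgn_eq]
    have h5 := wt_le c.1
    have h6 := wt_ne_two h2 c.2
    have h7 := wt_add_two_ne hC h2 c.2
    obtain ⟨k, hk⟩ := even_wt_of_selfDual hC c.2
    obtain ⟨n, hn⟩ := he
    have h8 : wt c.1 = 0 ∨ wt c.1 = Fintype.card ι := by omega
    rcases h8 with h8 | h8 <;> rw [h8]  <;> push_cast <;> ring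
  simp_rw [h4] at h3
  rw [Finset.sum_const, Finset.card_univ, ← Nat.card_eq_fintype_card, nsmul_eq_mul] at h3
  have h5 : (Nat.card C : ℝ) ≠ 0 := by exact_mod_cast Nat.card_pos.ne'
  have h6 := mul_left_cancel₀ h5 h3
  have h7 : Fintype.card ι * Fintype.card ι = Fintype.card ι * 1 := by
    rw [mul_one, ← sq]
    exact_mod_cast h6
  exact h1 (Nat.eq_of_mul_eq_mul_left h0 h7)

/-- The words of a self-dual code whose weight is divisible by four. -/
def doublyEven (C : Submodule (ZMod 2) (ι → ZMod 2)) (hC : dualCode C = C) :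
    Submodule (ZMod 2) (ι → ZMod 2) where
  carrier := {c | c ∈ C ∧ 4 ∣ wt c}
  zero_mem' := ⟨C.zero_mem, by simp [wt_zero]⟩
  add_mem' := by
    rintro a b ⟨ha, ha'⟩ ⟨hb, hb'⟩
    refine ⟨C.add_mem ha hb, ?_⟩
    have h1 := wt_add a b
    have h2 : Even (∑ i, (a i).val * (b i).val) := by
      rw [← ZMod.natCast_eq_zero_iff_even, ← dotProduct_eq_zero_of_selfDual hC ha hb]
      simp [dotProduct]
    obtain ⟨k, hk⟩ := h2
    omega
  smul_mem' := by
    rintro x a ⟨ha, ha'⟩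
    rcases zmod_two_eq x with rfl | rfl
    · simp [wt_zero]
    · simpa using ⟨ha, ha'⟩

lemma mem_doublyEven {hC : dualCode C = C} {c : ι → ZMod 2} :
    c ∈ doublyEven C hC ↔ c ∈ C ∧ 4 ∣ wt c := Iff.rfl

lemma add_mem_doublyEven (hC : dualCode C = C) {c d : ι → ZMod 2} (hc : c ∈ C) (hd : d ∈ C)
    (hc' : c ∉ doublyEven C hC) (hd' : d ∉ doublyEven C hC) : c + d ∈ doublyEven C hC := by
  rw [mem_doublyEven] at *
  refine ⟨C.add_mem hc hd, ?_⟩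
  have h1 := wt_add c d
  have h2 : Even (∑ i, (c i).val * (d i).val) := by
    rw [← ZMod.natCast_eq_zero_iff_even, ← dotProduct_eq_zero_of_selfDual hC hc hd]
    simp [dotProduct]
  obtain ⟨k, hk⟩ := h2
  obtain ⟨a, ha⟩ := even_wt_of_selfDual hC hc
  obtain ⟨b, hb⟩ := even_wt_of_selfDual hC hd
  simp only [hc, hd, true_and] at hc' hd'
  omega

lemma card_of_index_two {D : Submodule (ZMod 2) (ι → ZMod 2)} (hD : D ≤ C) {c₀ : ι → ZMod 2}
    (hc₀ : c₀ ∈ C) (hc₀' : c₀ ∉ D) (hadd : ∀ c ∈ C, ∀ d ∈ C, c ∉ D → d ∉ D → c + d ∈ D) :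
    2 * Nat.card D = Nat.card C := by
  classical
  rw [Nat.card_eq_fintype_card, Nat.card_eq_fintype_card, Fintype.card_subtype,
    Fintype.card_subtype]
  have h1 : (univ.filter fun c => c ∈ C) = (univ.filter fun c => c ∈ D) ∪
      (univ.filter fun c => c ∈ D).image (c₀ + ·) := by
    ext c
    simp only [mem_filter, mem_univ, true_and, mem_union, mem_image]
    constructor
    · intro h
      by_cases hc : c ∈ D
      · exact Or.inl hc
      · refine Or.inr ⟨c₀ + c, hadd _ hc₀ _ h hc₀' hc, ?_⟩
        funext i
        simp only [Pi.add_apply]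
        rw [← add_assoc, zmod_two_add_self, zero_add]
    · rintro (h | ⟨d, hd, rfl⟩)
      · exact hD h
      · exact C.add_mem hc₀ (hD hd)
  rw [h1, Finset.card_union_of_disjoint, Finset.card_image_of_injective _
    (add_right_injective c₀)]
  · ring
  · rw [Finset.disjoint_left]
    intro c hc hc'
    simp only [mem_filter, mem_univ, true_and, mem_image] at hc hc'
    obtain ⟨d, hd, rfl⟩ := hc'
    exact hc₀' (by simpa using D.sub_mem hc hd)

/-- The doubly even subcode has 16 words, and all its nonzero words have weight 4, as weight 8 would
have a complement of weight 2. The first moment is `10 + 15 * 2 = 40`, which is not divisible by 16.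
-/
lemma not_noWeightTwo_of_card_eq_ten (hC : dualCode C = C) (h10 : Fintype.card ι = 10) :
    ¬ NoWeightTwo C := by
  classical
  intro h2
  have hcard : Nat.card C = 32 := by
    have := card_sq_of_selfDual hC
    rw [h10] at this
    nlinarith
  have h1 : (1 : ι → ZMod 2) ∉ doublyEven C hC := by
    rintro ⟨-, h⟩
    have := wt_one_add (0 : ι → ZMod 2)
    rw [add_zero, wt_zero, h10] at this
    omega
  have h3 := card_of_index_two (D := doublyEven C hC) (fun c hc => hc.1) (one_mem_of_selfDual hC) h1
    fun c hc d hd => add_mem_doublyEven hC hc hd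
  have h4 := sum_sum_sgn (doublyEven C hC)
  rw [← Finset.add_sum_erase _ _ (mem_univ 0),
    Finset.sum_congr (s₁ := univ.erase 0) rfl (g := fun _ => (2 : ℝ)), Finset.sum_const,
    Finset.card_erase_of_mem (mem_univ _), Finset.card_univ, ← Nat.card_eq_fintype_card,
    show Nat.card (doublyEven C hC) = 16 by omega] at h4
  · simp only [Submodule.coe_zero, Pi.zero_apply, sgn_zero, Finset.sum_const, Finset.card_univ,
      h10, nsmul_eq_mul] at h4
    norm_num at h4
    norm_cast at h4
    omega
  · intro c hc
    have h5 : wt c.1 ≠ 0 := fun h => (Finset.mem_erase.mp hc).1 (Subtype.ext (eq_zero_of_wt h))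
    have h6 := wt_add_two_ne hC h2 c.2.1
    obtain ⟨k, hk⟩ := c.2.2
    have h7 := wt_le c.1
    rw [sum_sgn_eq, h10, show wt c.1 = 4 by omega]
    norm_num

/-- A code of length `2 * k` is of type `d⁺` if its coordinates can be paired such that the words
of the code are those that have a constant sum on the pairs and an even number of ones at the
first members of the pairs. -/
def IsDPlus (k : ℕ) (C : Submodule (ZMod 2) (ι → ZMod 2)) : Prop :=
  ∃ e : Fin k × Bool ≃ ι, ∀ c, c ∈ C ↔
    (∃ α, ∀ t, c (e (t, false)) + c (e (t, true)) = α) ∧ ∑ t, c (e (t, false)) = 0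

-- The coordinates are grouped into classes not separated by `D`. A class has at most two members,
-- since among three some two would not be separated by `C` either; the second moment says that the
-- average size is two.
open Classical in
lemma exists_pairing (hC : dualCode C = C) (h2 : NoWeightTwo C)
    {D : Submodule (ZMod 2) (ι → ZMod 2)}
    (hadd : ∀ c ∈ C, ∀ d ∈ C, c ∉ D → d ∉ D → c + d ∈ D)
    (hsum : ∑ c : D, (∑ i, sgn (c.1 i)) ^ 2 = Nat.card D * (2 * Fintype.card ι)) :
    ∃ τ : ι → ι, Function.Involutive τ ∧ (∀ c ∈ D, ∀ i, c i = c (τ i)) ∧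
      ∀ c ∈ C, c ∉ D → ∀ i, c i ≠ c (τ i) := by
  set R : ι → Finset ι := fun i => univ.filter fun j => ∀ c ∈ D, c i = c j with hR
  have hmemR : ∀ i j, j ∈ R i ↔ ∀ c ∈ D, c i = c j := by simp [hR]
  have hself : ∀ i, i ∈ R i := by simp [hR]
  have hne : ∀ c ∈ C, c ∉ D → ∀ i j, i ≠ j → j ∈ R i → c i ≠ c j := by
    intro c hc hcD i j hij hj h
    have h3 := h2 i j hij
    rw [← hC, single_add_single_mem_dualCode] at h3
    push Not at h3
    obtain ⟨d, hd, hdij⟩ := h3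
    have hdD : d ∉ D := fun h4 => hdij ((hmemR i j).mp hj d h4)
    have h4 := (hmemR i j).mp hj _ (hadd c hc d hd hcD hdD)
    rw [Pi.add_apply, Pi.add_apply, h] at h4
    exact hdij (add_left_cancel h4)
  have hle : ∀ i, ((R i).erase i).card ≤ 1 := by
    intro i
    rw [Finset.card_le_one]
    intro j hj k hk
    rw [Finset.mem_erase] at hj hk
    by_contra hjk
    refine h2 j k hjk ?_
    rw [← hC, single_add_single_mem_dualCode]
    intro c hc
    by_cases hcD : c ∈ D
    · rw [← (hmemR i j).mp hj.2 c hcD, (hmemR i k).mp hk.2 c hcD]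
    · have h3 := hne c hc hcD i j hj.1.symm hj.2
      have h4 := hne c hc hcD i k hk.1.symm hk.2
      rcases zmod_two_eq (c i) with h5 | h5 <;> rcases zmod_two_eq (c j) with h6 | h6 <;>
        rcases zmod_two_eq (c k) with h7 | h7 <;> simp_all
  have hcardR : ∀ i, (R i).card = ((R i).erase i).card + 1 := fun i =>
    (Finset.card_erase_add_one (hself i)).symm
  have htot : ∑ i, ((R i).erase i).card = ∑ i : ι, 1 := by
    have h3 := sum_sq_sum_sgn D
    rw [hsum] at h3
    have h5 : (Nat.card D : ℝ) ≠ 0 := by exact_mod_cast Nat.card_pos.ne'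
    have h6 := mul_left_cancel₀ h5 h3
    have h7 : 2 * Fintype.card ι = ∑ i, (R i).card := by exact_mod_cast h6
    simp_rw [hcardR, Finset.sum_add_distrib] at h7
    simp only [Finset.sum_const, Finset.card_univ, smul_eq_mul, mul_one] at h7 ⊢
    omega
  have hone : ∀ i, ((R i).erase i).card = 1 := fun i =>
    (Finset.sum_eq_sum_iff_of_le fun i _ => hle i).mp htot i (mem_univ i)
  simp_rw [Finset.card_eq_one] at hone
  choose τ hτ using hone
  have hτR : ∀ i j, j ≠ i ∧ j ∈ R i ↔ j = τ i := by
    intro i j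
    rw [← Finset.mem_erase, hτ i, Finset.mem_singleton]
  have hτ1 : ∀ i, τ i ≠ i ∧ τ i ∈ R i := fun i => (hτR i _).mpr rfl
  refine ⟨τ, fun i => ?_, fun c hc i => (hmemR _ _).mp (hτ1 i).2 c hc,
    fun c hc hcD i => hne c hc hcD i _ (hτ1 i).1.symm (hτ1 i).2⟩
  refine ((hτR (τ i) i).mp ⟨(hτ1 i).1.symm, ?_⟩).symm
  rw [hmemR]
  exact fun c hc => ((hmemR _ _).mp (hτ1 i).2 c hc).symm

-- Words of `D` have sum 0 on every pair and the other words of `C` have sum 1. Orthogonality to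
-- `c₀` gives the parity condition on the first members.
open Classical in
lemma isDPlus_of_index_two (hC : dualCode C = C) (h2 : NoWeightTwo C) {k : ℕ} (hk : Even k)
    (hι : Fintype.card ι = 2 * k)
    {D : Submodule (ZMod 2) (ι → ZMod 2)} {c₀ : ι → ZMod 2}
    (hc₀ : c₀ ∈ C) (hc₀' : c₀ ∉ D) (hadd : ∀ c ∈ C, ∀ d ∈ C, c ∉ D → d ∉ D → c + d ∈ D)
    (hsum : ∑ c : D, (∑ i, sgn (c.1 i)) ^ 2 = Nat.card D * (2 * Fintype.card ι)) :
    IsDPlus k C := by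
  obtain ⟨τ, hττ, hτD, hτC⟩ := exists_pairing hC h2 hadd hsum
  have hτ0 : ∀ i, c₀ (τ i) = 1 + c₀ i := by
    intro i
    have := hτC c₀ hc₀ hc₀' i
    generalize c₀ i = x, c₀ (τ i) = y at this ⊢
    revert x y
    decide
  -- The word `c₀` has exactly one 1 in each pair; its support supplies the first members.
  let f : {i // c₀ i = 1} × Bool → ι := fun p => if p.2 then τ p.1 else p.1
  have hf : Function.Bijective f := by
    constructor
    · rintro ⟨⟨i, hi⟩, a⟩ ⟨⟨j, hj⟩, b⟩ h
      cases a <;> cases b <;> simp only [f, if_true, Bool.false_eq_true, if_false] at h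
      · simp [h]
      · have := hτ0 j; rw [← h, hi, hj] at this; exact absurd this (by decide)
      · have := hτ0 i; rw [h, hi, hj] at this; exact absurd this (by decide)
      · simp [hττ.injective h]
    · intro i
      rcases zmod_two_eq (c₀ i) with h | h
      · refine ⟨(⟨τ i, by rw [hτ0, h]; rfl⟩, true), ?_⟩
        simp [f, hττ i]
      · exact ⟨(⟨i, h⟩, false), by simp [f]⟩
  have hcard : Fintype.card {i // c₀ i = 1} = k := by
    have := Fintype.card_of_bijective hf
    rw [Fintype.card_prod, hι, Fintype.card_bool] at this
    omega
  let g : Fin k ≃ {i // c₀ i = 1} := (Fintype.equivFinOfCardEq hcard).symm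
  let e : Fin k × Bool ≃ ι := (g.prodCongr (Equiv.refl _)).trans (Equiv.ofBijective f hf)
  have hef : ∀ t, e (t, false) = g t := fun t => by simp [e, f]
  have het : ∀ t, e (t, true) = τ (g t) := fun t => by simp [e, f]
  have hsplit : ∀ F : ι → ZMod 2, ∑ i, F i = ∑ t, (F (e (t, false)) + F (e (t, true))) := by
    intro F
    rw [← Equiv.sum_comp e, Fintype.sum_prod_type]
    refine Finset.sum_congr rfl fun t _ => ?_
    rw [Fintype.sum_bool, add_comm]
  have hfwd : ∀ c ∈ C, (∃ α, ∀ t, c (e (t, false)) + c (e (t, true)) = α) ∧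
      ∑ t, c (e (t, false)) = 0 := by
    intro c hc
    constructor
    · by_cases hcD : c ∈ D
      · refine ⟨0, fun t => ?_⟩
        rw [hef, het, ← hτD c hcD, zmod_two_add_self]
      · refine ⟨1, fun t => ?_⟩
        rw [hef, het]
        have := hτC c hc hcD (g t)
        generalize c (g t) = x, c (τ (g t)) = y at this ⊢
        revert x y
        decide
    · have h3 := dotProduct_eq_zero_of_selfDual hC hc hc₀
      rw [dotProduct, hsplit] at h3
      rw [← h3]
      refine Finset.sum_congr rfl fun t _ => ?_
      have h4 : c₀ (g t) = 1 := (g t).2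
      rw [hef, het, hτ0, h4, show (1 : ZMod 2) + 1 = 0 from rfl]
      ring
  refine ⟨e, fun c => ⟨hfwd c, ?_⟩⟩
  rintro ⟨⟨α, hα⟩, hs⟩
  -- The two conditions already make a word orthogonal to all of `C`: the pairwise products sum to
  -- multiples of the two vanishing parities and of `k`, which is even.
  rw [← hC]
  intro d hd
  obtain ⟨⟨β, hβ⟩, hs'⟩ := hfwd d hd
  rw [dotProduct, hsplit]
  have h3 : ∀ t, d (e (t, false)) * c (e (t, false)) + d (e (t, true)) * c (e (t, true)) =
      β * c (e (t, false)) + α * d (e (t, false)) + α * β := by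
    intro t
    rw [← hα t, ← hβ t]
    generalize c (e (t, false)) = x, c (e (t, true)) = y, d (e (t, false)) = z,
      d (e (t, true)) = w
    revert x y z w
    decide
  simp_rw [h3]
  rw [Finset.sum_add_distrib, Finset.sum_add_distrib, ← Finset.mul_sum, ← Finset.mul_sum, hs, hs']
  have hk' : (k : ZMod 2) = 0 := ZMod.natCast_eq_zero_iff_even.mpr hk
  simp [hk']

/-- The weights of `C` are 0, 4 and 8, and weight 4 contributes nothing to the second moment. Taking
for `D` the words that agree at two chosen coordinates gives index two and the moment `64 + 64 = 8 *
16`. -/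
theorem isDPlus_of_card_eq_eight (hC : dualCode C = C) (h2 : NoWeightTwo C)
    (h8 : Fintype.card ι = 8) : IsDPlus 4 C := by
  classical
  obtain ⟨a, b, hab⟩ := Fintype.exists_pair_of_one_lt_card (α := ι) (by omega)
  have hcard : Nat.card C = 16 := by
    have := card_sq_of_selfDual hC
    rw [h8] at this
    nlinarith
  let f : (ι → ZMod 2) →ₗ[ZMod 2] ZMod 2 := LinearMap.proj (R := ZMod 2) (φ := fun _ : ι => ZMod 2) a +
    LinearMap.proj (R := ZMod 2) (φ := fun _ : ι => ZMod 2) b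
  set D : Submodule (ZMod 2) (ι → ZMod 2) := C ⊓ LinearMap.ker f with hD
  have hmemD : ∀ c, c ∈ D ↔ c ∈ C ∧ c a = c b := by
    intro c
    simp only [hD, Submodule.mem_inf, LinearMap.mem_ker, f, LinearMap.add_apply,
      LinearMap.proj_apply, CharTwo.add_eq_zero]
  have h1 : (1 : ι → ZMod 2) ∈ D := (hmemD 1).mpr ⟨one_mem_of_selfDual hC, rfl⟩
  have hwt1 : wt (1 : ι → ZMod 2) = 8 := by
    have := wt_one_add (0 : ι → ZMod 2)
    rwa [add_zero, wt_zero, h8] at this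
  have h01 : (0 : ι → ZMod 2) ≠ 1 := by
    intro h
    rw [← h, wt_zero] at hwt1
    omega
  have hsum : ∑ c : D, (∑ i, sgn (c.1 i)) ^ 2 = 128 := by
    have h3 : ∀ c : D, (∑ i, sgn (c.1 i)) ^ 2 =
        (if c = 0 then 64 else 0) + if c = ⟨1, h1⟩ then 64 else 0 := by
      intro c
      rw [sum_sgn_eq, h8]
      by_cases hc0 : c = 0
      · subst hc0
        have : (0 : D) ≠ ⟨1, h1⟩ := fun h => h01 (congrArg Subtype.val h)
        simp only [Submodule.coe_zero, wt_zero, if_true, if_neg this]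
        norm_num
      by_cases hc1 : c = ⟨1, h1⟩
      · rw [if_neg hc0, if_pos hc1, hc1]
        simp only [hwt1]
        norm_num
      · rw [if_neg hc0, if_neg hc1]
        have hcC := ((hmemD _).mp c.2).1
        obtain ⟨k, hk⟩ := even_wt_of_selfDual hC hcC
        have h4 : wt c.1 ≠ 0 := fun h => hc0 (Subtype.ext (eq_zero_of_wt h))
        have h5 : wt c.1 ≠ 8 := fun h => hc1 (Subtype.ext (eq_one_of_wt (by omega)))
        have h6 := wt_le c.1
        have h7 := wt_ne_two h2 hcC
        have h9 := wt_add_two_ne hC h2 hcC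
        rw [show wt c.1 = 4 by omega]
        norm_num
    simp_rw [h3]
    rw [Finset.sum_add_distrib]
    simp
    norm_num
  obtain ⟨c₀, hc₀, hc₀'⟩ : ∃ c₀ ∈ C, c₀ ∉ D := by
    have h3 := h2 a b hab
    rw [← hC, single_add_single_mem_dualCode] at h3
    push Not at h3
    obtain ⟨d, hd, hdab⟩ := h3
    exact ⟨d, hd, fun h => hdab ((hmemD d).mp h).2⟩
  have hadd : ∀ c ∈ C, ∀ d ∈ C, c ∉ D → d ∉ D → c + d ∈ D := by
    intro c hc d hd hcD hdD
    rw [hmemD] at *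
    refine ⟨C.add_mem hc hd, ?_⟩
    simp only [hc, hd, true_and, Pi.add_apply] at *
    generalize c a = x, c b = y, d a = z, d b = w at *
    revert x y z w
    decide
  have h3 := card_of_index_two (D := D) (fun c hc => ((hmemD c).mp hc).1) hc₀ hc₀' hadd
  refine isDPlus_of_index_two hC h2 (by decide) h8 hc₀ hc₀' hadd ?_
  rw [hsum, h8, show Nat.card D = 8 by omega]
  norm_num

/-- Here `D` is the doubly even subcode. Its weights 0, 4, 8, 12 give the squares 144, 16, 16, 144,
hence the moment `16 * 32 + 256 = 32 * 24`. -/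
theorem isDPlus_of_card_eq_twelve (hC : dualCode C = C) (h2 : NoWeightTwo C)
    (h12 : Fintype.card ι = 12) : IsDPlus 6 C := by
  classical
  have hcard : Nat.card C = 64 := by
    have := card_sq_of_selfDual hC
    rw [h12] at this
    nlinarith
  have h1C := one_mem_of_selfDual hC
  have h1 : (1 : ι → ZMod 2) ∈ doublyEven C hC := by
    refine ⟨h1C, ?_⟩
    have := wt_one_add (0 : ι → ZMod 2)
    rw [add_zero, wt_zero, h12] at this
    omega
  have h01 : (0 : ι → ZMod 2) ≠ 1 := by
    intro h
    have := wt_one_add (0 : ι → ZMod 2)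
    rw [← h, add_zero, wt_zero, h12] at this
    omega
  have hsum : ∑ c : doublyEven C hC, (∑ i, sgn (c.1 i)) ^ 2 =
      16 * Nat.card (doublyEven C hC) + 256 := by
    have h3 : ∀ c : doublyEven C hC, (∑ i, sgn (c.1 i)) ^ 2 =
        16 + ((if c = 0 then 128 else 0) + if c = ⟨1, h1⟩ then 128 else 0) := by
      intro c
      rw [sum_sgn_eq, h12]
      by_cases hc0 : c = 0
      · subst hc0
        have : (0 : doublyEven C hC) ≠ ⟨1, h1⟩ := fun h => h01 (congrArg Subtype.val h)
        simp only [Submodule.coe_zero, wt_zero, if_true, if_neg this]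
        norm_num
      by_cases hc1 : c = ⟨1, h1⟩
      · rw [if_neg hc0, if_pos hc1, hc1]
        have : wt (1 : ι → ZMod 2) = 12 := by
          have := wt_one_add (0 : ι → ZMod 2)
          rwa [add_zero, wt_zero, h12] at this
        simp only [this]
        norm_num
      · rw [if_neg hc0, if_neg hc1]
        obtain ⟨k, hk⟩ := c.2.2
        have h4 : wt c.1 ≠ 0 := fun h => hc0 (Subtype.ext (eq_zero_of_wt h))
        have h5 : wt c.1 ≠ 12 := fun h => hc1 (Subtype.ext (eq_one_of_wt (by omega)))
        have h6 := wt_le c.1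
        have h7 : wt c.1 = 4 ∨ wt c.1 = 8 := by omega
        rcases h7 with h7 | h7 <;> rw [h7] <;> norm_num
    simp_rw [h3]
    rw [Finset.sum_add_distrib, Finset.sum_add_distrib, Finset.sum_const, Finset.card_univ,
      ← Nat.card_eq_fintype_card]
    simp
    ring
  -- If all of `C` were doubly even, the second moment would be `16 * 64 + 256`, not `64 * 12`.
  obtain ⟨c₀, hc₀, hc₀'⟩ : ∃ c₀ ∈ C, c₀ ∉ doublyEven C hC := by
    by_contra! h
    have h3 : doublyEven C hC = C := le_antisymm (fun c hc => hc.1) h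
    rw [h3, sum_sq_of_selfDual hC h2, hcard, h12] at hsum
    norm_num at hsum
  have h3 := card_of_index_two (D := doublyEven C hC) (fun c hc => hc.1) hc₀ hc₀'
    fun c hc d hd => add_mem_doublyEven hC hc hd
  refine isDPlus_of_index_two hC h2 (by decide) h12 hc₀ hc₀'
    (fun c hc d hd => add_mem_doublyEven hC hc hd) ?_
  rw [hsum, h12, show Nat.card (doublyEven C hC) = 32 by omega]
  norm_num

lemma IsDPlus.exists_equiv {k : ℕ} {C' : Submodule (ZMod 2) (ι → ZMod 2)} (h : IsDPlus k C)
    (h' : IsDPlus k C') : ∃ σ : ι ≃ ι, ∀ c, c ∈ C' ↔ c ∘ σ ∈ C := by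
  obtain ⟨e, he⟩ := h
  obtain ⟨e', he'⟩ := h'
  refine ⟨e.symm.trans e', fun c => ?_⟩
  rw [he, he']
  simp

section CodeSum

variable {κ : Type*} [Fintype κ] [DecidableEq κ]

lemma codeSum_eq_of_equiv {φ : (κ → ι → ZMod 2) → ℝ} {C' : Submodule (ZMod 2) (ι → ZMod 2)}
    (hφ : ∀ (σ : ι ≃ ι) ρ, φ (fun a => ρ a ∘ σ) = φ ρ) (σ : ι ≃ ι)
    (hσ : ∀ c, c ∈ C' ↔ c ∘ σ ∈ C) : codeSum φ C' = codeSum φ C := by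
  classical
  unfold codeSum
  rw [← Equiv.sum_comp (Equiv.piCongrRight fun _ : κ => σ.symm.arrowCongr (Equiv.refl (ZMod 2)))
    (fun ρ => if ∀ i, ρ i ∈ C then φ ρ else 0)]
  refine Finset.sum_congr rfl fun ρ _ => ?_
  have h1 : (Equiv.piCongrRight fun _ : κ => σ.symm.arrowCongr (Equiv.refl (ZMod 2))) ρ =
      fun a => ρ a ∘ σ := rfl
  rw [h1, hφ σ ρ]
  simp only [hσ]

/-- The Laplacian condition on the tensor of a polynomial. -/
def IsHarmonic (φ : (κ → ι → ZMod 2) → ℝ) : Prop :=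
  ∀ (ρ : κ → ι → ZMod 2) (i j : ι), i ≠ j → (∀ a, ρ a i = ρ a j) →
    ∑ v : κ → ZMod 2, φ (fun a => ρ a + v a • (Pi.single i 1 + Pi.single j 1)) = 0

/-- A word of weight two in the self-dual `C` forces its two coordinates to agree on `C`.
Translating rows by multiples of it permutes the tuples over `C`, and averaging over these
translations produces the vanishing sums of `IsHarmonic`. -/
lemma codeSum_eq_zero_of_isHarmonic {φ : (κ → ι → ZMod 2) → ℝ} (hφ : IsHarmonic φ)
    (hC : dualCode C = C) (h2 : ¬ NoWeightTwo C) : codeSum φ C = 0 := by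
  classical
  simp only [NoWeightTwo, not_forall, not_not] at h2
  obtain ⟨i, j, hij, h2⟩ := h2
  set w : ι → ZMod 2 := Pi.single i 1 + Pi.single j 1 with hw
  have h3 : ∀ c ∈ C, c i = c j := by
    rw [← single_add_single_mem_dualCode, hC]
    exact h2
  have h4 : ∀ v : κ → ZMod 2, codeSum φ C =
      ∑ ρ : κ → ι → ZMod 2, if ∀ a, ρ a ∈ C then φ (fun a => ρ a + v a • w) else 0 := by
    intro v
    unfold codeSum
    rw [← Equiv.sum_comp (Equiv.addRight fun a => v a • w)]
    refine Finset.sum_congr rfl fun ρ _ => ?_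
    have h5 : ∀ a, (Equiv.addRight fun a => v a • w) ρ a ∈ C ↔ ρ a ∈ C := by
      intro a
      exact C.add_mem_iff_left (C.smul_mem _ h2)
    simp only [h5]
    rfl
  have h5 : ∑ _v : κ → ZMod 2, codeSum φ C = 0 := by
    rw [Finset.sum_congr rfl fun v _ => h4 v, Finset.sum_comm]
    refine Finset.sum_eq_zero fun ρ _ => ?_
    by_cases h : ∀ a, ρ a ∈ C
    · simp only [h, implies_true, if_true]
      exact hφ ρ i j hij fun a => h3 _ (h a)
    · simp [h]
  rw [Finset.sum_const, nsmul_eq_mul] at h5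
  refine (mul_eq_zero.mp h5).resolve_left ?_
  exact_mod_cast (Finset.card_pos.mpr Finset.univ_nonempty).ne'

end CodeSum

end Facts

end SelfDual

open MvPolynomial

/-! ### The apolar product, the Laplacian and the tensor of a polynomial. -/

section Apolar

variable {σ : Type*} [Fintype σ] [DecidableEq σ]

/-- The product of the factorials of the exponents of a monomial. -/
def factorialWeight (s : σ →₀ ℕ) : ℝ := ∏ i, ((s i).factorial : ℝ)

lemma factorialWeight_ne_zero (s : σ →₀ ℕ) : factorialWeight s ≠ 0 :=
  Finset.prod_ne_zero_iff.mpr fun i _ => by exact_mod_cast (s i).factorial_ne_zero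

lemma factorialWeight_add_single (s : σ →₀ ℕ) (i : σ) :
    factorialWeight (s + Finsupp.single i 1) = (s i + 1) * factorialWeight s := by
  unfold factorialWeight
  rw [← Finset.mul_prod_erase _ _ (Finset.mem_univ i),
    ← Finset.mul_prod_erase (a := i) _ (fun i => ((s i).factorial : ℝ)) (Finset.mem_univ i),
    ← mul_assoc]
  congr 1
  · simp [Nat.factorial_succ]
  · refine Finset.prod_congr rfl fun j hj => ?_
    simp [(Finset.ne_of_mem_erase hj).symm]

/-- The apolar inner product of real polynomials. -/
def apolar : MvPolynomial σ ℝ →ₗ[ℝ] MvPolynomial σ ℝ →ₗ[ℝ] ℝ where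
  toFun p := (basisMonomials σ ℝ).constr ℝ fun s => factorialWeight s * coeff s p
  map_add' p q := by
    refine (basisMonomials σ ℝ).ext fun s => ?_
    simp only [LinearMap.add_apply, Module.Basis.constr_basis, coeff_add, mul_add]
  map_smul' c p := by
    refine (basisMonomials σ ℝ).ext fun s => ?_
    simp only [Module.Basis.constr_basis, LinearMap.smul_apply, coeff_smul, smul_eq_mul,
      RingHom.id_apply]
    ring

lemma apolar_monomial (p : MvPolynomial σ ℝ) (s : σ →₀ ℕ) :
    apolar p (monomial s 1) = factorialWeight s * coeff s p := by
  have := (basisMonomials σ ℝ).constr_basis ℝ (fun s => factorialWeight s * coeff s p) s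
  rwa [coe_basisMonomials] at this

/-- The factorial weights are chosen so that differentiation is adjoint to multiplication by a
variable. Consequently the Laplacian is adjoint to multiplication by `normSq`. -/
lemma apolar_pderiv (i : σ) (p q : MvPolynomial σ ℝ) :
    apolar (pderiv i p) q = apolar p (X i * q) := by
  have h : apolar (pderiv i p) = apolar p ∘ₗ LinearMap.mulLeft ℝ (X i) := by
    refine (basisMonomials σ ℝ).ext fun s => ?_
    rw [coe_basisMonomials, LinearMap.comp_apply, LinearMap.mulLeft_apply, apolar_monomial,
      coeff_pderiv, X, monomial_mul, one_mul, add_comm (Finsupp.single i 1) s, apolar_monomial,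
      factorialWeight_add_single]
    ring
  rw [h]
  rfl

lemma eq_zero_of_apolar {p : MvPolynomial σ ℝ} (h : ∀ q, apolar p q = 0) : p = 0 := by
  ext s
  have := h (monomial s 1)
  rw [apolar_monomial] at this
  simpa using (mul_eq_zero.mp this).resolve_left (factorialWeight_ne_zero s)

/-- The Laplacian. -/
def laplacian : MvPolynomial σ ℝ →ₗ[ℝ] MvPolynomial σ ℝ :=
  ∑ i, (pderiv i : Derivation ℝ (MvPolynomial σ ℝ) _).toLinearMap ∘ₗ
    (pderiv i : Derivation ℝ (MvPolynomial σ ℝ) _).toLinearMap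

/-- The squared Euclidean norm as a polynomial. -/
def normSq (σ : Type*) [Fintype σ] : MvPolynomial σ ℝ := ∑ i, X i ^ 2

lemma laplacian_apply (p : MvPolynomial σ ℝ) :
    laplacian p = ∑ i, pderiv i (pderiv i p) := by
  simp [laplacian]

lemma apolar_laplacian (p q : MvPolynomial σ ℝ) :
    apolar (laplacian p) q = apolar p (normSq σ * q) := by
  rw [laplacian_apply]
  simp only [normSq, LinearMap.sum_apply, map_sum, Finset.sum_mul]
  refine Finset.sum_congr rfl fun i _ => ?_
  rw [apolar_pderiv, apolar_pderiv]
  congr 1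
  ring

lemma IsHomogeneous.laplacian {p : MvPolynomial σ ℝ} {d : ℕ} (hp : p.IsHomogeneous (d + 2)) :
    (laplacian p).IsHomogeneous d := by
  rw [laplacian_apply]
  exact IsHomogeneous.sum _ _ _ fun i _ => hp.pderiv.pderiv

lemma isHomogeneous_normSq : (normSq σ).IsHomogeneous 2 :=
  IsHomogeneous.sum _ _ _ fun i _ => by simpa using (isHomogeneous_X ℝ i).pow 2

/-- The tensor of a polynomial. -/
def tensor {N : ℕ} (p : MvPolynomial σ ℝ) (w : Fin N → σ) : ℝ := apolar p (∏ l, X (w l))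

lemma exists_prod_X_eq_monomial {N : ℕ} {s : σ →₀ ℕ} (hs : s.degree = N) :
    ∃ w : Fin N → σ, ∏ l, (X (w l) : MvPolynomial σ ℝ) = monomial s 1 := by
  subst hs
  have hlen : (Finsupp.toMultiset s).toList.length = s.degree := by
    rw [Multiset.length_toList, Finsupp.card_toMultiset]
    rfl
  refine ⟨fun l => (Finsupp.toMultiset s).toList.get (l.cast hlen.symm), ?_⟩
  have h1 : ∏ l : Fin s.degree,
      (X ((Finsupp.toMultiset s).toList.get (l.cast hlen.symm)) : MvPolynomial σ ℝ) =
      ∏ l : Fin (Finsupp.toMultiset s).toList.length,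
        (X ((Finsupp.toMultiset s).toList.get l) : MvPolynomial σ ℝ) :=
    Equiv.prod_comp (finCongr hlen.symm) fun l =>
      (X ((Finsupp.toMultiset s).toList.get l) : MvPolynomial σ ℝ)
  rw [h1, ← List.prod_ofFn, List.ofFn_comp', List.ofFn_get, ← Multiset.prod_coe,
    ← Multiset.map_coe, Multiset.coe_toList]
  clear h1 hlen
  induction s using Finsupp.induction_linear with
  | zero => simp
  | add f g hf hg =>
    rw [map_add, Multiset.map_add, Multiset.prod_add, hf, hg, monomial_mul, one_mul]
  | single a n => 
    rw [Finsupp.toMultiset_single, Multiset.map_nsmul, Multiset.prod_nsmul, Multiset.map_singleton,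
      Multiset.prod_singleton, X_pow_eq_monomial]

lemma eq_zero_of_tensor {N : ℕ} {p : MvPolynomial σ ℝ} (hp : p.IsHomogeneous N)
    (h : ∀ w : Fin N → σ, tensor p w = 0) : p = 0 := by
  ext s
  rw [coeff_zero]
  by_contra hs
  obtain ⟨w, hw⟩ := exists_prod_X_eq_monomial (σ := σ) (N := N) (by
    rw [Finsupp.degree_eq_weight_one]; exact hp hs)
  have h1 := h w
  rw [tensor, hw, apolar_monomial] at h1
  exact hs ((mul_eq_zero.mp h1).resolve_left (factorialWeight_ne_zero s))

lemma tensor_comp_equiv {N : ℕ} (p : MvPolynomial σ ℝ) (w : Fin N → σ) (e : Fin N ≃ Fin N) :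
    tensor p (w ∘ e) = tensor p w := by
  unfold tensor
  congr 1
  exact Equiv.prod_comp e fun l => X (w l)

end Apolar

/-! ### Linear substitutions. -/

section Substitute

variable {m : ℕ}

lemma substitute_X (A : Matrix (Idx m) (Idx m) ℝ) (i : Idx m) :
    substitute A (X i) = ∑ j, C (A i j) * X j := by
  simp [substitute]

lemma coeff_zero_substitute (A : Matrix (Idx m) (Idx m) ℝ) (p : MvPolynomial (Idx m) ℝ) :
    coeff 0 (substitute A p) = coeff 0 p := by
  have h : ((aeval (0 : Idx m → ℝ) : MvPolynomial (Idx m) ℝ →ₐ[ℝ] ℝ)).comp (substitute A) =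
      aeval (0 : Idx m → ℝ) := by
    ext i
    simp [substitute_X]
  have := DFunLike.congr_fun h p
  simpa [aeval_zero, constantCoeff_eq] using this

lemma pderiv_substitute (A : Matrix (Idx m) (Idx m) ℝ) (i : Idx m)
    (p : MvPolynomial (Idx m) ℝ) :
    pderiv i (substitute A p) = ∑ j, C (A j i) * substitute A (pderiv j p) := by
  induction p using MvPolynomial.induction_on with
  | C a => simp [substitute]
  | add p q hp hq => simp [hp, hq, mul_add, Finset.sum_add_distrib]
  | mul_X p k hp =>
    have h1 : pderiv i (substitute A (X k)) = C (A k i) := by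
      rw [substitute_X, map_sum, Finset.sum_eq_single i]
      · rw [pderiv_C_mul, pderiv_X_self, mul_one]
      · intro j _ hj
        rw [pderiv_C_mul, pderiv_X_of_ne hj, mul_zero]
      · simp
    have h2 : ∀ j, substitute A (pderiv j (p * X k)) =
        substitute A (pderiv j p) * substitute A (X k) +
          if j = k then substitute A p else 0 := by
      intro j
      rw [pderiv_mul, map_add, map_mul, map_mul]
      congr 1
      split_ifs with h
      · rw [h, pderiv_X_self, map_one, mul_one]
      · rw [pderiv_X_of_ne (Ne.symm h), map_zero, mul_zero]
    rw [map_mul, pderiv_mul, hp, h1]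
    simp_rw [h2, mul_add]
    rw [Finset.sum_add_distrib, Finset.sum_mul]
    congr 1
    · exact Finset.sum_congr rfl fun j _ => by ring
    · simp [mul_comm]

/-- Induction on `q`: a factor `X k` moves across the product as a derivative, and the chain rule
supplies the entries of `A`. -/
lemma apolar_substitute (A : Matrix (Idx m) (Idx m) ℝ) (p q : MvPolynomial (Idx m) ℝ) :
    apolar (substitute A p) q = apolar p (substitute A.transpose q) := by
  induction q using MvPolynomial.induction_on generalizing p with
  | C a =>
    have h : (C a : MvPolynomial (Idx m) ℝ) = a • monomial 0 1 := by
      rw [smul_monomial, smul_eq_mul, mul_one]; rfl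
    have h' : substitute A.transpose (C a) = C a := by simp [substitute]
    rw [h', h, map_smul, map_smul, apolar_monomial, apolar_monomial, coeff_zero_substitute]
  | add q r hq hr => rw [map_add, hq, hr, map_add, map_add]
  | mul_X q k hq =>
    rw [mul_comm q, ← apolar_pderiv, pderiv_substitute, map_mul, substitute_X, map_sum,
      LinearMap.sum_apply, Finset.sum_mul, map_sum]
    refine Finset.sum_congr rfl fun j _ => ?_
    rw [C_mul', C_mul', map_smul, LinearMap.smul_apply, hq, apolar_pderiv, smul_mul_assoc,
      map_smul, Matrix.transpose_apply]

lemma tensor_substitute {N : ℕ} (A : Matrix (Idx m) (Idx m) ℝ) (p : MvPolynomial (Idx m) ℝ)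
    (w : Fin N → Idx m) :
    tensor (substitute A p) w = ∑ v : Fin N → Idx m, (∏ l, A (v l) (w l)) * tensor p v := by
  unfold tensor
  rw [apolar_substitute, map_prod]
  simp_rw [substitute_X, Matrix.transpose_apply]
  rw [Finset.prod_univ_sum, Fintype.piFinset_univ, map_sum]
  refine Finset.sum_congr rfl fun v _ => ?_
  rw [Finset.prod_mul_distrib, ← map_prod, C_mul', map_smul, smul_eq_mul]

lemma substitute_normSq {A : Matrix (Idx m) (Idx m) ℝ} (hA : A.transpose * A = 1) :
    substitute A (normSq (Idx m)) = normSq (Idx m) := by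
  simp only [normSq, map_sum, map_pow, substitute_X]
  have h1 : ∀ i, (∑ j, C (A i j) * X j : MvPolynomial (Idx m) ℝ) ^ 2 =
      ∑ j, ∑ k, C (A i j * A i k) * (X j * X k) := by
    intro i
    rw [sq, Finset.sum_mul_sum]
    refine Finset.sum_congr rfl fun j _ => Finset.sum_congr rfl fun k _ => ?_
    rw [map_mul]; ring
  simp_rw [h1]
  rw [Finset.sum_comm]
  refine Finset.sum_congr rfl fun j _ => ?_
  rw [Finset.sum_comm]
  have h2 : ∀ k, ∑ i, C (A i j * A i k) * (X j * X k : MvPolynomial (Idx m) ℝ) =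
      C ((1 : Matrix (Idx m) (Idx m) ℝ) j k) * (X j * X k) := by
    intro k
    rw [← Finset.sum_mul, ← map_sum, ← hA, Matrix.mul_apply]
    rfl
  simp_rw [h2]
  rw [Finset.sum_eq_single j]
  · simp [sq]
  · intro k _ hk
    simp [Matrix.one_apply_ne' hk]
  · simp

/-- By adjointness this reduces to the invariance of `normSq` under the orthogonal matrix `Aᵀ`. -/
lemma laplacian_substitute {A : Matrix (Idx m) (Idx m) ℝ} (hA : A * A.transpose = 1)
    (p : MvPolynomial (Idx m) ℝ) :
    laplacian (substitute A p) = substitute A (laplacian p) := by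
  rw [← sub_eq_zero]
  refine eq_zero_of_apolar fun q => ?_
  rw [map_sub, LinearMap.sub_apply, apolar_laplacian, apolar_substitute, apolar_substitute,
    apolar_laplacian, map_mul, substitute_normSq, sub_self]
  rw [Matrix.transpose_transpose, hA]

end Substitute

/-! ### Generators and the tensor as a function of binary words. -/

/-- The Kronecker product of `2 × 2` matrices. -/
def kronecker {m : ℕ} (g : Fin m → Matrix (Fin 2) (Fin 2) ℝ) : Matrix (Idx m) (Idx m) ℝ :=
  fun u w => ∏ a, g a (u a) (w a)

/-- The matrix acting as `g` on one tensor factor. -/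
def localMatrix {m : ℕ} (i : Fin m) (g : Matrix (Fin 2) (Fin 2) ℝ) : Matrix (Idx m) (Idx m) ℝ :=
  kronecker (Function.update (fun _ => 1) i g)

/-- The real character of the product of two bits. -/
def bitSgn (x y : Fin 2) : ℝ := sgn ((x : ZMod 2) * (y : ZMod 2))

/-- The `2 × 2` Hadamard matrix. -/
def hadamardTwo : Matrix (Fin 2) (Fin 2) ℝ := fun x y => (√2)⁻¹ * bitSgn x y

/-- The controlled sign change of two tensor factors (a sign change for `i = j`). -/
def controlledSign {m : ℕ} (i j : Fin m) : Matrix (Idx m) (Idx m) ℝ :=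
  Matrix.diagonal fun u => bitSgn (u i) (u j)

/-- The polynomial is fixed by the Hadamard matrices and the controlled sign changes. -/
structure IsGeneratorInvariant {m : ℕ} (p : MvPolynomial (Idx m) ℝ) : Prop where
  sign : ∀ i j, substitute (controlledSign i j) p = p
  hadamard : ∀ i, substitute (localMatrix i hadamardTwo) p = p

section RowTensor

variable {m N : ℕ}

/-- An element of `𝔽₂` as an index. -/
def toBit (x : ZMod 2) : Fin 2 := x

/-- A vector over `𝔽₂` as an index. -/
def toIdx (v : Fin m → ZMod 2) : Idx m := fun a => toBit (v a)

/-- Tuples of binary words as tuples of indices. -/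
def rowsEquiv (m N : ℕ) : (Fin m → Fin N → ZMod 2) ≃ (Fin N → Idx m) where
  toFun ρ l a := ρ a l
  invFun w a l := w l a
  left_inv _ := rfl
  right_inv _ := rfl

lemma rowsEquiv_apply (ρ : Fin m → Fin N → ZMod 2) (l : Fin N) :
    rowsEquiv m N ρ l = toIdx fun a => ρ a l := rfl

/-- The tensor of a polynomial as a function of tuples of binary words. -/
def rowTensor (N : ℕ) (p : MvPolynomial (Idx m) ℝ) (ρ : Fin m → Fin N → ZMod 2) : ℝ :=
  tensor p (rowsEquiv m N ρ)

lemma rowTensor_add (p q : MvPolynomial (Idx m) ℝ) (ρ : Fin m → Fin N → ZMod 2) :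
    rowTensor N (p + q) ρ = rowTensor N p ρ + rowTensor N q ρ := by
  simp [rowTensor, tensor]

lemma rowTensor_smul (c : ℝ) (p : MvPolynomial (Idx m) ℝ) (ρ : Fin m → Fin N → ZMod 2) :
    rowTensor N (c • p) ρ = c * rowTensor N p ρ := by
  simp [rowTensor, tensor]

lemma rowTensor_comp (p : MvPolynomial (Idx m) ℝ) (σ : Fin N ≃ Fin N)
    (ρ : Fin m → Fin N → ZMod 2) : rowTensor N p (fun a => ρ a ∘ σ) = rowTensor N p ρ :=
  tensor_comp_equiv p (rowsEquiv m N ρ) σ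

lemma eq_zero_of_rowTensor {p : MvPolynomial (Idx m) ℝ} (hp : p.IsHomogeneous N)
    (h : rowTensor N p = 0) : p = 0 := by
  refine eq_zero_of_tensor hp fun w => ?_
  obtain ⟨ρ, rfl⟩ := (rowsEquiv m N).surjective w
  exact congrFun h ρ

/-- On tensors the controlled sign change multiplies by `sgn (ρ i ⬝ᵥ ρ j)`, and the Hadamard matrix
in factor `i` is the normalised Fourier transform in row `i`. -/
lemma IsGeneratorInvariant.isCliffordInvariant {p : MvPolynomial (Idx m) ℝ}
    (hp : IsGeneratorInvariant p) : IsCliffordInvariant (rowTensor N p) where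
  support := by
    intro ρ i j h0
    have h1 := tensor_substitute (controlledSign i j) p (rowsEquiv m N ρ)
    rw [hp.sign, Finset.sum_eq_single (rowsEquiv m N ρ)] at h1
    · have h2 : ∏ l, controlledSign i j (rowsEquiv m N ρ l) (rowsEquiv m N ρ l) =
          sgn (ρ i ⬝ᵥ ρ j) := by
        rw [dotProduct, sgn_sum]
        refine Finset.prod_congr rfl fun l _ => ?_
        rw [controlledSign, Matrix.diagonal_apply_eq]
        rfl
      rw [h2] at h1
      refine (zmod_two_eq _).resolve_right fun h3 => h0 ?_
      rw [h3, sgn_one] at h1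
      rw [rowTensor]
      linarith
    · intro v _ hv
      obtain ⟨l, hl⟩ := Function.ne_iff.mp hv
      rw [Finset.prod_eq_zero (Finset.mem_univ l), zero_mul]
      exact Matrix.diagonal_apply_ne _ hl
    · simp
  fourier := by
    intro ρ i
    have h1 := tensor_substitute (localMatrix i hadamardTwo) p (rowsEquiv m N ρ)
    rw [hp.hadamard, ← Equiv.sum_comp (rowsEquiv m N),
      -- The other factors act by identity matrices, so only tuples that agree with `ρ` outside row
      -- `i` contribute.
      ← Fintype.sum_of_injective (fun s : Fin N → ZMod 2 => Function.update ρ i s)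
        (Function.update_injective ρ i)
        (fun s => ((√2)⁻¹ ^ N * sgn (s ⬝ᵥ ρ i)) * rowTensor N p (Function.update ρ i s))] at h1
    · have h2 : (√2 : ℝ) ^ N * (√2)⁻¹ ^ N = 1 := by
        rw [← mul_pow, mul_inv_cancel₀ (by positivity), one_pow]
      rw [Fintype.card_fin]
      change √2 ^ N * tensor p (rowsEquiv m N ρ) = _
      rw [h1, Finset.mul_sum]
      refine Finset.sum_congr rfl fun s _ => ?_
      rw [← mul_assoc, ← mul_assoc, h2, one_mul]
    · intro ρ' hρ'
      have h3 : ∃ a, a ≠ i ∧ ρ' a ≠ ρ a := by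
        by_contra! h
        refine hρ' ⟨ρ' i, ?_⟩
        funext a
        by_cases ha : a = i
        · subst ha; simp
        · simp [ha, h a ha]
      obtain ⟨a, ha, h4⟩ := h3
      obtain ⟨l, hl⟩ := Function.ne_iff.mp h4
      rw [Finset.prod_eq_zero (Finset.mem_univ l), zero_mul]
      rw [localMatrix, kronecker]
      refine Finset.prod_eq_zero (Finset.mem_univ a) ?_
      rw [Function.update_of_ne ha]
      exact Matrix.one_apply_ne hl
    · intro s
      have h3 : ∏ l, localMatrix i hadamardTwo (rowsEquiv m N (Function.update ρ i s) l)
          (rowsEquiv m N ρ l) = (√2)⁻¹ ^ N * sgn (s ⬝ᵥ ρ i) := by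
        have h4 : ∀ l, localMatrix i hadamardTwo (rowsEquiv m N (Function.update ρ i s) l)
            (rowsEquiv m N ρ l) = (√2)⁻¹ * sgn (s l * ρ i l) := by
          intro l
          rw [localMatrix, kronecker, Finset.prod_eq_single i]
          · simp only [rowsEquiv_apply, Function.update_self, toIdx]
            rfl
          · intro a _ ha
            simp [rowsEquiv_apply, toIdx, ha]
          · simp
        simp_rw [h4]
        rw [Finset.prod_mul_distrib, dotProduct, sgn_sum, Finset.prod_const, Finset.card_univ,
          Fintype.card_fin]
      rw [h3]
      rfl

/-- The equal letters at positions `i` and `j` run together through all indices, so the sum pairs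
`p` with a multiple of `normSq`; adjointness turns this into the Laplacian of `p`. -/
lemma isHarmonic_rowTensor {p : MvPolynomial (Idx m) ℝ} (hp : laplacian p = 0) :
    IsHarmonic (rowTensor N p) := by
  intro ρ i j hij hρ
  unfold rowTensor tensor
  rw [← map_sum]
  set w := rowsEquiv m N ρ with hw
  have h1 : ∀ v : Fin m → ZMod 2, ∏ l, (X (rowsEquiv m N
      (fun a => ρ a + v a • (Pi.single i 1 + Pi.single j 1)) l) : MvPolynomial (Idx m) ℝ) =
      X (toIdx fun a => ρ a i + v a) ^ 2 * ∏ l ∈ (Finset.univ.erase i).erase j, X (w l) := by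
    intro v
    have hj : j ∈ Finset.univ.erase i := Finset.mem_erase.mpr ⟨hij.symm, Finset.mem_univ _⟩
    set w' := rowsEquiv m N (fun a => ρ a + v a • (Pi.single i 1 + Pi.single j 1)) with hw'
    have hi1 : w' i = toIdx fun a => ρ a i + v a := by
      rw [hw', rowsEquiv_apply]
      congr 1
      funext a
      simp [hij]
    have hj1 : w' j = toIdx fun a => ρ a i + v a := by
      rw [hw', rowsEquiv_apply]
      congr 1
      funext a
      simp [hij.symm, hρ]
    rw [← Finset.mul_prod_erase Finset.univ (fun l => X (w' l)) (Finset.mem_univ i),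
      ← Finset.mul_prod_erase (Finset.univ.erase i) (fun l => X (w' l)) hj, ← mul_assoc, hi1,
      hj1, ← sq]
    congr 1
    refine Finset.prod_congr rfl fun l hl => ?_
    have hlj := Finset.ne_of_mem_erase hl
    have hli := Finset.ne_of_mem_erase (Finset.mem_of_mem_erase hl)
    have : w' l = w l := by
      rw [hw', hw, rowsEquiv_apply, rowsEquiv_apply]
      congr 1
      funext a
      simp [hlj, hli]
    rw [this]
  simp_rw [h1]
  rw [← Finset.sum_mul]
  have h2 : ∑ v : Fin m → ZMod 2, (X (toIdx fun a => ρ a i + v a) : MvPolynomial (Idx m) ℝ) ^ 2 =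
      normSq (Idx m) :=
    Equiv.sum_comp (Equiv.addLeft (fun a => ρ a i))
      (fun u : Fin m → ZMod 2 => (X (toIdx u) : MvPolynomial (Idx m) ℝ) ^ 2)
  rw [h2, ← apolar_laplacian, hp]
  simp

end RowTensor

/-! ### Vanishing of harmonic invariants. -/

section Vanishing

variable {m : ℕ} {p : MvPolynomial (Idx m) ℝ}

lemma IsGeneratorInvariant.eq_zero_of_codeSum {N : ℕ} (hg : IsGeneratorInvariant p)
    (hm : 1 ≤ m) (hp : p.IsHomogeneous N) (hN : Even N)
    (h : ∀ C : Submodule (ZMod 2) (Fin N → ZMod 2), dualCode C = C →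
      codeSum (rowTensor N p) C = 0) : p = 0 := by
  have : Nonempty (Fin m) := ⟨⟨0, hm⟩⟩
  exact eq_zero_of_rowTensor hp
    (hg.isCliffordInvariant.eq_zero_of_codeSum (by simpa using hN) h)

/-- A row and its complement would both lie in the support and have even weight, which is impossible
in odd length. -/
lemma IsGeneratorInvariant.eq_zero_of_odd {N : ℕ} (hg : IsGeneratorInvariant p)
    (hm : 1 ≤ m) (hp : p.IsHomogeneous N) (hN : Odd N) : p = 0 := by
  refine eq_zero_of_rowTensor hp (funext fun ρ => ?_)
  by_contra h0
  have hc := hg.isCliffordInvariant (N := N)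
  have h1 := hc.support ρ ⟨0, hm⟩ ⟨0, hm⟩ h0
  have h2 := hc.update_add_one ρ ⟨0, hm⟩
  have h3 := hc.support _ ⟨0, hm⟩ ⟨0, hm⟩ (h2 ▸ h0)
  rw [Function.update_self, self_dotProduct, add_dotProduct, ← self_dotProduct (ρ _), h1,
    zero_add] at h3
  simp only [dotProduct, Pi.one_apply, mul_one, Finset.sum_const, Finset.card_univ,
    Fintype.card_fin, nsmul_eq_mul, ZMod.natCast_eq_zero_iff_even] at h3
  exact (Nat.not_even_iff_odd.mpr hN) h3

lemma IsGeneratorInvariant.eq_zero_of_laplacian {N : ℕ} (hg : IsGeneratorInvariant p)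
    (hm : 1 ≤ m) (hp : p.IsHomogeneous N) (hN : N = 2 ∨ N = 4 ∨ N = 6 ∨ N = 10)
    (hl : laplacian p = 0) : p = 0 := by
  refine hg.eq_zero_of_codeSum hm hp (by rcases hN with rfl | rfl | rfl | rfl <;> decide)
    fun C hC => codeSum_eq_zero_of_isHarmonic (isHarmonic_rowTensor hl) hC ?_
  rcases hN with rfl | rfl | rfl | rfl
  · exact not_noWeightTwo_of_card_le_six hC (by simp) (by simp) (by simp) (by simp)
  · exact not_noWeightTwo_of_card_le_six hC (by simp) (by simp; decide) (by simp) (by simp)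
  · exact not_noWeightTwo_of_card_le_six hC (by simp) (by simp; decide) (by simp) (by simp)
  · exact not_noWeightTwo_of_card_eq_ten hC (by simp)

lemma isDPlus_fin {N : ℕ} (hN : N = 8 ∨ N = 12) {C : Submodule (ZMod 2) (Fin N → ZMod 2)}
    (hC : dualCode C = C) (h2 : NoWeightTwo C) : IsDPlus (N / 2) C := by
  rcases hN with rfl | rfl
  · exact isDPlus_of_card_eq_eight hC h2 (by simp)
  · exact isDPlus_of_card_eq_twelve hC h2 (by simp)

/-- The sum of the tensor of a polynomial over a code, as a linear functional. -/
def codeFunctional {N : ℕ} (C : Submodule (ZMod 2) (Fin N → ZMod 2)) :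
    MvPolynomial (Idx m) ℝ →ₗ[ℝ] ℝ where
  toFun p := codeSum (rowTensor N p) C
  map_add' p q := by
    unfold codeSum
    rw [← Finset.sum_add_distrib]
    refine Finset.sum_congr rfl fun ρ _ => ?_
    split_ifs <;> simp [rowTensor_add]
  map_smul' c p := by
    unfold codeSum
    rw [smul_eq_mul, Finset.mul_sum]
    refine Finset.sum_congr rfl fun ρ _ => ?_
    split_ifs <;> simp [rowTensor_smul]

/-- All codes that matter are of type `d⁺`, hence equivalent, and the tensor is symmetric: the sum
over a single one controls all the sums. -/
lemma exists_functional (hm : 1 ≤ m) {N : ℕ} (hN : N = 8 ∨ N = 12) :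
    ∃ f : MvPolynomial (Idx m) ℝ →ₗ[ℝ] ℝ, ∀ p : MvPolynomial (Idx m) ℝ,
      IsGeneratorInvariant p → p.IsHomogeneous N → laplacian p = 0 → f p = 0 → p = 0 := by
  have he : Even N := by rcases hN with rfl | rfl <;> decide
  by_cases h : ∃ C : Submodule (ZMod 2) (Fin N → ZMod 2), dualCode C = C ∧ NoWeightTwo C
  · obtain ⟨C, hC, h2⟩ := h
    refine ⟨codeFunctional C, fun p hg hp hl hf => hg.eq_zero_of_codeSum hm hp he fun C' hC' => ?_⟩
    by_cases h2' : NoWeightTwo C'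
    · obtain ⟨σ, hσ⟩ := (isDPlus_fin hN hC h2).exists_equiv (isDPlus_fin hN hC' h2')
      rw [codeSum_eq_of_equiv (rowTensor_comp p) σ hσ]
      exact hf
    · exact codeSum_eq_zero_of_isHarmonic (isHarmonic_rowTensor hl) hC' h2'
  -- If no such code existed, every code sum would vanish and the zero functional would do; the
  -- existence of the code is never needed.
  · push Not at h
    exact ⟨0, fun p hg hp hl _ => hg.eq_zero_of_codeSum hm hp he fun C hC =>
      codeSum_eq_zero_of_isHarmonic (isHarmonic_rowTensor hl) hC (h C hC)⟩

end Vanishing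

/-! ### The case `m = 1` in degree 12. -/

section RankOne

lemma wt_single_add_single {ι : Type*} [Fintype ι] [DecidableEq ι] {i j : ι} (hij : i ≠ j) :
    wt (Pi.single i 1 + Pi.single j 1 : ι → ZMod 2) = 2 := by
  have h1 : ∀ i : ι, wt (Pi.single i 1 : ι → ZMod 2) = 1 := by
    intro i
    rw [wt, Finset.sum_eq_single i]
    · rw [Pi.single_eq_same]; rfl
    · intro k _ hk
      simp [hk]
    · simp
  have h2 := wt_add (Pi.single i 1 : ι → ZMod 2) (Pi.single j 1)
  rw [h1, h1, Finset.sum_eq_zero] at h2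
  · omega
  · intro k _
    by_cases hk : k = i
    · subst hk; simp [hij]
    · simp [hk]

lemma sum_I_pow_wt (N : ℕ) :
    ∑ r : Fin N → ZMod 2, Complex.I ^ wt r = (1 + Complex.I) ^ N := by
  have h1 : ∀ r : Fin N → ZMod 2, Complex.I ^ wt r = ∏ l, Complex.I ^ (r l).val := by
    intro r
    rw [wt, Finset.prod_pow_eq_pow_sum]
  have h2 : ∑ x : ZMod 2, Complex.I ^ x.val = 1 + Complex.I := by
    have : (Finset.univ : Finset (ZMod 2)) = {0, 1} := rfl
    rw [this, Finset.sum_insert (by decide), Finset.sum_singleton, ZMod.val_zero, pow_zero,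
      show (1 : ZMod 2).val = 1 from rfl, pow_one]
  simp_rw [h1]
  rw [← h2, ← Fin.prod_const, Finset.prod_univ_sum, Fintype.piFinset_univ]

lemma IsGeneratorInvariant.eq_zero_of_laplacian_rank_one {p : MvPolynomial (Idx 1) ℝ}
    (hg : IsGeneratorInvariant p) (hp : p.IsHomogeneous 12) (hl : laplacian p = 0) : p = 0 := by
  have hc := hg.isCliffordInvariant (N := 12)
  have hh := isHarmonic_rowTensor (N := 12) hl
  set φ : (Fin 12 → ZMod 2) → ℝ := fun r => rowTensor 12 p fun _ => r with hφ
  -- Odd weights are excluded by the support condition, and harmonicity flips the sign whenever two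
  -- ones are removed.
  have hval : ∀ n r, wt r = n → φ r = φ 0 * (Complex.I ^ n).re := by
    intro n
    induction n using Nat.twoStepInduction with
    | zero =>
      intro r hr
      rw [eq_zero_of_wt hr]
      simp
    | one =>
      intro r hr
      rw [pow_one, Complex.I_re, mul_zero]
      by_contra h0
      have h1 := hc.support (fun _ => r) 0 0 h0
      rw [self_dotProduct, ← wt_cast, hr] at h1
      exact absurd h1 (by decide)
    | more n ih _ =>
      intro r hr
      obtain ⟨i, j, hi, hj, hij⟩ : ∃ i j, r i = 1 ∧ r j = 1 ∧ i ≠ j := by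
        have : 1 < (Finset.univ.filter fun i => r i = 1).card := by
          rw [← wt_eq_card]; omega
        obtain ⟨i, hi, j, hj, hij⟩ := Finset.one_lt_card.mp this
        exact ⟨i, j, by simpa using hi, by simpa using hj, hij⟩
      set e : Fin 12 → ZMod 2 := Pi.single i 1 + Pi.single j 1 with he
      have h1 : wt (r + e) = n := by
        have h2 := wt_add (r + e) e
        have h3 : r + e + e = r := by
          funext l
          simp only [Pi.add_apply]
          rw [add_assoc, zmod_two_add_self, add_zero]
        rw [h3, wt_single_add_single hij, Finset.sum_eq_zero] at h2
        · omega
        · intro l _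
          by_cases hl : l = i
          · subst hl; simp [he, hi, hij, zmod_two_add_self]
          · by_cases hl' : l = j
            · subst hl'; simp [he, hj, hij.symm, zmod_two_add_self]
            · simp [he, hl, hl']
      have h2 := hh (fun _ => r) i j hij fun _ => by rw [hi, hj]
      have h3 : ∑ v : Fin 1 → ZMod 2, rowTensor 12 p (fun a => r + v a • e) =
          φ r + φ (r + e) := by
        rw [← Equiv.sum_comp (Equiv.funUnique (Fin 1) (ZMod 2)).symm]
        have : (Finset.univ : Finset (ZMod 2)) = {0, 1} := rfl
        rw [this, Finset.sum_insert (by decide), Finset.sum_singleton]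
        simp [hφ]
      rw [h3, ih _ h1] at h2
      rw [pow_add, Complex.I_sq]
      simp
      linarith
  have h0 : φ 0 = 0 := by
    have h1 := hc.fourier 0 0
    have h2 : ∀ s : Fin 12 → ZMod 2,
        Function.update (0 : Fin 1 → Fin 12 → ZMod 2) 0 s = fun _ => s := by
      intro s
      funext a
      rw [Subsingleton.elim a 0, Function.update_self]
    simp_rw [h2] at h1
    have h3 : ∀ s : Fin 12 → ZMod 2,
        sgn (s ⬝ᵥ (0 : Fin 1 → Fin 12 → ZMod 2) 0) * rowTensor 12 p (fun _ => s) =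
          φ 0 * (Complex.I ^ wt s).re := by
      intro s
      rw [Pi.zero_apply, dotProduct_zero, sgn_zero, one_mul]
      exact hval _ s rfl
    simp_rw [h3] at h1
    rw [← Finset.mul_sum, ← Complex.re_sum, sum_I_pow_wt] at h1
    -- The Fourier condition at the zero row compares `√2 ^ 12 = 64` with the real part of `(1 + i)
    -- ^ 12 = -64`, which forces `φ 0 = 0`.
    have h4 : (1 + Complex.I) ^ 12 = -64 := by
      have : (1 + Complex.I) ^ 2 = 2 * Complex.I := by
        rw [add_sq, Complex.I_sq]; ring
      rw [show 12 = 2 * 6 from rfl, pow_mul, this, mul_pow, show 6 = 2 * 3 from rfl,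
        pow_mul Complex.I, Complex.I_sq]
      norm_num
    have h5 : (√2 : ℝ) ^ 12 = 64 := by
      rw [show 12 = 2 * 6 from rfl, pow_mul, Real.sq_sqrt (by norm_num)]
      norm_num
    rw [h4, Fintype.card_fin, h5] at h1
    have h6 : rowTensor 12 p 0 = φ 0 := rfl
    rw [h6] at h1
    norm_num at h1
    linarith
  refine eq_zero_of_rowTensor hp (funext fun ρ => ?_)
  have h1 : ρ = fun _ => ρ 0 := by
    funext a
    rw [Subsingleton.elim a 0]
  have h2 := hval _ (ρ 0) rfl
  rw [h0, zero_mul] at h2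
  rw [h1]
  exact h2

end RankOne

/-! ### Upper bounds for the dimensions. -/

section UpperBound

variable {m : ℕ} {G : Subgroup (Matrix.orthogonalGroup (Idx m) ℝ)}

/-- The group contains the Hadamard matrices and the controlled sign changes. -/
structure ContainsGenerators (G : Subgroup (Matrix.orthogonalGroup (Idx m) ℝ)) : Prop where
  sign : ∀ i j, ∃ A ∈ G, A.1 = controlledSign i j
  hadamard : ∀ i, ∃ A ∈ G, A.1 = localMatrix i hadamardTwo

lemma ContainsGenerators.isGeneratorInvariant (hG : ContainsGenerators G) {d : ℕ}
    {p : MvPolynomial (Idx m) ℝ} (hp : p ∈ homogeneousInvariants G d) :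
    IsGeneratorInvariant p where
  sign i j := by
    obtain ⟨A, hA, h⟩ := hG.sign i j
    rw [← h]
    exact hp.2 A hA
  hadamard i := by
    obtain ⟨A, hA, h⟩ := hG.hadamard i
    rw [← h]
    exact hp.2 A hA

instance finiteDimensional_homogeneousInvariants (d : ℕ) :
    FiniteDimensional ℝ (homogeneousInvariants G d) := by
  have h1 : FiniteDimensional ℝ (homogeneousSubmodule (Idx m) ℝ d) :=
    Module.Finite.iff_fg.mpr (homogeneousSubmodule_fg (σ := Idx m) (R := ℝ) d)
  exact Submodule.finiteDimensional_of_le (S₂ := homogeneousSubmodule (Idx m) ℝ d)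
    fun p hp => hp.1

/-- The Laplacian on the homogeneous invariants. -/
def invariantLaplacian (G : Subgroup (Matrix.orthogonalGroup (Idx m) ℝ)) (d : ℕ) :
    homogeneousInvariants G (d + 2) →ₗ[ℝ] homogeneousInvariants G d :=
  (laplacian.domRestrict _).codRestrict _ fun p => by
    refine ⟨IsHomogeneous.laplacian p.2.1, fun A hA => ?_⟩
    rw [LinearMap.domRestrict_apply, ← laplacian_substitute, p.2.2 A hA]
    exact (Matrix.mem_orthogonalGroup_iff (Idx m) ℝ).mp A.2

lemma finrank_le_of_laplacian {d : ℕ}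
    (h : ∀ p ∈ homogeneousInvariants G (d + 2), laplacian p = 0 → p = 0) :
    Module.finrank ℝ (homogeneousInvariants G (d + 2)) ≤
      Module.finrank ℝ (homogeneousInvariants G d) := by
  refine LinearMap.finrank_le_finrank_of_injective (f := invariantLaplacian G d) ?_
  rw [← LinearMap.ker_eq_bot, LinearMap.ker_eq_bot']
  intro p hp
  exact Subtype.ext (h p p.2 (congrArg Subtype.val hp))

lemma finrank_le_add_one_of_laplacian {d : ℕ} (f : MvPolynomial (Idx m) ℝ →ₗ[ℝ] ℝ)
    (h : ∀ p ∈ homogeneousInvariants G (d + 2), laplacian p = 0 → f p = 0 → p = 0) :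
    Module.finrank ℝ (homogeneousInvariants G (d + 2)) ≤
      Module.finrank ℝ (homogeneousInvariants G d) + 1 := by
  have h1 : Module.finrank ℝ (homogeneousInvariants G d × ℝ) =
      Module.finrank ℝ (homogeneousInvariants G d) + 1 := by
    rw [Module.finrank_prod, Module.finrank_self]
  rw [← h1]
  refine LinearMap.finrank_le_finrank_of_injective
    (f := (invariantLaplacian G d).prod (f.domRestrict _)) ?_
  rw [← LinearMap.ker_eq_bot, LinearMap.ker_eq_bot']
  intro p hp
  rw [LinearMap.prod_apply, Prod.mk_eq_zero] at hp
  exact Subtype.ext (h p p.2 (congrArg Subtype.val hp.1) hp.2)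

lemma finrank_zero_le : Module.finrank ℝ (homogeneousInvariants G 0) ≤ 1 := by
  rw [← Module.finrank_self ℝ]
  refine LinearMap.finrank_le_finrank_of_injective
    (f := (lcoeff ℝ 0 : MvPolynomial (Idx m) ℝ →ₗ[ℝ] ℝ).domRestrict _) ?_
  rw [← LinearMap.ker_eq_bot, LinearMap.ker_eq_bot']
  intro p hp
  refine Subtype.ext ?_
  have h1 : (p : MvPolynomial (Idx m) ℝ) = C (coeff 0 p.1) :=
    totalDegree_eq_zero_iff_eq_C.mp (Nat.le_zero.mp p.2.1.totalDegree_le)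
  have h2 : coeff 0 p.1 = 0 := hp
  rw [h1, h2, C_0]
  rfl

lemma ContainsGenerators.finrank_odd (hG : ContainsGenerators G) (hm : 1 ≤ m) {d : ℕ}
    (hd : Odd d) : Module.finrank ℝ (homogeneousInvariants G d) = 0 := by
  have : homogeneousInvariants G d = ⊥ := by
    rw [Submodule.eq_bot_iff]
    exact fun p hp => (hG.isGeneratorInvariant hp).eq_zero_of_odd hm hp.1 hd
  rw [this]
  simp

lemma ContainsGenerators.finrank_le (hG : ContainsGenerators G) (hm : 1 ≤ m) {d : ℕ}
    (hd : d = 0 ∨ d = 2 ∨ d = 4 ∨ d = 8) :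
    Module.finrank ℝ (homogeneousInvariants G (d + 2)) ≤
      Module.finrank ℝ (homogeneousInvariants G d) :=
  finrank_le_of_laplacian fun p hp hl =>
    (hG.isGeneratorInvariant hp).eq_zero_of_laplacian hm hp.1 (by omega) hl

lemma ContainsGenerators.finrank_le_add_one (hG : ContainsGenerators G) (hm : 1 ≤ m) {d : ℕ}
    (hd : d = 6 ∨ d = 10) :
    Module.finrank ℝ (homogeneousInvariants G (d + 2)) ≤
      Module.finrank ℝ (homogeneousInvariants G d) + 1 := by
  obtain ⟨f, hf⟩ := exists_functional hm (N := d + 2) (by omega)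
  exact finrank_le_add_one_of_laplacian f fun p hp hl hfp =>
    hf p (hG.isGeneratorInvariant hp) hp.1 hl hfp

lemma ContainsGenerators.finrank_le_rank_one
    {G : Subgroup (Matrix.orthogonalGroup (Idx 1) ℝ)} (hG : ContainsGenerators G) :
    Module.finrank ℝ (homogeneousInvariants G (10 + 2)) ≤
      Module.finrank ℝ (homogeneousInvariants G 10) :=
  finrank_le_of_laplacian fun _ hp hl =>
    (hG.isGeneratorInvariant hp).eq_zero_of_laplacian_rank_one hp.1 hl

end UpperBound

/-! ### Kronecker products. -/

section Kronecker

variable {m : ℕ}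

lemma kronecker_mul (g h : Fin m → Matrix (Fin 2) (Fin 2) ℝ) :
    kronecker g * kronecker h = kronecker fun a => g a * h a := by
  ext u w
  simp only [kronecker, Matrix.mul_apply]
  rw [Finset.prod_univ_sum, Fintype.piFinset_univ]
  exact Finset.sum_congr rfl fun v _ => Finset.prod_mul_distrib.symm

lemma kronecker_one : kronecker (fun _ : Fin m => 1) = 1 := by
  ext u w
  by_cases h : u = w
  · subst h; simp [kronecker]
  · obtain ⟨a, ha⟩ := Function.ne_iff.mp h
    rw [Matrix.one_apply_ne h, kronecker]
    exact Finset.prod_eq_zero (Finset.mem_univ a) (Matrix.one_apply_ne ha)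

lemma kronecker_transpose (g : Fin m → Matrix (Fin 2) (Fin 2) ℝ) :
    (kronecker g)ᵀ = kronecker fun a => (g a)ᵀ := rfl

lemma kronecker_mulVec (g : Fin m → Matrix (Fin 2) (Fin 2) ℝ) (v : Fin m → Fin 2 → ℝ) :
    kronecker g *ᵥ pureTensor v = pureTensor fun a => g a *ᵥ v a := by
  funext u
  simp only [kronecker, pureTensor, Matrix.mulVec, dotProduct]
  rw [Finset.prod_univ_sum, Fintype.piFinset_univ]
  exact Finset.sum_congr rfl fun v _ => Finset.prod_mul_distrib.symm

lemma kronecker_mem_orthogonalGroup {g : Fin m → Matrix (Fin 2) (Fin 2) ℝ}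
    (hg : ∀ a, g a * (g a)ᵀ = 1) : kronecker g ∈ Matrix.orthogonalGroup (Idx m) ℝ := by
  rw [Matrix.mem_orthogonalGroup_iff, kronecker_transpose, kronecker_mul]
  simp_rw [hg]
  exact kronecker_one

end Kronecker

/-! ### The lattice in the plane. -/

section LatticeOne

/-- The element `√2` of `ℤ[√2]`. -/
def sqrtTwo : ZSqrtTwo := ⟨√2, Algebra.subset_adjoin rfl⟩

@[simp] lemma coe_sqrtTwo : (sqrtTwo : ℝ) = √2 := rfl

lemma sqrt_two_mul_self : (√2 : ℝ) * √2 = 2 := Real.mul_self_sqrt (by norm_num)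

lemma mem_latticeOne {v : Fin 2 → ℝ} :
    v ∈ latticeOne ↔ ∃ a b : ZSqrtTwo, v 0 = a * √2 + b ∧ v 1 = b := by
  rw [latticeOne, Submodule.mem_span_range_iff_exists_fun]
  constructor
  · rintro ⟨c, rfl⟩
    refine ⟨c 0, c 1, ?_, ?_⟩ <;> simp [genMatrix, Fin.sum_univ_two, Subalgebra.smul_def]
  · rintro ⟨a, b, h0, h1⟩
    refine ⟨![a, b], ?_⟩
    funext i
    fin_cases i
    · simp [genMatrix, Fin.sum_univ_two, Subalgebra.smul_def, h0]
    · simp [genMatrix, Fin.sum_univ_two, Subalgebra.smul_def, h1]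

lemma apply_mem_of_mem_latticeOne {v : Fin 2 → ℝ} (hv : v ∈ latticeOne) (x : Fin 2) :
    v x ∈ ZSqrtTwo := by
  obtain ⟨a, b, h0, h1⟩ := mem_latticeOne.mp hv
  fin_cases x
  · change v 0 ∈ ZSqrtTwo
    rw [h0]
    exact (a * sqrtTwo + b).2
  · change v 1 ∈ ZSqrtTwo
    rw [h1]
    exact b.2

lemma bitSgn_eq (x y : Fin 2) : bitSgn x y = if x = 1 ∧ y = 1 then -1 else 1 := by
  have h : (1 : ZMod 2) * 1 = 1 := rfl
  fin_cases x <;> fin_cases y <;> simp [bitSgn] <;> rfl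

/-- The Pauli matrix `X ^ s * Z ^ t`. -/
def pauliTwo (s t : Fin 2) : Matrix (Fin 2) (Fin 2) ℝ :=
  fun x y => if x = y + s then bitSgn t y else 0

lemma hadamardTwo_eq : hadamardTwo = !![(√2)⁻¹, (√2)⁻¹; (√2)⁻¹, -(√2)⁻¹] := by
  ext x y
  fin_cases x <;> fin_cases y <;> simp [hadamardTwo, bitSgn_eq]

lemma pauliTwo_zero_zero : pauliTwo 0 0 = !![1, 0; 0, 1] := by
  ext x y
  fin_cases x <;> fin_cases y <;> simp [pauliTwo, bitSgn_eq]

lemma pauliTwo_zero_one : pauliTwo 0 1 = !![1, 0; 0, -1] := by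
  ext x y
  fin_cases x <;> fin_cases y <;> simp [pauliTwo, bitSgn_eq]

lemma pauliTwo_one_zero : pauliTwo 1 0 = !![0, 1; 1, 0] := by
  ext x y
  fin_cases x <;> fin_cases y <;> simp [pauliTwo, bitSgn_eq]

lemma pauliTwo_one_one : pauliTwo 1 1 = !![0, -1; 1, 0] := by
  ext x y
  fin_cases x <;> fin_cases y <;> simp [pauliTwo, bitSgn_eq]

lemma forall_pauliTwo {P : Matrix (Fin 2) (Fin 2) ℝ → Prop} (h1 : P !![1, 0; 0, 1])
    (h2 : P !![1, 0; 0, -1]) (h3 : P !![0, 1; 1, 0]) (h4 : P !![0, -1; 1, 0]) (s t : Fin 2) :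
    P (pauliTwo s t) := by
  fin_cases s <;> fin_cases t
  · exact pauliTwo_zero_zero ▸ h1
  · exact pauliTwo_zero_one ▸ h2
  · exact pauliTwo_one_zero ▸ h3
  · exact pauliTwo_one_one ▸ h4

lemma hadamardTwo_mul_transpose : hadamardTwo * hadamardTwoᵀ = 1 := by
  have h : (√2 : ℝ)⁻¹ * (√2)⁻¹ = 1 / 2 := by
    rw [← mul_inv, sqrt_two_mul_self]; norm_num
  rw [hadamardTwo_eq]
  ext x y
  fin_cases x <;> fin_cases y <;> simp [Matrix.mul_apply, Fin.sum_univ_two, h] <;> norm_num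

lemma pauliTwo_mul_transpose (s t : Fin 2) : pauliTwo s t * (pauliTwo s t)ᵀ = 1 := by
  refine forall_pauliTwo (P := fun A => A * Aᵀ = 1) ?_ ?_ ?_ ?_ s t <;>
  · ext x y
    fin_cases x <;> fin_cases y <;> simp [Matrix.mul_apply, Fin.sum_univ_two]

lemma hadamardTwo_mulVec_mem {v : Fin 2 → ℝ} (hv : v ∈ latticeOne) :
    hadamardTwo *ᵥ v ∈ latticeOne := by
  obtain ⟨a, b, h0, h1⟩ := mem_latticeOne.mp hv
  have h2 : (√2 : ℝ)⁻¹ * √2 = 1 := inv_mul_cancel₀ (by positivity)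
  have h3 : (√2 : ℝ)⁻¹ * 2 = √2 := by
    rw [inv_mul_eq_iff_eq_mul₀ (by positivity), sqrt_two_mul_self]
  rw [mem_latticeOne]
  refine ⟨b, a, ?_, ?_⟩
  · simp only [hadamardTwo_eq, Matrix.mulVec, dotProduct, Fin.sum_univ_two, h0, h1]
    simp
    linear_combination (a : ℝ) * h2 + (b : ℝ) * h3
  · simp only [hadamardTwo_eq, Matrix.mulVec, dotProduct, Fin.sum_univ_two, h0, h1]
    simp
    linear_combination (a : ℝ) * h2

/-- The Pauli matrices act trivially on the lattice modulo `√2`. -/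
lemma pauliTwo_mulVec_sub (s t : Fin 2) {v : Fin 2 → ℝ} (hv : v ∈ latticeOne) :
    ∃ y ∈ latticeOne, pauliTwo s t *ᵥ v = v + sqrtTwo • y := by
  obtain ⟨a, b, h0, h1⟩ := mem_latticeOne.mp hv
  have hs := sqrt_two_mul_self
  refine forall_pauliTwo (P := fun A => ∃ y ∈ latticeOne, A *ᵥ v = v + sqrtTwo • y)
    ?_ ?_ ?_ ?_ s t
  · exact ⟨0, latticeOne.zero_mem, by simp [← Matrix.one_fin_two]⟩
  · refine ⟨![0, -(sqrtTwo * b : ZSqrtTwo)], mem_latticeOne.mpr ⟨b, -(sqrtTwo * b), ?_, ?_⟩, ?_⟩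
    · simp; ring
    · simp
    · funext i
      fin_cases i
      · simp [Matrix.mulVec, dotProduct, Fin.sum_univ_two]
      · simp [Matrix.mulVec, dotProduct, Fin.sum_univ_two, h1, Subalgebra.smul_def]
        linear_combination (b : ℝ) * hs
  · refine ⟨![(-a : ZSqrtTwo), a], mem_latticeOne.mpr ⟨-(sqrtTwo * a), a, ?_, ?_⟩, ?_⟩
    · simp
      linear_combination (a : ℝ) * hs
    · simp
    · funext i
      fin_cases i
      · simp [Matrix.mulVec, dotProduct, Fin.sum_univ_two, h0, h1, Subalgebra.smul_def]
        ring
      · simp [Matrix.mulVec, dotProduct, Fin.sum_univ_two, h0, h1, Subalgebra.smul_def]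
        ring
  · refine ⟨![(-a - sqrtTwo * b : ZSqrtTwo), a],
      mem_latticeOne.mpr ⟨-(sqrtTwo * a) - b, a, ?_, ?_⟩, ?_⟩
    · simp
      linear_combination (a : ℝ) * hs
    · simp
    · funext i
      fin_cases i
      · simp [Matrix.mulVec, dotProduct, Fin.sum_univ_two, h0, h1, Subalgebra.smul_def]
        linear_combination (b : ℝ) * hs
      · simp [Matrix.mulVec, dotProduct, Fin.sum_univ_two, h0, h1, Subalgebra.smul_def]
        ring

lemma pauliTwo_transpose (s t : Fin 2) : (pauliTwo s t)ᵀ = bitSgn s t • pauliTwo s t := by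
  ext x y
  fin_cases s <;> fin_cases t <;> fin_cases x <;> fin_cases y <;> simp [pauliTwo, bitSgn_eq]

end LatticeOne

/-! ### Automorphisms of the lattice: generators and Pauli matrices. -/

section Lattice

variable {m : ℕ}

lemma pureTensor_mem {v : Fin m → Fin 2 → ℝ} (hv : ∀ k, v k ∈ latticeOne) :
    pureTensor v ∈ lattice m := Submodule.subset_span ⟨v, hv, rfl⟩

lemma mulVec_mem_lattice {A : Matrix (Idx m) (Idx m) ℝ}
    (hA : ∀ v : Fin m → Fin 2 → ℝ, (∀ k, v k ∈ latticeOne) → A *ᵥ pureTensor v ∈ lattice m)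
    {x : Idx m → ℝ} (hx : x ∈ lattice m) : A *ᵥ x ∈ lattice m := by
  induction hx using Submodule.span_induction with
  | mem x hx =>
    obtain ⟨v, hv, rfl⟩ := hx
    exact hA v hv
  | zero => simp
  | add x y _ _ hx hy =>
    rw [Matrix.mulVec_add]
    exact Submodule.add_mem _ hx hy
  | smul c x _ hx =>
    rw [Matrix.mulVec_smul]
    exact Submodule.smul_mem _ c hx

lemma mem_cliffordGroup_iff {A : Matrix.orthogonalGroup (Idx m) ℝ} :
    A ∈ cliffordGroup m ↔ (fun v => A.1 *ᵥ v) '' (lattice m : Set (Idx m → ℝ)) = lattice m :=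
  Iff.rfl

lemma mul_transpose_of_orthogonal (A : Matrix.orthogonalGroup (Idx m) ℝ) : A.1 * A.1ᵀ = 1 :=
  (Matrix.mem_orthogonalGroup_iff (Idx m) ℝ).mp A.2

lemma transpose_mul_of_orthogonal (A : Matrix.orthogonalGroup (Idx m) ℝ) : A.1ᵀ * A.1 = 1 :=
  (Matrix.mem_orthogonalGroup_iff' (Idx m) ℝ).mp A.2

lemma mulVec_mem_of_mem_cliffordGroup {A : Matrix.orthogonalGroup (Idx m) ℝ}
    (hA : A ∈ cliffordGroup m) {x : Idx m → ℝ} (hx : x ∈ lattice m) : A.1 *ᵥ x ∈ lattice m := by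
  rw [mem_cliffordGroup_iff] at hA
  have : A.1 *ᵥ x ∈ (lattice m : Set (Idx m → ℝ)) := hA ▸ ⟨x, hx, rfl⟩
  exact this

lemma transpose_mulVec_mem_of_mem_cliffordGroup {A : Matrix.orthogonalGroup (Idx m) ℝ}
    (hA : A ∈ cliffordGroup m) {x : Idx m → ℝ} (hx : x ∈ lattice m) :
    A.1ᵀ *ᵥ x ∈ lattice m :=
  mulVec_mem_of_mem_cliffordGroup ((cliffordGroup m).inv_mem hA) hx

lemma mem_cliffordGroup_of {A : Matrix.orthogonalGroup (Idx m) ℝ}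
    (h1 : ∀ v : Fin m → Fin 2 → ℝ, (∀ k, v k ∈ latticeOne) → A.1 *ᵥ pureTensor v ∈ lattice m)
    (h2 : ∀ v : Fin m → Fin 2 → ℝ, (∀ k, v k ∈ latticeOne) →
      A.1ᵀ *ᵥ pureTensor v ∈ lattice m) : A ∈ cliffordGroup m := by
  rw [mem_cliffordGroup_iff]
  ext x
  constructor
  · rintro ⟨y, hy, rfl⟩
    exact mulVec_mem_lattice h1 hy
  · intro hx
    refine ⟨A.1ᵀ *ᵥ x, mulVec_mem_lattice h2 hx, ?_⟩
    simp only
    rw [Matrix.mulVec_mulVec, mul_transpose_of_orthogonal, Matrix.one_mulVec]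

/-- The sign change subtracts twice the part with `u i = u j = 1`. For `i ≠ j` the factor 2 is
absorbed by one lattice vector `(0, √2)` in each of the two places; for `i = j` by one such vector
and the scalar `√2`. -/
lemma controlledSign_mulVec_pureTensor (i j : Fin m) {v : Fin m → Fin 2 → ℝ}
    (hv : ∀ k, v k ∈ latticeOne) : controlledSign i j *ᵥ pureTensor v ∈ lattice m := by
  set v' : Fin m → Fin 2 → ℝ :=
    fun k => if k = i ∨ k = j then ![0, √2] else v k with hv'
  have hv'1 : ∀ k, v' k ∈ latticeOne := by
    intro k
    simp only [hv']
    split_ifs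
    · exact mem_latticeOne.mpr ⟨-1, sqrtTwo, by simp, by simp⟩
    · exact hv k
  have hs := sqrt_two_mul_self
  by_cases hij : i = j
  · subst hij
    have h1 : controlledSign i i *ᵥ pureTensor v =
        pureTensor v - (sqrtTwo * ⟨v i 1, apply_mem_of_mem_latticeOne (hv i) 1⟩ : ZSqrtTwo) •
          pureTensor v' := by
      funext u
      rw [controlledSign, Matrix.mulVec_diagonal, Pi.sub_apply, Pi.smul_apply,
        Subalgebra.smul_def, smul_eq_mul]
      simp only [pureTensor, Subalgebra.coe_mul, coe_sqrtTwo]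
      rw [← Finset.mul_prod_erase _ _ (Finset.mem_univ i),
        ← Finset.mul_prod_erase _ (fun k => v' k (u k)) (Finset.mem_univ i)]
      have h2 : ∏ k ∈ Finset.univ.erase i, v' k (u k) =
          ∏ k ∈ Finset.univ.erase i, v k (u k) :=
        Finset.prod_congr rfl fun k hk => by simp [hv', Finset.ne_of_mem_erase hk]
      rw [h2, bitSgn_eq]
      generalize ∏ k ∈ Finset.univ.erase i, v k (u k) = R
      have h3 : v' i = ![0, √2] := by simp [hv']
      rw [h3]
      generalize u i = x
      fin_cases x
      · simp
      · simp
        linear_combination (v i 1) * R * hs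
    rw [h1]
    exact Submodule.sub_mem _ (pureTensor_mem hv) (Submodule.smul_mem _ _ (pureTensor_mem hv'1))
  · have h1 : controlledSign i j *ᵥ pureTensor v =
        pureTensor v - (⟨v i 1, apply_mem_of_mem_latticeOne (hv i) 1⟩ *
          ⟨v j 1, apply_mem_of_mem_latticeOne (hv j) 1⟩ : ZSqrtTwo) • pureTensor v' := by
      funext u
      rw [controlledSign, Matrix.mulVec_diagonal, Pi.sub_apply, Pi.smul_apply,
        Subalgebra.smul_def, smul_eq_mul]
      simp only [pureTensor, Subalgebra.coe_mul]
      have hj : j ∈ Finset.univ.erase i := Finset.mem_erase.mpr ⟨Ne.symm hij, Finset.mem_univ _⟩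
      rw [← Finset.mul_prod_erase _ _ (Finset.mem_univ i),
        ← Finset.mul_prod_erase _ (fun k => v' k (u k)) (Finset.mem_univ i),
        ← Finset.mul_prod_erase _ _ hj, ← Finset.mul_prod_erase _ (fun k => v' k (u k)) hj]
      have h2 : ∏ k ∈ (Finset.univ.erase i).erase j, v' k (u k) =
          ∏ k ∈ (Finset.univ.erase i).erase j, v k (u k) :=
        Finset.prod_congr rfl fun k hk => by
          simp [hv', Finset.ne_of_mem_erase hk,
            Finset.ne_of_mem_erase (Finset.mem_of_mem_erase hk)]
      rw [h2, bitSgn_eq]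
      generalize ∏ k ∈ (Finset.univ.erase i).erase j, v k (u k) = R
      have h3 : v' i = ![0, √2] := by simp [hv']
      have h4 : v' j = ![0, √2] := by simp [hv']
      rw [h3, h4]
      generalize u i = x, u j = y
      fin_cases x <;> fin_cases y
      · simp
      · simp
      · simp
      · simp
        linear_combination (v i 1) * (v j 1) * R * hs
    rw [h1]
    exact Submodule.sub_mem _ (pureTensor_mem hv) (Submodule.smul_mem _ _ (pureTensor_mem hv'1))

lemma controlledSign_mem_orthogonalGroup (i j : Fin m) :
    controlledSign i j ∈ Matrix.orthogonalGroup (Idx m) ℝ := by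
  have h : (controlledSign i j)ᵀ = controlledSign i j := Matrix.diagonal_transpose _
  have h2 : ∀ x y, bitSgn x y * bitSgn x y = 1 := fun x y => sgn_mul_self _
  rw [Matrix.mem_orthogonalGroup_iff, h, controlledSign, Matrix.diagonal_mul_diagonal]
  simp [h2]

theorem containsGenerators_cliffordGroup (m : ℕ) : ContainsGenerators (cliffordGroup m) where
  sign i j := by
    refine ⟨⟨_, controlledSign_mem_orthogonalGroup i j⟩, mem_cliffordGroup_of
      (fun v hv => controlledSign_mulVec_pureTensor i j hv) (fun v hv => ?_), rfl⟩
    have : (controlledSign i j)ᵀ = controlledSign i j := Matrix.diagonal_transpose _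
    simp only [this]
    exact controlledSign_mulVec_pureTensor i j hv
  hadamard i := by
    have h0 : ∀ a, Function.update (fun _ : Fin m => (1 : Matrix (Fin 2) (Fin 2) ℝ)) i hadamardTwo a
        = hadamardTwo ∨
        Function.update (fun _ : Fin m => (1 : Matrix (Fin 2) (Fin 2) ℝ)) i hadamardTwo a = 1 := by
      intro a
      by_cases ha : a = i
      · subst ha; simp
      · simp [ha]
    have hT : hadamardTwoᵀ = hadamardTwo := by
      rw [hadamardTwo_eq]
      ext x y
      fin_cases x <;> fin_cases y <;> simp
    refine ⟨⟨localMatrix i hadamardTwo, kronecker_mem_orthogonalGroup fun a => ?_⟩,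
      mem_cliffordGroup_of (fun v hv => ?_) (fun v hv => ?_), rfl⟩
    · rcases h0 a with h | h <;> rw [h]
      · exact hadamardTwo_mul_transpose
      · simp
    · simp only [localMatrix, kronecker_mulVec]
      refine pureTensor_mem fun a => ?_
      rcases h0 a with h | h <;> rw [h]
      · exact hadamardTwo_mulVec_mem (hv a)
      · simpa using hv a
    · simp only [localMatrix, kronecker_transpose, kronecker_mulVec]
      refine pureTensor_mem fun a => ?_
      rcases h0 a with h | h <;> rw [h]
      · rw [hT]
        exact hadamardTwo_mulVec_mem (hv a)
      · simpa using hv a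

/-- The Pauli matrices of `m` tensor factors. -/
def pauli (a b : Idx m) : Matrix (Idx m) (Idx m) ℝ := kronecker fun i => pauliTwo (a i) (b i)

lemma pauli_mem_orthogonalGroup (a b : Idx m) :
    pauli a b ∈ Matrix.orthogonalGroup (Idx m) ℝ :=
  kronecker_mem_orthogonalGroup fun i => pauliTwo_mul_transpose (a i) (b i)

/-- The Pauli matrices as orthogonal matrices. -/
def orthogonalPauli (a b : Idx m) : Matrix.orthogonalGroup (Idx m) ℝ :=
  ⟨pauli a b, pauli_mem_orthogonalGroup a b⟩

lemma pauliTwo_mulVec_mem (s t : Fin 2) {v : Fin 2 → ℝ} (hv : v ∈ latticeOne) :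
    pauliTwo s t *ᵥ v ∈ latticeOne := by
  obtain ⟨y, hy, h⟩ := pauliTwo_mulVec_sub s t hv
  rw [h]
  exact latticeOne.add_mem hv (latticeOne.smul_mem _ hy)

lemma pauli_mem_cliffordGroup (a b : Idx m) : orthogonalPauli a b ∈ cliffordGroup m := by
  refine mem_cliffordGroup_of (fun v hv => ?_) (fun v hv => ?_)
  · simp only [orthogonalPauli, pauli, kronecker_mulVec]
    exact pureTensor_mem fun i => pauliTwo_mulVec_mem _ _ (hv i)
  · simp only [orthogonalPauli, pauli, kronecker_transpose, kronecker_mulVec]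
    refine pureTensor_mem fun i => ?_
    rw [pauliTwo_transpose, bitSgn_eq]
    split_ifs
    · rw [neg_smul, one_smul, Matrix.neg_mulVec]
      exact latticeOne.neg_mem (pauliTwo_mulVec_mem _ _ (hv i))
    · rw [one_smul]
      exact pauliTwo_mulVec_mem _ _ (hv i)

/-- The matrix acts trivially on the lattice modulo `√2`. -/
def IsCongruentOne (A : Matrix (Idx m) (Idx m) ℝ) : Prop :=
  ∀ x ∈ lattice m, ∃ y ∈ lattice m, A *ᵥ x = x + sqrtTwo • y

/-- Changing one tensor factor at a time, each change adds `√2` times a pure tensor of lattice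
vectors. -/
lemma exists_pureTensor_eq_add {v y : Fin m → Fin 2 → ℝ} (hv : ∀ k, v k ∈ latticeOne)
    (hy : ∀ k, y k ∈ latticeOne) :
    ∃ z ∈ lattice m, pureTensor (fun k => v k + sqrtTwo • y k) = pureTensor v + sqrtTwo • z := by
  suffices H : ∀ s : Finset (Fin m), ∃ z ∈ lattice m,
      pureTensor (fun k => if k ∈ s then v k + sqrtTwo • y k else v k) =
        pureTensor v + sqrtTwo • z by
    simpa using H Finset.univ
  intro s
  induction s using Finset.induction_on with
  | empty => exact ⟨0, Submodule.zero_mem _, by simp⟩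
  | insert i s hi ih =>
    obtain ⟨z, hz, h⟩ := ih
    set f : Fin m → Fin 2 → ℝ := fun k => if k ∈ s then v k + sqrtTwo • y k else v k with hf
    have hfmem : ∀ k, f k ∈ latticeOne := by
      intro k
      simp only [hf]
      split_ifs
      · exact latticeOne.add_mem (hv k) (latticeOne.smul_mem _ (hy k))
      · exact hv k
    refine ⟨z + pureTensor (Function.update f i (y i)), Submodule.add_mem _ hz
      (pureTensor_mem fun k => ?_), ?_⟩
    · by_cases hk : k = i
      · subst hk; simpa using hy k
      · simpa [hk] using hfmem k
    · rw [smul_add, ← add_assoc, ← h]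
      set f' : Fin m → Fin 2 → ℝ :=
        fun k => if k ∈ insert i s then v k + sqrtTwo • y k else v k with hf'
      funext u
      simp only [pureTensor, Pi.add_apply, Pi.smul_apply, Subalgebra.smul_def, smul_eq_mul]
      rw [← Finset.mul_prod_erase _ (fun k => f' k (u k)) (Finset.mem_univ i),
        ← Finset.mul_prod_erase _ (fun k => f k (u k)) (Finset.mem_univ i),
        ← Finset.mul_prod_erase _ (fun k => Function.update f i (y i) k (u k))
          (Finset.mem_univ i)]
      have h1 : ∏ k ∈ Finset.univ.erase i, Function.update f i (y i) k (u k) =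
          ∏ k ∈ Finset.univ.erase i, f k (u k) :=
        Finset.prod_congr rfl fun k hk => by simp [Finset.ne_of_mem_erase hk]
      have h2 : ∏ k ∈ Finset.univ.erase i, f' k (u k) =
          ∏ k ∈ Finset.univ.erase i, f k (u k) :=
        Finset.prod_congr rfl fun k hk => by simp [hf, hf', Finset.ne_of_mem_erase hk]
      rw [h1, h2]
      simp [hf, hf', hi, Subalgebra.smul_def]
      ring

lemma isCongruentOne_pauli (a b : Idx m) : IsCongruentOne (pauli a b) := by
  intro x hx
  induction hx using Submodule.span_induction with
  | mem x hx =>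
    obtain ⟨v, hv, rfl⟩ := hx
    choose y hy h using fun k => pauliTwo_mulVec_sub (a k) (b k) (hv k)
    rw [pauli, kronecker_mulVec]
    simp_rw [h]
    exact exists_pureTensor_eq_add hv hy
  | zero => exact ⟨0, Submodule.zero_mem _, by simp⟩
  | add x y _ _ hx hy =>
    obtain ⟨z, hz, h⟩ := hx
    obtain ⟨w, hw, h'⟩ := hy
    refine ⟨z + w, Submodule.add_mem _ hz hw, ?_⟩
    rw [Matrix.mulVec_add, h, h', smul_add]
    abel
  | smul c x _ hx =>
    obtain ⟨z, hz, h⟩ := hx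
    refine ⟨c • z, Submodule.smul_mem _ c hz, ?_⟩
    rw [Matrix.mulVec_smul, h, smul_add, smul_comm]

end Lattice

/-! ### Minimal vectors, and automorphisms congruent to 1 modulo 2. -/

section Integral

/-- The embedding of `ℤ[√2]` into the reals. -/
def embed : ℤ√2 →+* ℝ := Zsqrtd.toReal (d := 2) (by norm_num)

lemma embed_apply (r : ℤ√2) : embed r = r.re + r.im * √2 := by
  simp [embed, Zsqrtd.toReal]

lemma embed_injective : Function.Injective embed := by
  refine Zsqrtd.toReal_injective (by norm_num) fun n h => ?_
  have h1 : n.natAbs * n.natAbs = 2 := by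
    have := congrArg Int.natAbs h
    rw [Int.natAbs_mul] at this
    exact this.symm
  have h2 : n.natAbs < 2 := by nlinarith
  interval_cases n.natAbs <;> omega

lemma embed_sqrtd : embed Zsqrtd.sqrtd = √2 := by
  simp [embed_apply]

lemma exists_embed_eq {c : ℝ} (hc : c ∈ ZSqrtTwo) : ∃ r, embed r = c := by
  have h : ZSqrtTwo ≤ embed.toIntAlgHom.range := by
    refine Algebra.adjoin_le ?_
    rintro _ rfl
    exact ⟨Zsqrtd.sqrtd, embed_sqrtd⟩
  exact h hc

variable {m : ℕ}

lemma apply_mem_of_mem_lattice {x : Idx m → ℝ} (hx : x ∈ lattice m) (u : Idx m) :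
    x u ∈ ZSqrtTwo := by
  induction hx using Submodule.span_induction with
  | mem x hx =>
    obtain ⟨v, hv, rfl⟩ := hx
    exact Subalgebra.prod_mem _ fun k _ => apply_mem_of_mem_latticeOne (hv k) _
  | zero => exact ZSqrtTwo.zero_mem
  | add x y _ _ hx hy => exact ZSqrtTwo.add_mem hx hy
  | smul c x _ hx => exact ZSqrtTwo.mul_mem c.2 hx

/-- The real vector with the given coordinates in `ℤ[√2]`. -/
def embedVec (y : Idx m → ℤ√2) : Idx m → ℝ := fun u => embed (y u)

lemma exists_embedVec_eq {x : Idx m → ℝ} (hx : x ∈ lattice m) : ∃ y, embedVec y = x := by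
  choose y hy using fun u => exists_embed_eq (apply_mem_of_mem_lattice hx u)
  exact ⟨y, funext hy⟩

/-- Half the trace of the norm of a vector over `ℤ[√2]`. -/
def traceForm (y : Idx m → ℤ√2) : ℤ := (∑ u, y u * y u).re

lemma traceForm_eq (y : Idx m → ℤ√2) :
    traceForm y = ∑ u, ((y u).re ^ 2 + 2 * (y u).im ^ 2) := by
  have h : ∀ (s : Finset (Idx m)) (f : Idx m → ℤ√2), (∑ u ∈ s, f u).re = ∑ u ∈ s, (f u).re := by
    intro s f
    induction s using Finset.induction_on with
    | empty => simp
    | insert a s ha ih => rw [Finset.sum_insert ha, Finset.sum_insert ha, Zsqrtd.re_add, ih]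
  rw [traceForm, h]
  refine Finset.sum_congr rfl fun u _ => ?_
  rw [Zsqrtd.re_mul]
  ring

lemma eq_zero_of_traceForm_nonpos {y : Idx m → ℤ√2} (h : traceForm y ≤ 0) : y = 0 := by
  rw [traceForm_eq] at h
  have h1 : ∀ u ∈ Finset.univ, 0 ≤ (y u).re ^ 2 + 2 * (y u).im ^ 2 := fun u _ => by positivity
  have h2 := (Finset.sum_eq_zero_iff_of_nonneg h1).mp
    (le_antisymm h (Finset.sum_nonneg h1))
  funext u
  have h3 := h2 u (Finset.mem_univ u)
  have h4 : (y u).re = 0 := by nlinarith [sq_nonneg (y u).re, sq_nonneg (y u).im]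
  have h5 : (y u).im = 0 := by nlinarith [sq_nonneg (y u).re, sq_nonneg (y u).im]
  exact Zsqrtd.ext h4 h5

lemma traceForm_sqrtd_smul (y : Idx m → ℤ√2) :
    traceForm (fun u => Zsqrtd.sqrtd * y u) = 2 * traceForm y := by
  rw [traceForm_eq, traceForm_eq, Finset.mul_sum]
  refine Finset.sum_congr rfl fun u _ => ?_
  simp [Zsqrtd.re_mul, Zsqrtd.im_mul]
  ring

lemma traceForm_neg (y : Idx m → ℤ√2) : traceForm (fun u => -y u) = traceForm y := by
  simp [traceForm]

lemma traceForm_add (y z : Idx m → ℤ√2) :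
    traceForm (y + z) = traceForm y + 2 * (∑ u, y u * z u).re + traceForm z := by
  have h : ∑ u, (y + z) u * (y + z) u =
      ∑ u, y u * y u + 2 * ∑ u, y u * z u + ∑ u, z u * z u := by
    rw [Finset.mul_sum, ← Finset.sum_add_distrib, ← Finset.sum_add_distrib]
    refine Finset.sum_congr rfl fun u _ => ?_
    simp only [Pi.add_apply]
    ring
  rw [traceForm, h, Zsqrtd.re_add, Zsqrtd.re_add, Zsqrtd.re_mul]
  simp [traceForm]

/-- The recursive structure of the lattice: its vectors split into halves `(x₁ + √2 z, x₁)` with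
`x₁` and `z` in the lattice one level down. -/
lemma slice_of_mem_lattice {x : Idx (m + 1) → ℝ} (hx : x ∈ lattice (m + 1)) :
    (fun u => x (Fin.cons 1 u)) ∈ lattice m ∧
      ∃ z ∈ lattice m, ∀ u, x (Fin.cons 0 u) = x (Fin.cons 1 u) + √2 * z u := by
  induction hx using Submodule.span_induction with
  | mem x hx =>
    obtain ⟨v, hv, rfl⟩ := hx
    obtain ⟨a, b, h0, h1⟩ := mem_latticeOne.mp (hv 0)
    have h2 : pureTensor (fun k => v (Fin.succ k)) ∈ lattice m :=
      pureTensor_mem fun k => hv _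
    have h3 : ∀ (s : Fin 2) (u : Idx m), pureTensor v (Fin.cons s u) =
        v 0 s * pureTensor (fun k => v (Fin.succ k)) u := by
      intro s u
      simp [pureTensor, Fin.prod_univ_succ]
    refine ⟨?_, a • pureTensor (fun k => v (Fin.succ k)), Submodule.smul_mem _ a h2,
      fun u => ?_⟩
    · simp_rw [h3, h1]
      exact Submodule.smul_mem _ b h2
    · rw [h3, h3, h0, h1, Pi.smul_apply, Subalgebra.smul_def, smul_eq_mul]
      ring
  | zero => exact ⟨Submodule.zero_mem _, 0, Submodule.zero_mem _, by simp⟩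
  | add x y _ _ hx hy =>
    obtain ⟨h1, z, hz, h2⟩ := hx
    obtain ⟨h1', z', hz', h2'⟩ := hy
    refine ⟨Submodule.add_mem _ h1 h1', z + z', Submodule.add_mem _ hz hz', fun u => ?_⟩
    simp only [Pi.add_apply, h2, h2']
    ring
  | smul c x _ hx =>
    obtain ⟨h1, z, hz, h2⟩ := hx
    refine ⟨Submodule.smul_mem _ c h1, c • z, Submodule.smul_mem _ c hz, fun u => ?_⟩
    simp only [Pi.smul_apply, h2, Subalgebra.smul_def, smul_eq_mul]
    ring

/-- The minimal norm of the balanced Barnes-Wall lattice. -/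
theorem two_pow_le_traceForm : ∀ {m : ℕ} {y : Idx m → ℤ√2}, embedVec y ∈ lattice m → y ≠ 0 →
    (2 : ℤ) ^ m ≤ traceForm y := by
  intro m
  induction m with
  | zero =>
    intro y _ h0
    by_contra! h
    exact h0 (eq_zero_of_traceForm_nonpos (by simpa using Int.lt_add_one_iff.mp h))
  | succ m ih =>
    intro y hy h0
    obtain ⟨h1, z, hz, h2⟩ := slice_of_mem_lattice hy
    obtain ⟨z, rfl⟩ := exists_embedVec_eq hz
    set y0 : Idx m → ℤ√2 := fun u => y (Fin.cons 0 u) with hy0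
    set y1 : Idx m → ℤ√2 := fun u => y (Fin.cons 1 u) with hy1
    have h1' : embedVec y1 ∈ lattice m := h1
    have h3 : ∀ u, y0 u = y1 u + Zsqrtd.sqrtd * z u := by
      intro u
      apply embed_injective
      rw [map_add, map_mul, embed_sqrtd]
      exact h2 u
    have h4 : traceForm y = traceForm y0 + traceForm y1 := by
      rw [traceForm_eq, traceForm_eq, traceForm_eq,
        ← Equiv.sum_comp (Fin.consEquiv fun _ : Fin (m + 1) => Fin 2), Fintype.sum_prod_type,
        Fin.sum_univ_two]
      rfl
    have h0' : embedVec y0 ∈ lattice m := by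
      have : embedVec y0 = embedVec y1 + sqrtTwo • embedVec z := by
        funext u
        exact h2 u
      rw [this]
      exact Submodule.add_mem _ h1' (Submodule.smul_mem _ _ hz)
    rw [h4, pow_succ]
    -- If one half vanishes, the other is `√2 z` up to sign and `traceForm` doubles under `√2`;
    -- otherwise both halves contribute at least `2 ^ m`.
    by_cases hy10 : y1 = 0
    · have h5 : y0 = fun u => Zsqrtd.sqrtd * z u := by
        funext u
        rw [h3 u, hy10]
        simp
      have h6 : z ≠ 0 := by
        rintro rfl
        apply h0
        funext u
        rw [← Fin.cons_self_tail u]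
        generalize u 0 = s
        fin_cases s
        · have := congrFun h5 (Fin.tail u)
          simpa [hy0] using this
        · exact congrFun hy10 (Fin.tail u)
      have h7 := ih hz h6
      rw [h5, traceForm_sqrtd_smul, hy10]
      simp [traceForm] at h7 ⊢
      linarith
    · by_cases hy00 : y0 = 0
      · have h5 : y1 = fun u => -(Zsqrtd.sqrtd * z u) := by
          funext u
          have := h3 u
          rw [hy00, Pi.zero_apply] at this
          exact eq_neg_of_add_eq_zero_left this.symm
        have h6 : z ≠ 0 := by
          rintro rfl
          exact hy10 (by rw [h5]; funext u; simp)
        have h7 := ih hz h6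
        rw [hy00, h5, traceForm_neg, traceForm_sqrtd_smul]
        simp [traceForm] at h7 ⊢
        linarith
      · have h5 := ih h0' hy00
        have h6 := ih h1' hy10
        linarith

/-- An orthogonal matrix that is congruent to one modulo two sends each minimal vector to itself
or to its negative. -/
lemma mulVec_eq_or_eq_neg {A : Matrix (Idx m) (Idx m) ℝ} (hA : Aᵀ * A = 1)
    (h2 : ∀ x ∈ lattice m, ∃ z ∈ lattice m, A *ᵥ x = x + (2 : ℝ) • z) {y : Idx m → ℤ√2}
    (hy : embedVec y ∈ lattice m) (hmin : traceForm y = 2 ^ m) :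
    A *ᵥ embedVec y = embedVec y ∨ A *ᵥ embedVec y = -embedVec y := by
  obtain ⟨z, hz, h⟩ := h2 _ hy
  obtain ⟨z, rfl⟩ := exists_embedVec_eq hz
  by_cases h0 : z = 0
  · left
    rw [h, h0]
    funext u
    simp [embedVec]
  right
  have h3 : A *ᵥ embedVec y = embedVec (y + (z + z)) := by
    rw [h]
    funext u
    simp [embedVec]
    ring
  have h4 : traceForm (y + (z + z)) = traceForm y := by
    have h5 : (A *ᵥ embedVec y) ⬝ᵥ (A *ᵥ embedVec y) = embedVec y ⬝ᵥ embedVec y := by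
      rw [Matrix.dotProduct_mulVec, Matrix.vecMul_mulVec, ← Matrix.dotProduct_mulVec, hA,
        Matrix.one_mulVec]
    rw [h3] at h5
    rw [traceForm, traceForm]
    congr 1
    apply embed_injective
    rw [map_sum, map_sum]
    simpa [dotProduct, embedVec] using h5
  -- Comparing the norms of `y + 2 z` and `y` gives `traceForm (y + z) = traceForm y - traceForm z`,
  -- and `traceForm z ≥ 2 ^ m` by minimality. So `z = -y`.
  have h5 : traceForm (y + z) ≤ 0 := by
    have h6 := two_pow_le_traceForm hz h0
    have h7 : (∑ u, (y + z) u * z u).re = (∑ u, y u * z u).re + traceForm z := by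
      simp only [Pi.add_apply, add_mul, Finset.sum_add_distrib, Zsqrtd.re_add]
      rfl
    rw [← add_assoc, traceForm_add, h7, traceForm_add] at h4
    rw [traceForm_add]
    linarith
  have h6 := eq_zero_of_traceForm_nonpos h5
  rw [h3]
  have h7 : y + (z + z) = -y := by
    have h8 : z = -y := eq_neg_of_add_eq_zero_right h6
    rw [h8]; abel
  rw [h7]
  funext u
  simp [embedVec]

/-- The vectors `√2 ^ m e_u` and the all-ones vector are minimal. The former make `A` diagonal with
entries `±1`; the latter makes all these signs equal. -/
lemma eq_one_or_eq_neg_one {A : Matrix (Idx m) (Idx m) ℝ} (hA : Aᵀ * A = 1)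
    (h2 : ∀ x ∈ lattice m, ∃ z ∈ lattice m, A *ᵥ x = x + (2 : ℝ) • z) : A = 1 ∨ A = -1 := by
  have hones : A *ᵥ (fun _ => 1) = (fun _ => 1) ∨ A *ᵥ (fun _ => 1) = -(fun _ => 1) := by
    have h3 : embedVec (fun _ : Idx m => (1 : ℤ√2)) = fun _ => 1 := by
      funext u; simp [embedVec]
    rw [← h3]
    refine mulVec_eq_or_eq_neg hA h2 ?_ ?_
    · have h4 : embedVec (fun _ : Idx m => (1 : ℤ√2)) = pureTensor fun _ _ => 1 := by
        rw [h3]; funext u; simp [pureTensor]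
      rw [h4]
      exact pureTensor_mem fun _ => mem_latticeOne.mpr ⟨0, 1, by simp, by simp⟩
    · rw [traceForm_eq]
      simp
  have hbasis : ∀ u, A *ᵥ Pi.single u 1 = Pi.single u 1 ∨
      A *ᵥ Pi.single u 1 = -Pi.single u 1 := by
    intro u
    have h3 : embedVec (Pi.single u (Zsqrtd.sqrtd ^ m)) = √2 ^ m • Pi.single u (1 : ℝ) := by
      funext w
      by_cases hw : w = u
      · subst hw; simp [embedVec, embed_sqrtd]
      · simp [embedVec, hw]
    have h4 := mulVec_eq_or_eq_neg hA h2 (y := Pi.single u (Zsqrtd.sqrtd ^ m)) ?_ ?_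
    · rw [h3, Matrix.mulVec_smul, ← smul_neg] at h4
      have h5 : (√2 : ℝ) ^ m ≠ 0 := by positivity
      exact h4.imp (fun h => smul_right_injective _ h5 h) fun h => smul_right_injective _ h5 h
    · have h4 : embedVec (Pi.single u (Zsqrtd.sqrtd ^ m)) =
          pureTensor fun k => Pi.single (u k) (√2) := by
        rw [h3]
        funext w
        by_cases hw : w = u
        · subst hw; simp [pureTensor]
        · obtain ⟨k, hk⟩ := Function.ne_iff.mp hw
          rw [pureTensor, Finset.prod_eq_zero (Finset.mem_univ k)]
          · simp [hw]
          · simp [hk]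
      rw [h4]
      refine pureTensor_mem fun k => ?_
      generalize u k = s
      fin_cases s
      · exact mem_latticeOne.mpr ⟨1, 0, by simp, by simp⟩
      · exact mem_latticeOne.mpr ⟨-1, sqrtTwo, by simp, by simp⟩
    · rw [traceForm, Finset.sum_eq_single u]
      · rw [Pi.single_eq_same, ← mul_pow, Zsqrtd.dmuld]
        have : ((2 : ℤ) : ℤ√2) ^ m = ((2 ^ m : ℤ) : ℤ√2) := by push_cast; rfl
        rw [this, Zsqrtd.re_intCast]
      · intro w _ hw
        simp [hw]
      · simp
  have hentry : ∀ u w, u ≠ w → A u w = 0 := by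
    intro u w huw
    have h3 : (A *ᵥ Pi.single w 1) u = A u w := by simp
    rw [← h3]
    rcases hbasis w with h | h <;> rw [h] <;> simp [huw]
  have hdiag : ∀ u, (A *ᵥ fun _ => 1) u = A u u := by
    intro u
    rw [Matrix.mulVec, dotProduct, Finset.sum_eq_single u]
    · simp
    · intro w _ hw
      rw [hentry u w hw.symm, zero_mul]
    · simp
  rcases hones with h | h
  · left
    ext u w
    by_cases huw : u = w
    · subst huw
      rw [← hdiag, h, Matrix.one_apply_eq]
    · rw [hentry u w huw, Matrix.one_apply_ne huw]
  · right
    ext u w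
    by_cases huw : u = w
    · subst huw
      rw [← hdiag, h, Matrix.neg_apply, Matrix.one_apply_eq]
      rfl
    · rw [hentry u w huw, Matrix.neg_apply, Matrix.one_apply_ne huw, neg_zero]

/-- Automorphisms that are congruent to one modulo `√2` commute up to sign. -/
lemma mul_eq_or_eq_neg_of_isCongruentOne {A B : Matrix.orthogonalGroup (Idx m) ℝ}
    (hA : A ∈ cliffordGroup m) (hB : B ∈ cliffordGroup m) (hA' : IsCongruentOne A.1)
    (hB' : IsCongruentOne B.1) : A.1 * B.1 = B.1 * A.1 ∨ A.1 * B.1 = -(B.1 * A.1) := by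
  have key := eq_one_or_eq_neg_one (m := m) (A := (A * B * A⁻¹ * B⁻¹).1)
    (transpose_mul_of_orthogonal _) ?_
  · have h1 : (A * B * A⁻¹ * B⁻¹).1 * (B.1 * A.1) = A.1 * B.1 := by
      have : A * B * A⁻¹ * B⁻¹ * (B * A) = A * B := by group
      exact congrArg Subtype.val this
    rcases key with h | h <;> rw [h] at h1
    · left; rw [← h1, one_mul]
    · right; rw [← h1, neg_mul, one_mul]
  · intro x hx
    set z := A.1ᵀ *ᵥ (B.1ᵀ *ᵥ x) with hz
    have hzM : z ∈ lattice m := transpose_mulVec_mem_of_mem_cliffordGroup hA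
      (transpose_mulVec_mem_of_mem_cliffordGroup hB hx)
    have hx' : x = B.1 *ᵥ (A.1 *ᵥ z) := by
      rw [hz, Matrix.mulVec_mulVec _ A.1 A.1ᵀ, mul_transpose_of_orthogonal, Matrix.one_mulVec,
        Matrix.mulVec_mulVec, mul_transpose_of_orthogonal, Matrix.one_mulVec]
    have h1 : (A * B * A⁻¹ * B⁻¹).1 *ᵥ x = A.1 *ᵥ (B.1 *ᵥ z) := by
      have : (A * B * A⁻¹ * B⁻¹).1 = A.1 * B.1 * A.1ᵀ * B.1ᵀ := rfl
      rw [this, hz]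
      simp only [Matrix.mulVec_mulVec, mul_assoc]
    obtain ⟨p, hp, h2⟩ := hA' z hzM
    obtain ⟨q, hq, h3⟩ := hB' z hzM
    obtain ⟨p', hp', h4⟩ := hB' p hp
    obtain ⟨q', hq', h5⟩ := hA' q hq
    -- Expanding both products on `z`, the terms linear in `√2` cancel and `A B z - B A z = 2 (q' -
    -- p')` remains.
    refine ⟨q' - p', Submodule.sub_mem _ hq' hp', ?_⟩
    rw [h1, hx', h3, h2, Matrix.mulVec_add, Matrix.mulVec_add, Matrix.mulVec_smul,
      Matrix.mulVec_smul, h4, h5, h2, h3]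
    funext u
    simp only [Pi.add_apply, Pi.smul_apply, Pi.sub_apply, Subalgebra.smul_def, smul_eq_mul,
      coe_sqrtTwo]
    linear_combination (q' u - p' u) * sqrt_two_mul_self

end Integral

/-! ### The normalizer of the Pauli group. -/

section Pauli

variable {m : ℕ}

lemma bit_add_self (x : Fin 2) : x + x = 0 := by fin_cases x <;> rfl

lemma idx_add_self (u : Idx m) : u + u = 0 := funext fun i => bit_add_self (u i)

lemma idx_add_add_self (u v : Idx m) : u + v + v = u := by
  rw [add_assoc, idx_add_self, add_zero]

lemma bitSgn_add (x y z : Fin 2) : bitSgn x (y + z) = bitSgn x y * bitSgn x z := by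
  fin_cases x <;> fin_cases y <;> fin_cases z <;> simp [bitSgn_eq]

lemma bitSgn_comm (x y : Fin 2) : bitSgn x y = bitSgn y x := by
  simp only [bitSgn_eq, and_comm]

/-- The characters of the elementary abelian group of indices. -/
def chi (b u : Idx m) : ℝ := ∏ i, bitSgn (b i) (u i)

lemma chi_add (b u w : Idx m) : chi b (u + w) = chi b u * chi b w := by
  rw [chi, chi, chi, ← Finset.prod_mul_distrib]
  exact Finset.prod_congr rfl fun i _ => bitSgn_add _ _ _

lemma chi_comm (b u : Idx m) : chi b u = chi u b :=
  Finset.prod_congr rfl fun _ _ => bitSgn_comm _ _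

lemma chi_zero (b : Idx m) : chi b 0 = 1 :=
  Finset.prod_eq_one fun i _ => by simp [bitSgn_eq]

lemma chi_zero_left (b : Idx m) : chi 0 b = 1 := by rw [chi_comm, chi_zero]

lemma chi_mul_self (b u : Idx m) : chi b u * chi b u = 1 := by
  rw [← chi_add, idx_add_self, chi_zero]

lemma chi_single (b : Idx m) (i : Fin m) : chi b (Pi.single i 1) = bitSgn (b i) 1 := by
  rw [chi, Finset.prod_eq_single i]
  · simp
  · intro j _ hj
    simp [hj, bitSgn_eq]
  · simp

lemma chi_injective {b b' : Idx m} (h : ∀ u, chi b u = chi b' u) : b = b' := by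
  funext i
  have h1 := h (Pi.single i 1)
  rw [chi_single, chi_single] at h1
  generalize b i = x, b' i = y at h1
  fin_cases x <;> fin_cases y <;> simp [bitSgn_eq] at h1 ⊢ <;> norm_num at h1

lemma exists_eq_chi (f : Idx m → ℝ) (hadd : ∀ u w, f (u + w) = f u * f w)
    (hf : ∀ u, f u = 1 ∨ f u = -1) : ∃ b, ∀ u, f u = chi b u := by
  have h0 : f 0 = 1 := by
    have h1 := hadd 0 0
    rw [add_zero] at h1
    rcases hf 0 with h | h
    · exact h
    · rw [h] at h1; norm_num at h1
  refine ⟨fun i => if f (Pi.single i 1) = 1 then 0 else 1, fun u => ?_⟩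
  have h1 : ∀ i x, f (Pi.single i x) =
      bitSgn (if f (Pi.single i 1) = 1 then 0 else 1) x := by
    intro i x
    fin_cases x
    · simp [h0, bitSgn_eq]
    · change f (Pi.single i 1) = bitSgn _ 1
      rcases hf (Pi.single i 1) with h | h
      · simp [h, bitSgn_eq]
      · rw [h]; norm_num [bitSgn_eq]
  have h2 : ∀ s : Finset (Fin m), f (∑ i ∈ s, Pi.single i (u i)) =
      ∏ i ∈ s, f (Pi.single i (u i)) := by
    intro s
    induction s using Finset.induction_on with
    | empty => simpa using h0
    | insert a s ha ih => rw [Finset.sum_insert ha, hadd, ih, Finset.prod_insert ha]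
  have h3 := h2 Finset.univ
  rw [Finset.univ_sum_single] at h3
  rw [h3, chi]
  exact Finset.prod_congr rfl fun i _ => h1 i (u i)

lemma pauli_apply (a b u w : Idx m) : pauli a b u w = if u = w + a then chi b w else 0 := by
  rw [pauli, kronecker]
  split_ifs with h
  · subst h
    exact Finset.prod_congr rfl fun i _ => by simp [pauliTwo]
  · obtain ⟨i, hi⟩ := Function.ne_iff.mp h
    refine Finset.prod_eq_zero (Finset.mem_univ i) ?_
    exact if_neg hi

lemma mul_pauli_apply (h : Matrix (Idx m) (Idx m) ℝ) (a b u w : Idx m) :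
    (h * pauli a b) u w = h u (w + a) * chi b w := by
  simp [Matrix.mul_apply, pauli_apply]

lemma pauli_mul_apply (h : Matrix (Idx m) (Idx m) ℝ) (a b u w : Idx m) :
    (pauli a b * h) u w = chi b (u + a) * h (u + a) w := by
  rw [Matrix.mul_apply, Finset.sum_eq_single (u + a)]
  · rw [pauli_apply, if_pos (idx_add_add_self u a).symm]
  · intro v _ hv
    rw [pauli_apply, if_neg, zero_mul]
    rintro rfl
    exact hv (idx_add_add_self v a).symm
  · simp

/-- A matrix that commutes up to sign with all Pauli matrices is a multiple of a Pauli matrix. -/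
lemma exists_eq_pauli {h : Matrix (Idx m) (Idx m) ℝ} (hh : h * hᵀ = 1)
    (hP : ∀ a b, h * pauli a b = pauli a b * h ∨ h * pauli a b = -(pauli a b * h)) :
    ∃ a b, h = pauli a b ∨ h = -pauli a b := by
  have hsign : ∀ a b, ∃ ε : ℝ, (ε = 1 ∨ ε = -1) ∧
      ∀ u w, h u (w + a) * chi b w = ε * (chi b (u + a) * h (u + a) w) := by
    intro a b
    rcases hP a b with h1 | h1
    · refine ⟨1, Or.inl rfl, fun u w => ?_⟩
      rw [← mul_pauli_apply, h1, pauli_mul_apply, one_mul]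
    · refine ⟨-1, Or.inr rfl, fun u w => ?_⟩
      rw [← mul_pauli_apply, h1, Matrix.neg_apply, pauli_mul_apply, neg_one_mul]
  obtain ⟨w₀, hw₀⟩ : ∃ w, h 0 w ≠ 0 := by
    by_contra! h0
    have h1 := congrFun (congrFun hh 0) 0
    rw [Matrix.mul_apply, Matrix.one_apply_eq, Finset.sum_eq_zero] at h1
    · exact zero_ne_one h1
    · intro w _
      rw [h0 w, zero_mul]
  choose ε hε hεh using fun b => hsign 0 b
  choose δ hδ hδh using fun a => hsign a 0
  simp only [add_zero] at hεh
  simp only [chi_zero_left, mul_one, one_mul] at hδh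
  -- The signs against the diagonal Pauli matrices determine `u + w` at every nonzero entry, so `h`
  -- is supported on a single translate of the diagonal.
  have hε1 : ∀ b u w, h u w ≠ 0 → ε b = chi b (u + w) := by
    intro b u w h0
    have h1 := hεh b u w
    have h2 : chi b w = ε b * chi b u := by
      apply mul_left_cancel₀ h0
      rw [h1]; ring
    rw [chi_add, h2]
    linear_combination -(ε b) * chi_mul_self b u
  have hsupp : ∀ u w, h u w ≠ 0 → u = w + w₀ := by
    intro u w h0
    have h1 : u + w = w₀ := by
      refine chi_injective fun b => ?_
      rw [chi_comm, ← hε1 b u w h0, hε1 b 0 w₀ hw₀, zero_add, chi_comm]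
    rw [← h1, add_comm u w, ← add_assoc, idx_add_self, zero_add]
  have hδ1 : ∀ a, h a (w₀ + a) = δ a * h 0 w₀ := by
    intro a
    rw [hδh a a w₀, idx_add_self]
  -- The signs against the translations are multiplicative; the resulting character gives the
  -- entries along that translate.
  obtain ⟨b, hb⟩ := exists_eq_chi δ (fun a a' => by
    apply mul_right_cancel₀ hw₀
    have h1 := hδ1 (a' + a)
    rw [← add_assoc, hδh a (a' + a) (w₀ + a'), idx_add_add_self, hδ1 a', ← mul_assoc] at h1
    rw [add_comm a a', ← h1]) hδ
  have hval : ∀ w, h (w + w₀) w = (chi b w₀ * h 0 w₀) * chi b w := by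
    intro w
    have h1 := hδ1 (w + w₀)
    rw [add_comm w w₀, ← add_assoc, idx_add_self, zero_add, hb, chi_add] at h1
    rw [add_comm w w₀, h1]
    ring
  set κ := chi b w₀ * h 0 w₀ with hκ
  have heq : h = κ • pauli w₀ b := by
    ext u w
    rw [Matrix.smul_apply, pauli_apply, smul_eq_mul]
    split_ifs with h1
    · rw [h1, hval]
    · rw [mul_zero]
      by_contra h0
      exact h1 (hsupp u w h0)
  have hκ1 : κ * κ = 1 := by
    rw [heq, Matrix.transpose_smul, Matrix.smul_mul, Matrix.mul_smul, smul_smul,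
      (Matrix.mem_orthogonalGroup_iff (Idx m) ℝ).mp (pauli_mem_orthogonalGroup w₀ b)] at hh
    have h1 := congrFun (congrFun hh 0) 0
    simpa using h1
  refine ⟨w₀, b, ?_⟩
  rcases mul_self_eq_one_iff.mp hκ1 with h1 | h1
  · left; rw [heq, h1, one_smul]
  · right; rw [heq, h1, neg_smul, one_smul]

lemma pauli_injective {a b a' b' : Idx m}
    (h : pauli a b = pauli a' b' ∨ pauli a b = -pauli a' b') : a = a' ∧ b = b' := by
  have hc : ∀ b w : Idx m, chi b w ≠ 0 := fun b w h0 => by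
    have := chi_mul_self b w
    rw [h0, mul_zero] at this
    exact zero_ne_one this
  obtain ⟨ε, hε⟩ : ∃ ε : ℝ, pauli a b = ε • pauli a' b' := by
    rcases h with h | h
    · exact ⟨1, by rw [h, one_smul]⟩
    · exact ⟨-1, by rw [h, neg_smul, one_smul]⟩
  have h1 : ∀ u w, pauli a b u w = ε * pauli a' b' u w := fun u w => by rw [hε]; rfl
  have ha : a = a' := by
    by_contra hne
    have h2 := h1 (0 + a) 0
    rw [pauli_apply, pauli_apply, if_pos rfl, if_neg (by simpa using hne), mul_zero] at h2
    exact hc _ _ h2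
  subst ha
  refine ⟨rfl, chi_injective fun w => ?_⟩
  have h2 : ∀ w, chi b w = ε * chi b' w := fun w => by
    simpa [pauli_apply] using h1 (w + a) w
  have h3 := h2 0
  rw [chi_zero, chi_zero, mul_one] at h3
  rw [h2, ← h3, one_mul]

/-- The Clifford group normalizes the Pauli group. -/
theorem exists_conj_pauli {A : Matrix.orthogonalGroup (Idx m) ℝ} (hA : A ∈ cliffordGroup m)
    (a b : Idx m) : ∃ a' b', A.1ᵀ * pauli a b * A.1 = pauli a' b' ∨
      A.1ᵀ * pauli a b * A.1 = -pauli a' b' := by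
  have hmem : A⁻¹ * orthogonalPauli a b * A ∈ cliffordGroup m :=
    (cliffordGroup m).mul_mem ((cliffordGroup m).mul_mem ((cliffordGroup m).inv_mem hA)
      (pauli_mem_cliffordGroup a b)) hA
  have hval : (A⁻¹ * orthogonalPauli a b * A).1 = A.1ᵀ * pauli a b * A.1 := rfl
  -- Being congruent to 1 modulo `√2` is stable under conjugation by automorphisms of the lattice.
  have hcong : IsCongruentOne (A⁻¹ * orthogonalPauli a b * A).1 := by
    intro x hx
    obtain ⟨y, hy, h⟩ := isCongruentOne_pauli a b _ (mulVec_mem_of_mem_cliffordGroup hA hx)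
    refine ⟨A.1ᵀ *ᵥ y, transpose_mulVec_mem_of_mem_cliffordGroup hA hy, ?_⟩
    rw [hval, ← Matrix.mulVec_mulVec, ← Matrix.mulVec_mulVec, h, Matrix.mulVec_add,
      Matrix.mulVec_mulVec, transpose_mul_of_orthogonal, Matrix.one_mulVec, Matrix.mulVec_smul]
  rw [← hval]
  refine exists_eq_pauli (mul_transpose_of_orthogonal _) fun c d => ?_
  exact mul_eq_or_eq_neg_of_isCongruentOne hmem (pauli_mem_cliffordGroup c d) hcong
    (isCongruentOne_pauli c d)

end Pauli

/-! ### Invariants built from the Pauli matrices. -/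

section Invariants

variable {m : ℕ}

/-- The quadratic form of a matrix. -/
def quadForm (B : Matrix (Idx m) (Idx m) ℝ) : MvPolynomial (Idx m) ℝ :=
  ∑ u, ∑ w, C (B u w) * (X u * X w)

lemma quadForm_neg (B : Matrix (Idx m) (Idx m) ℝ) : quadForm (-B) = -quadForm B := by
  simp [quadForm]

lemma isHomogeneous_quadForm (B : Matrix (Idx m) (Idx m) ℝ) : (quadForm B).IsHomogeneous 2 := by
  refine IsHomogeneous.sum _ _ _ fun u _ => IsHomogeneous.sum _ _ _ fun w _ => ?_
  have := (isHomogeneous_C (Idx m) (B u w)).mul ((isHomogeneous_X ℝ u).mul (isHomogeneous_X ℝ w))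
  simpa using this

lemma eval_quadForm (B : Matrix (Idx m) (Idx m) ℝ) (x : Idx m → ℝ) :
    eval x (quadForm B) = x ⬝ᵥ B *ᵥ x := by
  simp only [quadForm, map_sum, map_mul, eval_C, eval_X, dotProduct, Matrix.mulVec,
    Finset.mul_sum]
  exact Finset.sum_congr rfl fun u _ => Finset.sum_congr rfl fun w _ => by ring

lemma eval_substitute (A : Matrix (Idx m) (Idx m) ℝ) (x : Idx m → ℝ)
    (p : MvPolynomial (Idx m) ℝ) : eval x (substitute A p) = eval (A *ᵥ x) p := by
  induction p using MvPolynomial.induction_on with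
  | C c => simp [substitute]
  | add p q hp hq => simp [hp, hq]
  | mul_X p i hp => simp [hp, substitute_X, Matrix.mulVec, dotProduct]

lemma substitute_quadForm (A B : Matrix (Idx m) (Idx m) ℝ) :
    substitute A (quadForm B) = quadForm (Aᵀ * B * A) := by
  refine MvPolynomial.funext fun x => ?_
  rw [eval_substitute, eval_quadForm, eval_quadForm, ← Matrix.mulVec_mulVec,
    ← Matrix.mulVec_mulVec, Matrix.dotProduct_mulVec x, Matrix.vecMul_transpose]

/-- The sum of the `k`-th powers of the quadratic forms of the Pauli matrices. -/
def pauliSum (m k : ℕ) : MvPolynomial (Idx m) ℝ :=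
  ∑ p : Idx m × Idx m, quadForm (pauli p.1 p.2) ^ k

/-- Conjugation by an element of the Clifford group permutes the Pauli matrices up to sign, and an
even exponent removes the signs. -/
lemma pauliSum_mem {k : ℕ} (hk : Even k) :
    pauliSum m k ∈ homogeneousInvariants (cliffordGroup m) (2 * k) := by
  refine ⟨IsHomogeneous.sum _ _ _ fun p _ => (isHomogeneous_quadForm _).pow k, fun A hA => ?_⟩
  choose f g hfg using exists_conj_pauli hA
  have hsub : ∀ a b, substitute A.1 (quadForm (pauli a b)) ^ k =
      quadForm (pauli (f a b) (g a b)) ^ k := by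
    intro a b
    rw [substitute_quadForm]
    rcases hfg a b with h | h
    · rw [h]
    · rw [h, quadForm_neg, hk.neg_pow]
  have hcancel : ∀ B C : Matrix (Idx m) (Idx m) ℝ, A.1ᵀ * B * A.1 = A.1ᵀ * C * A.1 → B = C := by
    intro B C h
    have h1 := congrArg (fun M => A.1 * M * A.1ᵀ) h
    simpa only [Matrix.mul_assoc, mul_transpose_of_orthogonal, Matrix.mul_one,
      ← Matrix.mul_assoc A.1 A.1ᵀ, Matrix.one_mul] using h1
  have hinj : Function.Injective fun p : Idx m × Idx m => (f p.1 p.2, g p.1 p.2) := by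
    rintro ⟨a, b⟩ ⟨a', b'⟩ h
    obtain ⟨h1, h2⟩ := Prod.mk.inj h
    dsimp only at h1 h2
    have h3 := hfg a b
    have h4 := hfg a' b'
    rw [← h1, ← h2] at h4
    obtain ⟨ha, hb⟩ : a = a' ∧ b = b' := by
      refine pauli_injective ?_
      rcases h3 with h3 | h3 <;> rcases h4 with h4 | h4
      · exact Or.inl (hcancel _ _ (h3.trans h4.symm))
      · refine Or.inr (hcancel _ _ ?_)
        rw [Matrix.mul_neg, Matrix.neg_mul, h3, h4, neg_neg]
      · refine Or.inr (hcancel _ _ ?_)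
        rw [Matrix.mul_neg, Matrix.neg_mul, h3, h4]
      · exact Or.inl (hcancel _ _ (h3.trans h4.symm))
    rw [ha, hb]
  rw [pauliSum, map_sum]
  simp only [map_pow, hsub]
  exact (Finite.injective_iff_bijective.mp hinj).sum_comp
    fun p : Idx m × Idx m => quadForm (pauli p.1 p.2) ^ k

lemma mul_mem_homogeneousInvariants {G : Subgroup (Matrix.orthogonalGroup (Idx m) ℝ)} {d e : ℕ}
    {p q : MvPolynomial (Idx m) ℝ} (hp : p ∈ homogeneousInvariants G d)
    (hq : q ∈ homogeneousInvariants G e) : p * q ∈ homogeneousInvariants G (d + e) :=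
  ⟨hp.1.mul hq.1, fun A hA => by rw [map_mul, hp.2 A hA, hq.2 A hA]⟩

lemma normSq_pow_mem (G : Subgroup (Matrix.orthogonalGroup (Idx m) ℝ)) (a : ℕ) :
    normSq (Idx m) ^ a ∈ homogeneousInvariants G (2 * a) :=
  ⟨isHomogeneous_normSq.pow a, fun A _ => by
    rw [map_pow, substitute_normSq (transpose_mul_of_orthogonal A)]⟩

lemma normSq_ne_zero : normSq (Idx m) ≠ 0 := by
  intro h
  have h1 := congrArg (eval fun _ => (1 : ℝ)) h
  simp [normSq] at h1

/-- Multiplication by the norm form embeds the invariants of one degree in those of the next. -/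
lemma finrank_le_finrank_add_two (G : Subgroup (Matrix.orthogonalGroup (Idx m) ℝ)) (d : ℕ) :
    Module.finrank ℝ (homogeneousInvariants G d) ≤
      Module.finrank ℝ (homogeneousInvariants G (d + 2)) := by
  let f : homogeneousInvariants G d →ₗ[ℝ] homogeneousInvariants G (d + 2) :=
    ((LinearMap.mulRight ℝ (normSq (Idx m))).domRestrict _).codRestrict _ fun p =>
      mul_mem_homogeneousInvariants p.2 (by simpa using normSq_pow_mem G 1)
  refine LinearMap.finrank_le_finrank_of_injective (f := f) fun p q h => Subtype.ext ?_
  exact mul_right_cancel₀ normSq_ne_zero (congrArg Subtype.val h)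

lemma one_le_finrank_zero (G : Subgroup (Matrix.orthogonalGroup (Idx m) ℝ)) :
    1 ≤ Module.finrank ℝ (homogeneousInvariants G 0) := by
  have h : (⟨1, by simpa using normSq_pow_mem G 0⟩ : homogeneousInvariants G 0) ≠ 0 :=
    fun h => one_ne_zero (congrArg Subtype.val h)
  have : Nontrivial (homogeneousInvariants G 0) := ⟨_, _, h⟩
  exact Module.finrank_pos

lemma dotProduct_pureTensor (v w : Fin m → Fin 2 → ℝ) :
    pureTensor v ⬝ᵥ pureTensor w = ∏ i, v i ⬝ᵥ w i := by
  simp only [dotProduct, pureTensor, ← Finset.prod_mul_distrib, Finset.prod_univ_sum,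
    Fintype.piFinset_univ]

lemma eval_normSq_pureTensor (v : Fin m → Fin 2 → ℝ) :
    eval (pureTensor v) (normSq (Idx m)) = ∏ i, v i ⬝ᵥ v i := by
  rw [← dotProduct_pureTensor]
  simp [normSq, dotProduct, pow_two]

/-- The value at a point of the plane of the sum of the `k`-th powers of the quadratic forms of
the four Pauli matrices. -/
def pauliPowerSum (k : ℕ) (x : Fin 2 → ℝ) : ℝ := ∑ s, ∑ t, (x ⬝ᵥ pauliTwo s t *ᵥ x) ^ k

/-- On a pure tensor each Pauli form is a product of planar forms, so the sum over all Pauli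
matrices factorises. -/
lemma eval_pauliSum_pureTensor (k : ℕ) (v : Fin m → Fin 2 → ℝ) :
    eval (pureTensor v) (pauliSum m k) = ∏ i, pauliPowerSum k (v i) := by
  simp only [pauliPowerSum, pauliSum, map_sum, map_pow, eval_quadForm, pauli, kronecker_mulVec,
    dotProduct_pureTensor, ← Finset.prod_pow, Fintype.sum_prod_type, Finset.prod_univ_sum,
    Fintype.piFinset_univ]

end Invariants

/-! ### Linear independence of the invariants. -/

section Independence

/-- The four planar forms are `x² + y²`, `x² - y²`, `2xy` and `0`. The hypothesis `k ≠ 0` makes the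
last one contribute nothing. -/
lemma pauliPowerSum_two_one (k : ℕ) (hk : k ≠ 0) :
    pauliPowerSum k ![2, 1] = 5 ^ k + 3 ^ k + 4 ^ k := by
  simp only [pauliPowerSum, Fin.sum_univ_two, pauliTwo_zero_zero, pauliTwo_zero_one, pauliTwo_one_zero,
    pauliTwo_one_one]
  norm_num [Matrix.mulVec, dotProduct, Fin.sum_univ_two, hk]

lemma pauliPowerSum_one_zero (k : ℕ) (hk : k ≠ 0) :
    pauliPowerSum k ![1, 0] = 2 := by
  simp only [pauliPowerSum, Fin.sum_univ_two, pauliTwo_zero_zero, pauliTwo_zero_one, pauliTwo_one_zero,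
    pauliTwo_one_one]
  norm_num [Matrix.mulVec, dotProduct, Fin.sum_univ_two, hk]

/-- The points `(1, 0)` and `(2, 1)` in the first factor separate the two invariants; each remaining
factor `(1, 0)` contributes 1 to the norm and 2 to the Pauli sum. -/
lemma two_le_finrank_eight {m : ℕ} (hm : 1 ≤ m) :
    2 ≤ Module.finrank ℝ (homogeneousInvariants (cliffordGroup m) 8) := by
  obtain ⟨n, rfl⟩ := Nat.exists_eq_add_of_le' hm
  let p : homogeneousInvariants (cliffordGroup (n + 1)) 8 :=
    ⟨normSq _ ^ 4, normSq_pow_mem _ 4⟩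
  let q : homogeneousInvariants (cliffordGroup (n + 1)) 8 :=
    ⟨pauliSum (n + 1) 4, pauliSum_mem (k := 4) (by decide)⟩
  have hli : LinearIndependent ℝ ![p, q] := by
    rw [LinearIndependent.pair_iff]
    intro a b h
    have hx : ∀ x : Fin 2 → ℝ, a * (x ⬝ᵥ x) ^ 4 +
        b * (pauliPowerSum 4 x * 2 ^ n) = 0 := by
      intro x
      have h1 := congrArg (fun r => eval (pureTensor (Fin.cons x fun _ : Fin n => ![1, 0])) r.1) h
      simpa [p, q, smul_eval, eval_normSq_pureTensor, eval_pauliSum_pureTensor,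
        Fin.prod_univ_succ, pauliPowerSum_one_zero] using h1
    have h1 := hx ![1, 0]
    have h2 := hx ![2, 1]
    rw [pauliPowerSum_one_zero 4 (by decide)] at h1
    rw [pauliPowerSum_two_one 4 (by decide)] at h2
    norm_num [dotProduct, Fin.sum_univ_two] at h1 h2
    have hb : b * 2 ^ n = 0 := by linarith
    have ha : a = 0 := by linarith
    exact ⟨ha, (mul_eq_zero.mp hb).resolve_right (by positivity)⟩
  simpa using hli.fintype_card_le_finrank

/-- Two tensor factors, filled from `(1, 0)` and `(2, 1)`, give three test points whose linear
system in the three coefficients is nonsingular. -/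
lemma three_le_finrank_twelve {m : ℕ} (hm : 2 ≤ m) :
    3 ≤ Module.finrank ℝ (homogeneousInvariants (cliffordGroup m) 12) := by
  obtain ⟨n, rfl⟩ := Nat.exists_eq_add_of_le' hm
  let p : homogeneousInvariants (cliffordGroup (n + 2)) 12 :=
    ⟨normSq _ ^ 6, normSq_pow_mem _ 6⟩
  let q : homogeneousInvariants (cliffordGroup (n + 2)) 12 :=
    ⟨normSq _ ^ 2 * pauliSum (n + 2) 4, mul_mem_homogeneousInvariants (d := 4) (e := 8)
      (normSq_pow_mem _ 2) (pauliSum_mem (k := 4) (by decide))⟩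
  let r : homogeneousInvariants (cliffordGroup (n + 2)) 12 :=
    ⟨pauliSum (n + 2) 6, pauliSum_mem (k := 6) (by decide)⟩
  have hli : LinearIndependent ℝ ![p, q, r] := by
    rw [Fintype.linearIndependent_iff]
    intro g h
    rw [Fin.sum_univ_three] at h
    have hxy : ∀ x y : Fin 2 → ℝ, g 0 * ((x ⬝ᵥ x) * (y ⬝ᵥ y)) ^ 6 +
        g 1 * (((x ⬝ᵥ x) * (y ⬝ᵥ y)) ^ 2 * (pauliPowerSum 4 x *
          (pauliPowerSum 4 y * 2 ^ n))) +
        g 2 * (pauliPowerSum 6 x *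
          (pauliPowerSum 6 y * 2 ^ n)) = 0 := by
      intro x y
      have h1 := congrArg (fun r => eval (pureTensor
        (Fin.cons x (Fin.cons y fun _ : Fin n => ![1, 0]))) r.1) h
      simpa [p, q, r, smul_eval, eval_normSq_pureTensor, eval_pauliSum_pureTensor,
        Fin.prod_univ_succ, pauliPowerSum_one_zero] using h1
    have h1 := hxy ![1, 0] ![1, 0]
    have h2 := hxy ![2, 1] ![1, 0]
    have h3 := hxy ![2, 1] ![2, 1]
    rw [pauliPowerSum_one_zero 4 (by decide),
      pauliPowerSum_one_zero 6 (by decide)] at h1 h2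
    rw [pauliPowerSum_two_one 4 (by decide),
      pauliPowerSum_two_one 6 (by decide)] at h2 h3
    norm_num [dotProduct, Fin.sum_univ_two] at h1 h2 h3
    have hb : g 1 * 2 ^ n = 0 := by linarith
    have hc : g 2 * 2 ^ n = 0 := by linarith
    have ha : g 0 = 0 := by linarith
    have hn : (2 : ℝ) ^ n ≠ 0 := by positivity
    intro i
    fin_cases i
    · exact ha
    · exact (mul_eq_zero.mp hb).resolve_right hn
    · exact (mul_eq_zero.mp hc).resolve_right hn
  simpa using hli.fintype_card_le_finrank

end Independence

end BarnesWall

end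


/-! ### The Molien coefficients. -/

theorem mainTheorem4 (m : ℕ) (hm : 1 ≤ m) :
    (PowerSeries.X : PowerSeries ℤ) ^ 12 ∣
        BarnesWall.molienSeries (BarnesWall.cliffordGroup m) -
          (1 + PowerSeries.X ^ 2 + PowerSeries.X ^ 4 + PowerSeries.X ^ 6
            + 2 * PowerSeries.X ^ 8 + 2 * PowerSeries.X ^ 10) ∧
      (m = 1 → PowerSeries.coeff 12
        (BarnesWall.molienSeries (BarnesWall.cliffordGroup m)) = 2) ∧
      (1 < m → PowerSeries.coeff 12
        (BarnesWall.molienSeries (BarnesWall.cliffordGroup m)) = 3) := by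
  have hG := BarnesWall.containsGenerators_cliffordGroup m
  obtain ⟨F, hF⟩ : ∃ F : ℕ → ℕ, ∀ d, Module.finrank ℝ
      (BarnesWall.homogeneousInvariants (BarnesWall.cliffordGroup m) d) = F d := ⟨_, fun _ => rfl⟩
  have hcoeff : ∀ d, PowerSeries.coeff d
      (BarnesWall.molienSeries (BarnesWall.cliffordGroup m)) = F d := fun d => by
    rw [BarnesWall.molienSeries, PowerSeries.coeff_mk, hF]
  have hodd : ∀ d, Odd d → F d = 0 := fun d hd => by rw [← hF, hG.finrank_odd hm hd]
  have hmono : ∀ d, F d ≤ F (d + 2) := fun d => by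
    simpa only [hF] using BarnesWall.finrank_le_finrank_add_two (BarnesWall.cliffordGroup m) d
  have hle : ∀ d, (d = 0 ∨ d = 2 ∨ d = 4 ∨ d = 8) → F (d + 2) ≤ F d := fun d hd => by
    simpa only [hF] using hG.finrank_le hm hd
  have hadd : ∀ d, (d = 6 ∨ d = 10) → F (d + 2) ≤ F d + 1 := fun d hd => by
    simpa only [hF] using hG.finrank_le_add_one hm hd
  have h0 : F 0 = 1 := by
    rw [← hF]
    exact le_antisymm BarnesWall.finrank_zero_le (BarnesWall.one_le_finrank_zero _)
  have h2 : F 2 = 1 := by rw [← h0]; exact le_antisymm (hle 0 (by omega)) (hmono 0)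
  have h4 : F 4 = 1 := by rw [← h2]; exact le_antisymm (hle 2 (by omega)) (hmono 2)
  have h6 : F 6 = 1 := by rw [← h4]; exact le_antisymm (hle 4 (by omega)) (hmono 4)
  have h8 : F 8 = 2 := by
    refine le_antisymm ((hadd 6 (by omega)).trans_eq (by rw [h6])) ?_
    rw [← hF]
    exact BarnesWall.two_le_finrank_eight hm
  have h10 : F 10 = 2 := by rw [← h8]; exact le_antisymm (hle 8 (by omega)) (hmono 8)
  refine ⟨PowerSeries.X_pow_dvd_iff.mpr fun d hd => ?_, fun h => ?_, fun h => ?_⟩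
  · have htwo : (2 : PowerSeries ℤ) = PowerSeries.C 2 := rfl
    rw [map_sub, sub_eq_zero, htwo, hcoeff]
    simp only [map_add, PowerSeries.coeff_C_mul, PowerSeries.coeff_X_pow, PowerSeries.coeff_one]
    rcases Nat.even_or_odd' d with ⟨k, rfl | rfl⟩
    · have hk : k < 6 := by omega
      interval_cases k <;> simp [h0, h2, h4, h6, h8, h10]
    · have hk : k < 6 := by omega
      rw [hodd _ (odd_two_mul_add_one k)]
      interval_cases k <;> simp
  · rw [hcoeff]
    have h12 : F 12 ≤ F 10 := by
      subst h
      rw [← hF, ← hF]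
      exact hG.finrank_le_rank_one
    exact_mod_cast (le_antisymm h12 (hmono 10)).trans h10
  · rw [hcoeff]
    have h12 : F 12 ≤ 2 + 1 := (hadd 10 (by omega)).trans_eq (by rw [h10])
    have h12' : 3 ≤ F 12 := by
      rw [← hF]
      exact BarnesWall.three_le_finrank_twelve h
    exact_mod_cast le_antisymm h12 h12'
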